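/- Let $N\in\mathbb N$, let $T_\pm$ be orthogonal projectors in $\mathbb C^N$, $T_\pm^\perp=I-T_\pm$, let $a=a^*=T_-^\perp aT_-^\perp$, $b=b^*=T_+^\perp bT_+^\perp$ be $N\times N$ matrices, and let $V=V^*\in L^1([0,1];\mathbb C^{N\times N})$. For vector- or matrix-valued $\psi$ on $[0,1]$ put $$\Gamma_-\psi=T_-^\perp(\psi'(0)-a\psi(0))-T_-\psi(0),\qquad \Gamma_-^\perp\psi=T_-^\perp\psi(0)+T_-\psi'(0),\qquad \Gamma_+\psi=T_+^\perp(\psi'(1)+b\psi(1))-T_+\psi(1).$$ Let $L\psi=-\psi''+V\psi$ on $[0,1]$ with the boundary conditions $\Gamma_-\psi=\Gamma_+\psi=0$. Let $F_-(x,\lambda)$, $\lambda\in\mathbb C$, be the $N\times N$ matrix solution of $-F''+VF=\lambda F$ with $\Gamma_-F_-=0$, $\Gamma_-^\perp F_-=I$, and let $W(\lambda)=(\Gamma_+F_-)(\lambda)$. Let $\lambda_0<\lambda_1<\dots$ be the (real) eigenvalues of $L$, counted without multiplicity, let $P_\alpha$ be the orthogonal projector of $\mathbb C^N$ onto $\mathcal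 E_\alpha=\operatorname{Ker}W(\lambda_\alpha)$, and let $g_\alpha:\mathcal E_\alpha\to\mathcal E_\alpha$ be the restriction to $\mathcal E_\alpha$ of $P_\alpha\int_0^1F_-(x,\lambda_\alpha)^*F_-(x,\lambda_\alpha)\,dx\,P_\alpha$. The set of all triples $(\lambda_\alpha,P_\alpha,g_\alpha)$ is the spectral data of $L$. (i) Let $\zeta$ be an entire matrix-valued function ($m\times N$, $m$ arbitrary) with $\zeta(\lambda_\alpha)P_\alpha=0$ for all $\alpha$. Then $\zeta(\lambda)W(\lambda)^{-1}$ is entire; that is, $W(\lambda)$ is invertible for all $\lambda$ outside a closed discrete subset of $\mathbb C$, and the function $\zeta W^{-1}$, defined where $W$ is invertible, extends to an entire function. (ii) The spectral data satisfy the following algebraic nondegeneracy condition: the only entire function $\xi:\mathbb C\to\mathbb C^N$ such that $P_\alpha\xi(\lambda_\alpha)=0$ for all $\alpha$, $\xi(\lambda)=O(e^{|\operatorname{Im}\sqrt\lambda|})$ as $|\lambda|\to\infty$, and $$T_-^\perp\xi(x)=O(x^{-1/2}),\qquad T_-\xi(x)=O(x^{-1})\qquad\text{as }x\to+\infty,$$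 is $\xi\equiv0$. -/

import Mathlib

open Filter Topology MeasureTheory Asymptotics
open scoped Matrix

noncomputable section

namespace SturmLiouville

/-- The parameters of a vector-valued Sturm--Liouville problem on `[0,1]`: an integrable Hermitian
matrix potential `V`, orthogonal projectors `Tm`, `Tp` (the projectors `T_-`, `T_+`), and
self-adjoint `a`, `b` acting in the ranges of the complementary projectors. Only the values of `V`
on `[0,1]` play a role. -/
structure Problem (N : ℕ) where
  V : ℝ → Matrix (Fin N) (Fin N) ℂ
  Tm : Matrix (Fin N) (Fin N) ℂ
  Tp : Matrix (Fin N) (Fin N) ℂ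
  a : Matrix (Fin N) (Fin N) ℂ
  b : Matrix (Fin N) (Fin N) ℂ
  V_integrable : ∀ i j, IntegrableOn (fun t => V t i j) (Set.Icc 0 1) volume
  V_hermitian : ∀ᵐ t ∂(volume.restrict (Set.Icc (0 : ℝ) 1)), (V t).IsHermitian
  Tm_proj : IsStarProjection Tm
  Tp_proj : IsStarProjection Tp
  a_hermitian : a.IsHermitian
  b_hermitian : b.IsHermitian
  a_eq : a = (1 - Tm) * a * (1 - Tm)
  b_eq : b = (1 - Tp) * b * (1 - Tp)

variable {N : ℕ}

/-- `ψ` (with derivative `ψ'`) is a solution on `[0,1]` of `-ψ'' + V ψ = z ψ`: `ψ` is continuously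
differentiable with derivative `ψ'`, and `ψ'` is absolutely continuous with `ψ'' = (V - z) ψ`
almost everywhere, both written in integrated form. The number of columns of `ψ` is arbitrary
(`κ = Fin N` for square matrix solutions, `κ = Unit` for column vectors). -/
structure IsSolution {κ : Type} (V : ℝ → Matrix (Fin N) (Fin N) ℂ) (z : ℂ)
    (ψ ψ' : ℝ → Matrix (Fin N) κ ℂ) : Prop where
  cont : ∀ i j, ContinuousOn (fun x => ψ x i j) (Set.Icc 0 1)
  cont' : ∀ i j, ContinuousOn (fun x => ψ' x i j) (Set.Icc 0 1)
  eq : ∀ x ∈ Set.Icc (0 : ℝ) 1, ∀ i j, ψ x i j = ψ 0 i j + ∫ t in (0 : ℝ)..x, ψ' t i j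
  eq' : ∀ x ∈ Set.Icc (0 : ℝ) 1, ∀ i j,
    ψ' x i j = ψ' 0 i j + ∫ t in (0 : ℝ)..x, (V t * ψ t - z • ψ t) i j

namespace Problem

variable (p : Problem N)

/-- The boundary map `Γ_- ψ = T_-^⊥ (ψ'(0) - a ψ(0)) - T_- ψ(0)`. -/
def Γm {κ : Type} (ψ ψ' : ℝ → Matrix (Fin N) κ ℂ) : Matrix (Fin N) κ ℂ :=
  (1 - p.Tm) * (ψ' 0 - p.a * ψ 0) - p.Tm * ψ 0

/-- The boundary map `Γ_-^⊥ ψ = T_-^⊥ ψ(0) + T_- ψ'(0)`. -/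
def ΓmPerp {κ : Type} (ψ ψ' : ℝ → Matrix (Fin N) κ ℂ) : Matrix (Fin N) κ ℂ :=
  (1 - p.Tm) * ψ 0 + p.Tm * ψ' 0

/-- The boundary map `Γ_+ ψ = T_+^⊥ (ψ'(1) + b ψ(1)) - T_+ ψ(1)`. -/
def Γp {κ : Type} (ψ ψ' : ℝ → Matrix (Fin N) κ ℂ) : Matrix (Fin N) κ ℂ :=
  (1 - p.Tp) * (ψ' 1 + p.b * ψ 1) - p.Tp * ψ 1

/-- `z` is an eigenvalue of the operator `L ψ = -ψ'' + V ψ` with the boundary conditions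
`Γ_- ψ = Γ_+ ψ = 0`: there is an eigenfunction, i.e. a solution of `-ψ'' + V ψ = z ψ` on `[0,1]`
satisfying the boundary conditions and not vanishing identically on `[0,1]`. -/
def IsEigenvalue (z : ℂ) : Prop :=
  ∃ ψ ψ' : ℝ → Matrix (Fin N) Unit ℂ, IsSolution p.V z ψ ψ' ∧ p.Γm ψ ψ' = 0 ∧ p.Γp ψ ψ' = 0 ∧
    ∃ x ∈ Set.Icc (0 : ℝ) 1, ψ x ≠ 0

/-- The fundamental solution `F_-(·, z)` paired with its derivative: the `N × N` matrix solution
with `Γ_- F_- = 0` and `Γ_-^⊥ F_- = I` (these conditions determine both functions on `[0,1]`). -/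
def fundamental (z : ℂ) : (ℝ → Matrix (Fin N) (Fin N) ℂ) × (ℝ → Matrix (Fin N) (Fin N) ℂ) :=
  Classical.epsilon fun F => IsSolution p.V z F.1 F.2 ∧ p.Γm F.1 F.2 = 0 ∧ p.ΓmPerp F.1 F.2 = 1

/-- `F_-(x, z)`. -/
def Fm (x : ℝ) (z : ℂ) : Matrix (Fin N) (Fin N) ℂ := (p.fundamental z).1 x

/-- The matrix function `W(z) = (Γ_+ F_-)(z)`. -/
def W (z : ℂ) : Matrix (Fin N) (Fin N) ℂ := p.Γp (p.fundamental z).1 (p.fundamental z).2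

/-- The subspace `Ker W(μ)` of `ℂ^N`. -/
def E (μ : ℝ) : Submodule ℂ (EuclideanSpace ℂ (Fin N)) :=
  LinearMap.ker (Matrix.toEuclideanLin (p.W μ))

/-- The matrix `S = ∫₀¹ F_-(x, μ)^* F_-(x, μ) dx`. -/
def S (μ : ℝ) : Matrix (Fin N) (Fin N) ℂ :=
  Matrix.of fun i j => ∫ x in (0 : ℝ)..1, ((p.Fm x μ)ᴴ * p.Fm x μ) i j

/-- The operator `g = (P S P)|_E` on `E = Ker W(μ)`, with `P` the orthogonal projector
onto `E`. -/
def g (μ : ℝ) : p.E μ →ₗ[ℂ] p.E μ :=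
  ((p.E μ).orthogonalProjectionOnto : EuclideanSpace ℂ (Fin N) →ₗ[ℂ] p.E μ) ∘ₗ
    Matrix.toEuclideanLin (p.S μ) ∘ₗ (p.E μ).subtype

end Problem

/-- A triple `(μ, P, g)`; the orthogonal projector `P` is recorded through its range `E`, on which
`g` acts. -/
structure SpectralTriple (N : ℕ) where
  μ : ℝ
  E : Submodule ℂ (EuclideanSpace ℂ (Fin N))
  g : E →ₗ[ℂ] E

/-- The matrix of the orthogonal projector onto `E`. -/
def SpectralTriple.P (τ : SpectralTriple N) : Matrix (Fin N) (Fin N) ℂ :=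
  Matrix.toEuclideanLin.symm (τ.E.starProjection : EuclideanSpace ℂ (Fin N) →ₗ[ℂ] _)

/-- The spectral data of the problem: the set of all triples `(μ, P, g)`, where `μ` runs over the
eigenvalues. -/
def Problem.spectralData (p : Problem N) : Set (SpectralTriple N) :=
  {τ | ∃ μ : ℝ, p.IsEigenvalue μ ∧ τ = ⟨μ, p.E μ, p.g μ⟩}

/-- A matrix-valued function on `ℂ` is entire. -/
def IsEntire {m n : ℕ} (f : ℂ → Matrix (Fin m) (Fin n) ℂ) : Prop :=
  ∀ i j, Differentiable ℂ fun z => f z i j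

/-- The algebraic nondegeneracy condition for a set `D` of spectral triples, relative to the
projector `Tm`. (The choice of the norm of `ℂ^N` in the `O`-conditions and of the branch of the
square root is immaterial.) -/
def AlgebraicallyNondegenerate (Tm : Matrix (Fin N) (Fin N) ℂ) (D : Set (SpectralTriple N)) :
    Prop :=
  ∀ ξ : ℂ → Fin N → ℂ, Differentiable ℂ ξ →
    (∀ τ ∈ D, τ.P *ᵥ ξ τ.μ = 0) →
    (ξ =O[Bornology.cobounded ℂ] fun z => Real.exp |(z ^ (1 / 2 : ℂ)).im|) →
    ((fun x : ℝ => (1 - Tm) *ᵥ ξ x) =O[atTop] fun x : ℝ => x ^ (-1 / 2 : ℝ)) →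
    ((fun x : ℝ => Tm *ᵥ ξ x) =O[atTop] fun x : ℝ => x ^ (-1 : ℝ)) →
    ∀ z, ξ z = 0

end SturmLiouville

end

/-! Everything rests on one a priori estimate. If `u = F_- v` solves the equation at `z`, it
satisfies the condition at `0`, and Lagrange's identity turns `|Im z| ∫ |u|²` into a boundary term
at `1` that is linear in `W(z) v`. A solution and its derivative are controlled by the `L²`-norm
with constants polynomial in `|z|`, so `|Im z| ‖v‖ ≤ C (1 + |z|)³ ‖W(z) v‖`
(`IsVectorSolution.abs_im_mul_le`, `Problem.exists_norm_le_norm_op_W`).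

Part (i). Hence `det W` vanishes only at real points, its zeros are isolated, and `W⁻¹` has at most
simple poles, because it is `O(1 / |Im z|)` along the vertical line through a pole. The residue `R`
at `μ` satisfies `W(μ) R = 0`, so its columns lie in `Ker W(μ)`, the range of the spectral projector
`P`. Thus `ζ(μ) R = ζ(μ) P R = 0` and the pole of `ζ W⁻¹` disappears
(`Problem.exists_tendsto_sub_mul_inv_W`, `Problem.exists_entire_eq_mul_inv_W`).

Part (ii). Apply (i) to the row `ζ(z) = ξ(z̄)^*`: then `ξ(z̄)^* = e(z)^* W(z)` with `e^*` entire.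
The a priori estimate shows that `e` grows at most like `exp(B √|z|)`. For `z = k²` with `Im k`
large, `W(k²)` is bounded below by a multiple of `e^{Im k} / |k|`
(`Problem.exists_exp_mul_norm_le_norm_op_W`); this cancels the growth of `ξ` and gives `e =
O(|z|^{1/2})` on the imaginary axis. Phragmén–Lindelöf in the left and right half-planes extends
this bound to the whole plane, so `e` is constant (`eq_const_of_growth`).

Finally, on the positive half-line `e^* W(κ²)` decays in the sense of the last hypotheses on `ξ`,
whereas `W(κ²)`, suitably scaled, is a trigonometric polynomial up to `O(1/κ)`. Comparison at `κ ∈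
2πℕ` and `κ ∈ π/2 + 2πℕ` kills first `T_+^⊥ e` and then `T_+ e` (`Problem.eq_zero_of_inner_op_W`),
hence `ξ = 0`. -/

namespace SturmLiouville
-- Absolutely continuous vector-valued functions and the product rule
section AbsolutelyContinuous

open Set AbsolutelyContinuousOnInterval

variable {E F G : Type*} [NormedAddCommGroup E] [NormedSpace ℝ E] [NormedAddCommGroup F]
  [NormedSpace ℝ F] [NormedAddCommGroup G] [NormedSpace ℝ G]

/-- Increments of the primitive are dominated in norm by those of the primitive of `‖f‖`, which
reduces the claim to the scalar case. -/
theorem absolutelyContinuousOnInterval_integral {f : ℝ → E} {a b : ℝ}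
    (h : IntervalIntegrable f volume a b) :
    AbsolutelyContinuousOnInterval (fun x => ∫ t in a..x, f t) a b := by
  have h1 : AbsolutelyContinuousOnInterval (fun x => ∫ t in a..x, ‖f t‖) a b :=
    h.norm.absolutelyContinuousOnInterval_intervalIntegral left_mem_uIcc
  unfold AbsolutelyContinuousOnInterval at h1 ⊢
  refine squeeze_zero' (.of_forall fun _ => Finset.sum_nonneg fun _ _ => dist_nonneg) ?_ h1
  rw [eventually_inf_principal]
  refine .of_forall fun ⟨n, I⟩ hI => Finset.sum_le_sum fun i hi => ?_
  have hx := (hI.1 i hi).1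
  have hy := (hI.1 i hi).2
  have key : ∀ {g : ℝ → E} (_ : IntervalIntegrable g volume a b),
      IntervalIntegrable g volume a (I i).1
      ∧ IntervalIntegrable g volume a (I i).2 := fun hg =>
    ⟨hg.mono_set (uIcc_subset_uIcc_left hx), hg.mono_set (uIcc_subset_uIcc_left hy)⟩
  have hn := h.norm
  rw [dist_comm, dist_eq_norm, dist_comm, Real.dist_eq,
    intervalIntegral.integral_interval_sub_left (key h).2 (key h).1,
    intervalIntegral.integral_interval_sub_left
      (hn.mono_set (uIcc_subset_uIcc_left hy)) (hn.mono_set (uIcc_subset_uIcc_left hx))]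
  exact intervalIntegral.norm_integral_le_abs_integral_norm

theorem absolutelyContinuousOnInterval_bilinear {b : E × F → G} (hb : IsBoundedBilinearMap ℝ b)
    {f : ℝ → E} {g : ℝ → F} {p q : ℝ} (hf : AbsolutelyContinuousOnInterval f p q)
    (hg : AbsolutelyContinuousOnInterval g p q) :
    AbsolutelyContinuousOnInterval (fun x => b (f x, g x)) p q := by
  obtain ⟨C, hC⟩ := hf.exists_bound
  obtain ⟨D, hD⟩ := hg.exists_bound
  obtain ⟨M, hM0, hM⟩ := hb.bound
  have hlim := (Tendsto.const_mul (M * C) hg).add (Tendsto.const_mul (M * D) hf)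
  rw [mul_zero, mul_zero, add_zero] at hlim
  unfold AbsolutelyContinuousOnInterval
  refine squeeze_zero' (.of_forall fun _ => Finset.sum_nonneg fun _ _ => dist_nonneg) ?_ hlim
  rw [eventually_inf_principal]
  refine .of_forall fun ⟨n, I⟩ hI => ?_
  simp only [Finset.mul_sum, ← Finset.sum_add_distrib]
  refine Finset.sum_le_sum fun i hi => ?_
  have hx := (hI.1 i hi).1
  have hy := (hI.1 i hi).2
  have e : b (f (I i).1, g (I i).1) - b (f (I i).2, g (I i).2)
      = b (f (I i).1, g (I i).1 - g (I i).2) + b (f (I i).1 - f (I i).2, g (I i).2) := by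
    rw [hb.map_sub_right, hb.map_sub_left]; abel
  rw [dist_eq_norm, e, dist_eq_norm, dist_eq_norm]
  refine (norm_add_le _ _).trans (add_le_add ((hM _ _).trans ?_) ((hM _ _).trans ?_))
  · have := hC _ hx
    gcongr
  · have := hD _ hy
    calc _ ≤ M * ‖f (I i).1 - f (I i).2‖ * D := by gcongr
      _ = _ := by ring

theorem intervalIntegrable_bilinear_right {b : E × F → G} (hb : IsBoundedBilinearMap ℝ b)
    {f : ℝ → E} {g : ℝ → F} {p q : ℝ} (hf : ContinuousOn f (uIcc p q))
    (hg : IntervalIntegrable g volume p q) :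
    IntervalIntegrable (fun t => b (f t, g t)) volume p q := by
  obtain ⟨C, hC⟩ := isCompact_uIcc.exists_bound_of_continuousOn hf
  obtain ⟨M, hM0, hM⟩ := hb.bound
  refine (hg.norm.const_mul (M * C)).mono_fun ?_ ?_
  · exact hb.continuous.comp_aestronglyMeasurable
      (((hf.mono uIoc_subset_uIcc).aestronglyMeasurable measurableSet_uIoc).prodMk
        hg.def'.aestronglyMeasurable)
  · refine (ae_restrict_mem measurableSet_uIoc).mono fun t ht => ?_
    refine (hM _ _).trans (le_trans (b := M * C * ‖g t‖) ?_ (Real.le_norm_self _))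
    have := hC _ (uIoc_subset_uIcc ht)
    gcongr

theorem intervalIntegrable_bilinear_left {b : E × F → G} (hb : IsBoundedBilinearMap ℝ b)
    {f : ℝ → E} {g : ℝ → F} {p q : ℝ} (hf : IntervalIntegrable f volume p q)
    (hg : ContinuousOn g (uIcc p q)) :
    IntervalIntegrable (fun t => b (f t, g t)) volume p q := by
  obtain ⟨C, hC⟩ := isCompact_uIcc.exists_bound_of_continuousOn hg
  obtain ⟨M, hM0, hM⟩ := hb.bound
  refine (hf.norm.const_mul (M * C)).mono_fun ?_ ?_
  · exact hb.continuous.comp_aestronglyMeasurable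
      (hf.def'.aestronglyMeasurable.prodMk
        ((hg.mono uIoc_subset_uIcc).aestronglyMeasurable measurableSet_uIoc))
  · refine (ae_restrict_mem measurableSet_uIoc).mono fun t ht => ?_
    refine (hM _ _).trans (le_trans (b := M * C * ‖f t‖) ?_ (Real.le_norm_self _))
    have := hC _ (uIoc_subset_uIcc ht)
    calc _ ≤ M * ‖f t‖ * C := by gcongr
      _ = _ := by ring

theorem absolutelyContinuousOnInterval_const {H : Type*} [NormedAddCommGroup H]
    (c : H) (p q : ℝ) :
    AbsolutelyContinuousOnInterval (fun _ : ℝ => c) p q := by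
  simpa [AbsolutelyContinuousOnInterval] using tendsto_const_nhds

/-- The fundamental theorem of calculus for a product of two absolutely continuous functions. -/
theorem integral_bilinear_deriv [CompleteSpace E] [CompleteSpace F] [CompleteSpace G]
    {b : E × F → G} (hb : IsBoundedBilinearMap ℝ b)
    {f f' : ℝ → E} {g g' : ℝ → F} {x : ℝ} (hx : 0 ≤ x)
    (hf' : IntervalIntegrable f' volume 0 x) (hg' : IntervalIntegrable g' volume 0 x)
    (hf : ∀ t ∈ Icc 0 x, f t = f 0 + ∫ s in (0 : ℝ)..t, f' s)
    (hg : ∀ t ∈ Icc 0 x, g t = g 0 + ∫ s in (0 : ℝ)..t, g' s) :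
    ∫ t in (0 : ℝ)..x, (b (f t, g' t) + b (f' t, g t)) = b (f x, g x) - b (f 0, g 0) := by
  -- These primitives agree with `f` and `g` on `[0, x]` and are absolutely continuous and
  -- differentiable almost everywhere by construction. The difference of the two sides then has zero
  -- derivative almost everywhere, so it is constant.
  set φ : ℝ → E := fun t => f 0 + ∫ s in (0 : ℝ)..t, f' s with hφ
  set γ : ℝ → F := fun t => g 0 + ∫ s in (0 : ℝ)..t, g' s with hγ
  have acφ : AbsolutelyContinuousOnInterval φ 0 x :=
    (absolutelyContinuousOnInterval_const (f 0) 0 x).fun_add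
      (absolutelyContinuousOnInterval_integral hf')
  have acγ : AbsolutelyContinuousOnInterval γ 0 x :=
    (absolutelyContinuousOnInterval_const (g 0) 0 x).fun_add
      (absolutelyContinuousOnInterval_integral hg')
  have hint : IntervalIntegrable (fun t => b (φ t, g' t) + b (f' t, γ t)) volume 0 x :=
    (intervalIntegrable_bilinear_right hb acφ.continuousOn hg').add
    (intervalIntegrable_bilinear_left hb hf' acγ.continuousOn)
  have aci := absolutelyContinuousOnInterval_integral hint
  have ac := (absolutelyContinuousOnInterval_bilinear hb acφ acγ).fun_sub aci
  obtain ⟨C, hC⟩ := ac.const_of_ae_hasDerivAt_zero (by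
    filter_upwards [hf'.ae_hasDerivAt_integral, hg'.ae_hasDerivAt_integral,
      hint.ae_hasDerivAt_integral] with t h1 h2 h3 ht
    have d1 : HasDerivAt φ (f' t) t := (h1 ht 0 left_mem_uIcc).const_add _
    have d2 : HasDerivAt γ (g' t) t := (h2 ht 0 left_mem_uIcc).const_add _
    have d3 := h3 ht 0 left_mem_uIcc
    have d4 := (hb.hasFDerivAt (φ t, γ t)).comp_hasDerivAt t (d1.prodMk d2)
    simpa [IsBoundedBilinearMap.deriv, Function.comp_def] using d4.fun_sub d3)
  have e0 := hC 0 left_mem_uIcc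
  have e1 := hC x right_mem_uIcc
  simp only [intervalIntegral.integral_same, sub_zero] at e0
  rw [← e0, sub_eq_iff_eq_add, ← sub_eq_iff_eq_add'] at e1
  have hm : ∀ t ∈ Icc 0 x, φ t = f t ∧ γ t = g t := fun t ht => ⟨(hf t ht).symm, (hg t ht).symm⟩
  rw [(hm x ⟨hx, le_rfl⟩).1, (hm x ⟨hx, le_rfl⟩).2, (hm 0 ⟨le_rfl, hx⟩).1,
    (hm 0 ⟨le_rfl, hx⟩).2] at e1
  rw [e1]
  refine intervalIntegral.integral_congr fun t ht => ?_
  rw [uIcc_of_le hx] at ht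
  simp only [(hm t ht).1, (hm t ht).2]

end AbsolutelyContinuous
-- Volterra operators with integrable kernels
section Volterra

open Set unitInterval

variable {F : Type*} [NormedAddCommGroup F] [NormedSpace ℂ F]

theorem isBoundedBilinearMap_apply_real {F' : Type*} [NormedAddCommGroup F'] [NormedSpace ℂ F'] :
    IsBoundedBilinearMap ℝ fun p : (F →L[ℂ] F') × F => p.1 p.2 where
  add_left _ _ _ := rfl
  smul_left _ _ _ := rfl
  add_right x := x.map_add
  smul_right c x y := by simp
  bound := ⟨1, one_pos, fun x y => by simpa using x.le_opNorm y⟩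

/-- Split at `x - δ/2`. On the near piece the mass of `g` is at most `1/4` by uniform continuity of
its primitive; on the far piece the weight gains `e^{-cδ/2}`, which for large `c` brings the total
mass below `1/4`. -/
theorem exists_weight_integral_le {g : ℝ → ℝ} (hg : IntervalIntegrable g volume 0 1)
    (h0 : ∀ t, 0 ≤ g t) :
    ∃ c : ℝ, 0 ≤ c ∧ ∀ x ∈ Icc (0 : ℝ) 1,
      ∫ t in (0 : ℝ)..x, g t * Real.exp (c * t) ≤ Real.exp (c * x) / 2 := by
  set G : ℝ → ℝ := fun x => ∫ t in (0 : ℝ)..x, g t with hG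
  have hgi : ∀ x ∈ Icc (0 : ℝ) 1, ∀ y ∈ Icc (0 : ℝ) 1, IntervalIntegrable g volume x y :=
    fun x hx y hy => hg.mono_set (uIcc_subset_uIcc (by rwa [uIcc_of_le zero_le_one])
      (by rwa [uIcc_of_le zero_le_one]))
  have hac := (absolutelyContinuousOnInterval_integral hg).uniformContinuousOn
  rw [uIcc_of_le zero_le_one, Metric.uniformContinuousOn_iff] at hac
  obtain ⟨δ, hδ, hδ'⟩ := hac (1 / 4) (by norm_num)
  have hG1 : 0 ≤ G 1 := intervalIntegral.integral_nonneg zero_le_one fun t _ => h0 t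
  obtain ⟨c, hc0, hc⟩ : ∃ c : ℝ, 0 ≤ c ∧ Real.exp (-(c * (δ / 2))) * G 1 ≤ 1 / 4 := by
    have : Tendsto (fun c : ℝ => Real.exp (-(c * (δ / 2))) * G 1) atTop (𝓝 (0 * G 1)) :=
      (Real.tendsto_exp_neg_atTop_nhds_zero.comp
        (tendsto_id.atTop_mul_const (half_pos hδ))).mul_const _
    rw [zero_mul] at this
    obtain ⟨c, h1, h2⟩ := ((eventually_ge_atTop 0).and
      (this.eventually (ge_mem_nhds (by norm_num : (0 : ℝ) < 1 / 4)))).exists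
    exact ⟨c, h1, h2⟩
  refine ⟨c, hc0, fun x hx => ?_⟩
  set y := max 0 (x - δ / 2) with hy
  have hyx : y ≤ x := max_le hx.1 (by linarith)
  have hyI : y ∈ Icc (0 : ℝ) 1 := ⟨le_max_left _ _, hyx.trans hx.2⟩
  have h0I : (0 : ℝ) ∈ Icc (0 : ℝ) 1 := ⟨le_rfl, zero_le_one⟩
  have hi : ∀ p ∈ Icc (0 : ℝ) 1, ∀ q ∈ Icc (0 : ℝ) 1,
      IntervalIntegrable (fun t => g t * Real.exp (c * t)) volume p q := fun p hp q hq =>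
    (hgi p hp q hq).mul_continuousOn (by fun_prop)
  have bd : ∀ p ∈ Icc (0 : ℝ) 1, ∀ q ∈ Icc (0 : ℝ) 1, p ≤ q →
      ∫ t in p..q, g t * Real.exp (c * t) ≤ (∫ t in p..q, g t) * Real.exp (c * q) := by
    intro p hp q hq hpq
    rw [← intervalIntegral.integral_mul_const]
    refine intervalIntegral.integral_mono_on hpq (hi p hp q hq) ((hgi p hp q hq).mul_const _) ?_
    intro t ht
    have := h0 t
    have := ht.2
    gcongr
  rw [← intervalIntegral.integral_add_adjacent_intervals (hi 0 h0I y hyI) (hi y hyI x hx)]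
  have e1 := bd 0 h0I y hyI hyI.1
  have e2 := bd y hyI x hx hyx
  have hsub : ∫ t in y..x, g t = G x - G y :=
    (intervalIntegral.integral_interval_sub_left (hgi 0 h0I x hx) (hgi 0 h0I y hyI)).symm
  have hd := hδ' x hx y hyI (by
    rw [Real.dist_eq, abs_of_nonneg (by linarith)]
    have := le_max_right 0 (x - δ / 2)
    linarith)
  rw [Real.dist_eq] at hd
  have hd := (abs_lt.1 hd).2
  have e3 : (∫ t in (0 : ℝ)..y, g t) * Real.exp (c * y) ≤ 1 / 4 * Real.exp (c * x) := by
    rcases le_total (x - δ / 2) 0 with h | h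
    · rw [hy, max_eq_left h, intervalIntegral.integral_same, zero_mul]
      positivity
    · have hy' : y = x - δ / 2 := max_eq_right h
      have hm : ∫ t in (0 : ℝ)..y, g t ≤ G 1 :=
        intervalIntegral.integral_mono_interval le_rfl hyI.1 hyI.2
          (.of_forall fun t => h0 t) hg
      calc _ ≤ G 1 * Real.exp (c * y) := by gcongr
        _ = Real.exp (-(c * (δ / 2))) * G 1 * Real.exp (c * x) := by
            rw [mul_right_comm, ← Real.exp_add, mul_comm (G 1), hy']
            ring_nf
        _ ≤ _ := by gcongr
  rw [hsub] at e2
  nlinarith [Real.exp_pos (c * x)]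

theorem continuous_comp_projIcc {X : Type*} [TopologicalSpace X] (u : C(I, X)) :
    Continuous fun t : ℝ => u (projIcc 0 1 zero_le_one t) :=
  u.continuous.comp continuous_projIcc

theorem intervalIntegrable_apply {B : ℝ → F →L[ℂ] F} (hB : IntervalIntegrable B volume 0 1)
    {u : ℝ → F} (hu : ContinuousOn u (Icc 0 1)) :
    IntervalIntegrable (fun t => B t (u t)) volume 0 1 :=
  intervalIntegrable_bilinear_left isBoundedBilinearMap_apply_real hB
    (by rwa [uIcc_of_le zero_le_one])

/-- The Volterra operator `u ↦ ∫₀ˣ B u` on continuous functions. -/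
noncomputable def volterra (B : ℝ → F →L[ℂ] F) (hB : IntervalIntegrable B volume 0 1) :
    C(I, F) →L[ℂ] C(I, F) :=
  LinearMap.mkContinuous
    { toFun := fun u => ⟨fun x => ∫ t in (0 : ℝ)..x, B t (u (projIcc 0 1 zero_le_one t)), by
        have := (absolutelyContinuousOnInterval_integral (intervalIntegrable_apply hB
          (continuous_comp_projIcc u).continuousOn)).continuousOn
        rw [uIcc_of_le zero_le_one] at this
        exact continuousOn_iff_continuous_domRestrict.1 this⟩
      map_add' := fun u v => by
        ext x
        have h : ∀ w : C(I, F), IntervalIntegrable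
            (fun t => B t (w (projIcc 0 1 zero_le_one t))) volume 0 x := fun w =>
          (intervalIntegrable_apply hB (continuous_comp_projIcc w).continuousOn).mono_set
            (uIcc_subset_uIcc_left (by rw [uIcc_of_le zero_le_one]; exact x.2))
        simp only [ContinuousMap.add_apply, map_add]
        exact intervalIntegral.integral_add (h u) (h v)
      map_smul' := fun c u => by
        ext x
        simp only [ContinuousMap.smul_apply, map_smul]
        exact intervalIntegral.integral_smul _ _ }
    (∫ t in (0 : ℝ)..1, ‖B t‖) fun u => by
      rw [ContinuousMap.norm_le _ (mul_nonneg
        (intervalIntegral.integral_nonneg zero_le_one fun _ _ => norm_nonneg _) (norm_nonneg _))]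
      intro x
      have hB' : IntervalIntegrable B volume 0 x := hB.mono_set
        (uIcc_subset_uIcc_left (by rw [uIcc_of_le zero_le_one]; exact x.2))
      calc ‖∫ t in (0 : ℝ)..x, B t (u (projIcc 0 1 zero_le_one t))‖
          ≤ ∫ t in (0 : ℝ)..x, ‖B t‖ * ‖u‖ :=
            intervalIntegral.norm_integral_le_of_norm_le x.2.1 (.of_forall fun t _ =>
              ((B t).le_opNorm _).trans (by gcongr; exact u.norm_coe_le_norm _))
              (hB'.norm.mul_const _)
        _ = (∫ t in (0 : ℝ)..x, ‖B t‖) * ‖u‖ := intervalIntegral.integral_mul_const _ _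
        _ ≤ _ := by
            gcongr
            exact intervalIntegral.integral_mono_interval le_rfl x.2.1 x.2.2
              (.of_forall fun t => norm_nonneg _) hB.norm

theorem volterra_apply (B : ℝ → F →L[ℂ] F) (hB : IntervalIntegrable B volume 0 1) (u : C(I, F))
    (x : I) : volterra B hB u x = ∫ t in (0 : ℝ)..x, B t (u (projIcc 0 1 zero_le_one t)) := rfl

/-- In the norm `sup e^{-cx} ‖u(x)‖` the operator has norm at most `1/2`. Back in the sup norm this
gives `‖Jⁿ‖ ≤ 2⁻ⁿ e^c`, so `1 - Jⁿ` is invertible for some `n`; it is the product of `1 - J` with a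
commuting geometric sum. -/
theorem isUnit_one_sub_volterra [CompleteSpace F] (B : ℝ → F →L[ℂ] F)
    (hB : IntervalIntegrable B volume 0 1) : IsUnit (1 - volterra B hB) := by
  obtain ⟨c, hc0, hc⟩ := exists_weight_integral_le hB.norm fun t => norm_nonneg (B t)
  have key : ∀ (n : ℕ) (u : C(I, F)) (x : I),
      ‖(volterra B hB ^ n) u x‖ ≤ (1 / 2) ^ n * ‖u‖ * Real.exp (c * x) := by
    intro n
    induction n with
    | zero =>
      intro u x
      have : 1 ≤ Real.exp (c * x) := Real.one_le_exp (mul_nonneg hc0 x.2.1)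
      have h2 := u.norm_coe_le_norm x
      rw [pow_zero, pow_zero, one_mul]
      exact h2.trans (le_mul_of_one_le_right (norm_nonneg u) this)
    | succ n ih =>
      intro u x
      rw [pow_succ', mul_apply_eq_comp, volterra_apply]
      have hB' : IntervalIntegrable (fun t => ‖B t‖) volume 0 x := (hB.mono_set
        (uIcc_subset_uIcc_left (by rw [uIcc_of_le zero_le_one]; exact x.2))).norm
      refine (intervalIntegral.norm_integral_le_of_norm_le x.2.1
        (g := fun t => (1 / 2) ^ n * ‖u‖ * (‖B t‖ * Real.exp (c * t)))
        (.of_forall fun t ht => ?_)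
        ((hB'.mul_continuousOn (by fun_prop)).const_mul _)).trans ?_
      · refine ((B t).le_opNorm _).trans ?_
        have := ih u (projIcc 0 1 zero_le_one t)
        rw [projIcc_of_mem zero_le_one ⟨ht.1.le, ht.2.trans x.2.2⟩] at this ⊢
        calc _ ≤ ‖B t‖ * ((1 / 2) ^ n * ‖u‖ * Real.exp (c * t)) := by gcongr
          _ = _ := by ring
      · rw [intervalIntegral.integral_const_mul]
        calc _ ≤ (1 / 2) ^ n * ‖u‖ * (Real.exp (c * x) / 2) := by
              gcongr
              exact hc x x.2
          _ = _ := by ring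
  obtain ⟨n, hn⟩ := exists_pow_lt_of_lt_one (inv_pos.2 (Real.exp_pos c))
    (by norm_num : (1 / 2 : ℝ) < 1)
  have hnorm : ‖volterra B hB ^ n‖ < 1 := by
    refine lt_of_le_of_lt (ContinuousLinearMap.opNorm_le_bound _
      (by positivity : 0 ≤ (1 / 2) ^ n * Real.exp c) fun u => ?_)
      ((lt_inv_mul_iff₀' (Real.exp_pos c)).1 (by simpa using hn))
    rw [ContinuousMap.norm_le _ (by positivity)]
    intro x
    have hx : Real.exp (c * x) ≤ Real.exp c :=
      Real.exp_le_exp.2 (mul_le_of_le_one_right hc0 x.2.2)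
    calc _ ≤ _ := key n u x
      _ ≤ (1 / 2) ^ n * ‖u‖ * Real.exp c := by gcongr
      _ = _ := by ring
  have h1 : IsUnit (1 - volterra B hB ^ n) :=
    isUnit_one_sub_of_norm_lt_one (R := C(I, F) →L[ℂ] C(I, F)) hnorm
  rw [← mul_neg_geom_sum] at h1
  have hcomm : Commute (1 - volterra B hB) (∑ i ∈ Finset.range n, volterra B hB ^ i) :=
    ((Commute.one_left _).sub_left
      (Commute.sum_right _ _ _ fun i _ => (Commute.refl _).pow_right i))
  exact (hcomm.isUnit_mul_iff.1 h1).1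

end Volterra
theorem differentiable_inverse_affine {R : Type*} [NormedRing R] [NormedAlgebra ℂ R]
    [CompleteSpace R] (a b : R) (h : ∀ z : ℂ, IsUnit (1 - (a - z • b))) :
    Differentiable ℂ fun z : ℂ => Ring.inverse (1 - (a - z • b)) := fun z =>
  DifferentiableAt.inverse (by fun_prop) (h z)

/-! ### Existence, uniqueness and analyticity in `z` for the initial value problem -/

section VectorSolutions

open Set unitInterval

variable {E : Type*} [NormedAddCommGroup E] [NormedSpace ℂ E]

/-- `u` (with derivative `u'`) is a vector-valued solution on `[0,1]` of `-u'' + A u = z u`, in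
integrated form. -/
structure IsVectorSolution (A : ℝ → E →L[ℂ] E) (z : ℂ) (u u' : ℝ → E) : Prop where
  cont : ContinuousOn u (Icc 0 1)
  cont' : ContinuousOn u' (Icc 0 1)
  eq : ∀ x ∈ Icc (0 : ℝ) 1, u x = u 0 + ∫ t in (0 : ℝ)..x, u' t
  eq' : ∀ x ∈ Icc (0 : ℝ) 1, u' x = u' 0 + ∫ t in (0 : ℝ)..x, (A t (u t) - z • u t)

/-- The coefficient of the first-order system for `(u, u')`. -/
noncomputable def systemMap (z : ℂ) (A : E →L[ℂ] E) : E × E →L[ℂ] E × E :=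
  (ContinuousLinearMap.snd ℂ E E).prod ((A - z • 1).comp (ContinuousLinearMap.fst ℂ E E))

theorem systemMap_apply (z : ℂ) (A : E →L[ℂ] E) (y : E × E) :
    systemMap z A y = (y.2, A y.1 - z • y.1) := by
  simp [systemMap]

theorem intervalIntegrable_systemMap {A : ℝ → E →L[ℂ] E} (hA : IntervalIntegrable A volume 0 1)
    (z : ℂ) : IntervalIntegrable (fun t => systemMap z (A t)) volume 0 1 := by
  have h : ∀ t, systemMap z (A t) = systemMap z 0 +
      ((ContinuousLinearMap.compL ℂ (E × E) E (E × E) (.inr ℂ E E)).comp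
        ((ContinuousLinearMap.compL ℂ (E × E) E E).flip (.fst ℂ E E))) (A t) := by
    intro t
    refine ContinuousLinearMap.ext fun y => ?_
    simp [systemMap_apply, sub_eq_add_neg, add_comm]
  simp_rw [h]
  refine intervalIntegrable_const.add ?_
  rw [intervalIntegrable_iff] at hA ⊢
  exact ContinuousLinearMap.integrable_comp _ hA

/-- The spectral parameter enters the integral operator affinely. Together with analyticity of
inversion this makes the solutions entire in `z`. -/
theorem volterra_systemMap {A : ℝ → E →L[ℂ] E} (hA : IntervalIntegrable A volume 0 1) (z : ℂ) :
    volterra _ (intervalIntegrable_systemMap hA z) = volterra _ (intervalIntegrable_systemMap hA 0)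
      - z • volterra (fun _ => (ContinuousLinearMap.inr ℂ E E).comp (.fst ℂ E E))
        intervalIntegrable_const := by
  refine ContinuousLinearMap.ext fun u => ContinuousMap.ext fun x => ?_
  have hi : ∀ {B : ℝ → E × E →L[ℂ] E × E} (_ : IntervalIntegrable B volume 0 1),
      IntervalIntegrable (fun t => B t (u (projIcc 0 1 zero_le_one t))) volume 0 x := fun hB =>
    (intervalIntegrable_apply hB (continuous_comp_projIcc u).continuousOn).mono_set
      (uIcc_subset_uIcc_left (by rw [uIcc_of_le zero_le_one]; exact x.2))
  simp only [sub_apply, smul_apply, ContinuousMap.sub_apply, ContinuousMap.smul_apply,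
    volterra_apply]
  rw [← intervalIntegral.integral_smul, ← intervalIntegral.integral_sub
    (hi (intervalIntegrable_systemMap hA 0)) (by exact (hi intervalIntegrable_const).smul z)]
  refine intervalIntegral.integral_congr fun t _ => ?_
  simp [systemMap_apply]

variable [CompleteSpace E]

theorem integral_prodMk_fst_snd {f g : ℝ → E} {a b : ℝ} (hf : IntervalIntegrable f volume a b)
    (hg : IntervalIntegrable g volume a b) :
    ∫ t in a..b, (f t, g t) = (∫ t in a..b, f t, ∫ t in a..b, g t) := by
  have h : IntervalIntegrable (fun t => (f t, g t)) volume a b := by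
    rw [intervalIntegrable_iff] at *
    exact hf.prodMk hg
  refine Prod.ext ?_ ?_
  · exact ((ContinuousLinearMap.fst ℝ E E).intervalIntegral_comp_comm h).symm
  · exact ((ContinuousLinearMap.snd ℝ E E).intervalIntegral_comp_comm h).symm

/-- The pair `(u, u')` is `(1 - J_z)⁻¹` applied to the constant initial data. The explicit formula
serves all `z` at once and so yields entire end values, which a separate choice for each `z` would
not. -/
theorem exists_isVectorSolution {A : ℝ → E →L[ℂ] E} (hA : IntervalIntegrable A volume 0 1)
    (u₀ u₁ : E) : ∃ u u' : ℂ → ℝ → E, (∀ z, IsVectorSolution A z (u z) (u' z)) ∧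
      (∀ z, u z 0 = u₀) ∧ (∀ z, u' z 0 = u₁) ∧
      Differentiable ℂ (fun z => u z 1) ∧ Differentiable ℂ (fun z => u' z 1) := by
  set J : ℂ → (C(I, E × E) →L[ℂ] C(I, E × E)) :=
    fun z => volterra _ (intervalIntegrable_systemMap hA z) with hJ
  have hunit : ∀ z, IsUnit (1 - J z) := fun z => isUnit_one_sub_volterra _ _
  set Y : ℂ → C(I, E × E) := fun z => Ring.inverse (1 - J z) (.const I (u₀, u₁)) with hY
  have hYd : Differentiable ℂ Y := by
    set J₁ : C(I, E × E) →L[ℂ] C(I, E × E) :=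
      volterra (fun _ => (ContinuousLinearMap.inr ℂ E E).comp (.fst ℂ E E))
        intervalIntegrable_const
    have e : ∀ z, J z = J 0 - z • J₁ := volterra_systemMap hA
    have hd : Differentiable ℂ fun z : ℂ => Ring.inverse (1 - (J 0 - z • J₁)) :=
      differentiable_inverse_affine (R := C(I, E × E) →L[ℂ] C(I, E × E)) _ _ fun z => by
        rw [← e]; exact hunit z
    simp only [← e] at hd
    exact hd.clm_apply (differentiable_const _)
  have hYeq : ∀ z (x : I), Y z x = (u₀, u₁) +
      ∫ t in (0 : ℝ)..x, systemMap z (A t) (Y z (projIcc 0 1 zero_le_one t)) := by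
    intro z x
    have h : ((1 - J z) * Ring.inverse (1 - J z)) (.const I (u₀, u₁)) = .const I (u₀, u₁) := by
      rw [Ring.mul_inverse_cancel _ (hunit z)]; rfl
    have h2 : Y z x - J z (Y z) x = (u₀, u₁) := congrArg (fun w : C(I, E × E) => w x) h
    rw [← h2]
    exact (sub_add_cancel _ _).symm
  set y : ℂ → ℝ → E × E := fun z t => Y z (projIcc 0 1 zero_le_one t) with hy
  have hyc : ∀ z, Continuous (y z) := fun z => continuous_comp_projIcc (Y z)
  have hy1 : ∀ z, ContinuousOn (fun t => (y z t).1) (Icc 0 1) := fun z =>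
    (continuous_fst.comp (hyc z)).continuousOn
  have hyeq : ∀ z, ∀ x ∈ Icc (0 : ℝ) 1, y z x = (u₀ + ∫ t in (0 : ℝ)..x, (y z t).2,
      u₁ + ∫ t in (0 : ℝ)..x, (A t (y z t).1 - z • (y z t).1)) := by
    intro z x hx
    have h := hYeq z ⟨x, hx⟩
    have hsub : uIcc 0 x ⊆ uIcc (0 : ℝ) 1 :=
      uIcc_subset_uIcc_left (by rwa [uIcc_of_le zero_le_one])
    simp only [systemMap_apply] at h
    have hi : IntervalIntegrable (fun t => (y z t).1) volume 0 x :=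
      (continuous_fst.comp (hyc z)).intervalIntegrable _ _
    have h2 : ∫ t in (0 : ℝ)..x, ((y z t).2, A t (y z t).1 - z • (y z t).1) =
        (∫ t in (0 : ℝ)..x, (y z t).2, ∫ t in (0 : ℝ)..x, (A t (y z t).1 - z • (y z t).1)) :=
      integral_prodMk_fst_snd ((continuous_snd.comp (hyc z)).intervalIntegrable _ _)
        (((intervalIntegrable_apply hA (hy1 z)).mono_set hsub).sub (hi.smul z))
    have h3 : y z x = Y z ⟨x, hx⟩ := by simp only [hy, projIcc_of_mem zero_le_one hx]
    rw [h3, h]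
    exact congrArg ((u₀, u₁) + ·) h2
  have h0 : ∀ z, y z 0 = (u₀, u₁) := fun z => by
    have := hyeq z 0 ⟨le_rfl, zero_le_one⟩
    simpa using this
  have hd : ∀ t, Differentiable ℂ fun z => y z t := fun t =>
    (ContinuousMap.evalCLM (M := E × E) ℂ
      (projIcc (0 : ℝ) 1 zero_le_one t)).differentiable.comp hYd
  refine ⟨fun z t => (y z t).1, fun z t => (y z t).2, fun z => ⟨hy1 z,
    (continuous_snd.comp (hyc z)).continuousOn, fun x hx => ?_, fun x hx => ?_⟩,
    fun z => by simp [h0], fun z => by simp [h0], (hd 1).fst, (hd 1).snd⟩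
  · have := congrArg Prod.fst (hyeq z x hx)
    simpa only [h0] using this
  · have := congrArg Prod.snd (hyeq z x hx)
    simpa only [h0] using this

/-- The difference of the two pairs lies in the kernel of the invertible operator `1 - J_z`. -/
theorem IsVectorSolution.eq_of_initial {A : ℝ → E →L[ℂ] E}
    (hA : IntervalIntegrable A volume 0 1) {z : ℂ} {u u' v v' : ℝ → E}
    (hu : IsVectorSolution A z u u') (hv : IsVectorSolution A z v v') (h0 : u 0 = v 0)
    (h1 : u' 0 = v' 0) : ∀ x ∈ Icc (0 : ℝ) 1, u x = v x ∧ u' x = v' x := by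
  set y : ℝ → E × E := fun x => (u x - v x, u' x - v' x) with hy
  have hyc : ContinuousOn y (Icc 0 1) :=
    (hu.cont.sub hv.cont).prodMk (hu.cont'.sub hv.cont')
  set Y : C(I, E × E) := ⟨fun x => y x, continuousOn_iff_continuous_domRestrict.1 hyc⟩ with hY
  have hYp : ∀ t ∈ Icc (0 : ℝ) 1, Y (projIcc 0 1 zero_le_one t) = y t := fun t ht => by
    rw [projIcc_of_mem zero_le_one ht]; rfl
  have hfix : (1 - volterra _ (intervalIntegrable_systemMap hA z)) Y = 0 := by
    refine ContinuousMap.ext fun x => ?_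
    have hx := x.2
    have hsub : uIcc 0 (x : ℝ) ⊆ uIcc (0 : ℝ) 1 :=
      uIcc_subset_uIcc_left (by rwa [uIcc_of_le zero_le_one])
    have hic : ∀ {w : ℝ → E}, ContinuousOn w (Icc 0 1) → IntervalIntegrable w volume 0 x :=
      fun hw => (hw.mono (by rw [← uIcc_of_le (zero_le_one' ℝ)]; exact hsub)).intervalIntegrable
    have hiA : ∀ {w : ℝ → E}, ContinuousOn w (Icc 0 1) →
        IntervalIntegrable (fun t => A t (w t) - z • w t) volume 0 x := fun hw =>
      ((intervalIntegrable_apply hA hw).mono_set hsub).sub ((hic hw).smul z)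
    have e : volterra _ (intervalIntegrable_systemMap hA z) Y x = y x := by
      rw [volterra_apply]
      calc _ = ∫ t in (0 : ℝ)..x, (u' t - v' t, (A t (u t) - z • u t) - (A t (v t) - z • v t)) := by
            refine intervalIntegral.integral_congr fun t ht => ?_
            rw [uIcc_of_le hx.1] at ht
            simp only [hYp t ⟨ht.1, ht.2.trans hx.2⟩, systemMap_apply, hy, map_sub, smul_sub]
            congr 1
            abel
        _ = y x := by
            rw [integral_prodMk_fst_snd ((hic hu.cont').sub (hic hv.cont'))
              ((hiA hu.cont).sub (hiA hv.cont)),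
              intervalIntegral.integral_sub (hic hu.cont') (hic hv.cont'),
              intervalIntegral.integral_sub (hiA hu.cont) (hiA hv.cont)]
            simp only [hy]
            rw [hu.eq x hx, hv.eq x hx, hu.eq' x hx, hv.eq' x hx, h0, h1]
            simp
    have : Y x - volterra _ (intervalIntegrable_systemMap hA z) Y x = 0 := by
      rw [e]; exact sub_self _
    exact this
  have hinj := (isUnit_one_sub_volterra _ (intervalIntegrable_systemMap hA z))
  obtain ⟨w, hw⟩ := hinj
  have hY0 : Y = 0 := by
    have :
        ((w⁻¹ : (C(I, E × E) →L[ℂ] C(I, E × E))ˣ) * (w : C(I, E × E) →L[ℂ] C(I, E × E))) Y = 0 := by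
      rw [mul_apply_eq_comp, hw, hfix, map_zero]
    rwa [Units.inv_mul] at this
  intro x hx
  have := hYp x hx
  rw [hY0] at this
  have h2 := Prod.ext_iff.1 this
  exact ⟨(sub_eq_zero.1 h2.1.symm), (sub_eq_zero.1 h2.2.symm)⟩

end VectorSolutions
-- Lagrange's identity and the a priori estimate off the real axis
section EnergyEstimates

open Set

variable {E : Type*} [NormedAddCommGroup E] [InnerProductSpace ℂ E]
  {A : ℝ → E →L[ℂ] E} {z : ℂ} {u u' : ℝ → E}

theorem uIcc_subset_Icc_zero_one {x y : ℝ} (hx : x ∈ Icc (0 : ℝ) 1) (hy : y ∈ Icc (0 : ℝ) 1) :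
    uIcc x y ⊆ Icc 0 1 := by
  rw [← uIcc_of_le (zero_le_one' ℝ)] at *
  exact uIcc_subset_uIcc hx hy

theorem IsVectorSolution.intervalIntegrable (hu : IsVectorSolution A z u u')
    (hA : IntervalIntegrable A volume 0 1) :
    IntervalIntegrable (fun t => A t (u t) - z • u t) volume 0 1 :=
  (intervalIntegrable_apply hA hu.cont).sub
    ((ContinuousOn.intervalIntegrable (by rw [uIcc_of_le zero_le_one]; exact hu.cont)).smul z)

theorem IsVectorSolution.intervalIntegrable' (hu : IsVectorSolution A z u u') :
    IntervalIntegrable u' volume 0 1 :=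
  ContinuousOn.intervalIntegrable (by rw [uIcc_of_le zero_le_one]; exact hu.cont')

variable [CompleteSpace E]

/-- Lagrange's identity for a solution paired with itself. -/
theorem IsVectorSolution.im_inner (hu : IsVectorSolution A z u u')
    (hA : IntervalIntegrable A volume 0 1)
    (hs : ∀ᵐ t ∂(volume.restrict (Icc (0 : ℝ) 1)), ∀ x, (inner ℂ x (A t x)).im = 0) :
    (inner ℂ (u 1) (u' 1)).im - (inner ℂ (u 0) (u' 0)).im =
      -(z.im * ∫ t in (0 : ℝ)..1, ‖u t‖ ^ 2) := by
  have hb : IsBoundedBilinearMap ℝ fun p : E × E => inner ℂ p.1 p.2 := isBoundedBilinearMap_inner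
  have hi := hu.intervalIntegrable hA
  have hi' := hu.intervalIntegrable'
  have h := integral_bilinear_deriv hb zero_le_one hi' hi hu.eq hu.eq'
  have hint : IntervalIntegrable (fun t => inner ℂ (u t) (A t (u t) - z • u t) +
      inner ℂ (u' t) (u' t)) volume 0 1 :=
    (intervalIntegrable_bilinear_right hb (by rw [uIcc_of_le zero_le_one]; exact hu.cont) hi).add
    (intervalIntegrable_bilinear_left hb hi' (by rw [uIcc_of_le zero_le_one]; exact hu.cont'))
  have h2 := congrArg Complex.im h
  rw [← Complex.imCLM_apply, ← Complex.imCLM.intervalIntegral_comp_comm hint, Complex.sub_im] at h2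
  rw [← h2, ← intervalIntegral.integral_const_mul, ← intervalIntegral.integral_neg]
  refine intervalIntegral.integral_congr_ae ?_
  rw [uIoc_of_le zero_le_one]
  have hs' := (ae_restrict_iff' measurableSet_Icc).1 hs
  filter_upwards [hs'] with t ht htI
  have h1 := ht ⟨htI.1.le, htI.2⟩ (u t)
  have e1 : (inner ℂ (u' t) (u' t)).im = 0 := by
    rw [inner_self_eq_norm_sq_to_K]
    norm_cast
  have e2 : inner ℂ (u t) (u t) = ((‖u t‖ ^ 2 : ℝ) : ℂ) := by
    rw [inner_self_eq_norm_sq_to_K]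
    norm_cast
  simp only [Complex.imCLM_apply, Complex.add_im, inner_sub_right, inner_smul_right,
    Complex.sub_im, h1, e1, e2, Complex.im_mul_ofReal]
  ring

/-- Average `u'(x) = (u'(x) - u'(y)) + u'(y)` over `y ∈ [0,1]`. The equation bounds the first part
by `(∫ ‖A‖ + |z|) m`; the second averages to `u(1) - u(0)`, whence the summand `2`. -/
theorem IsVectorSolution.norm_deriv_le (hu : IsVectorSolution A z u u')
    (hA : IntervalIntegrable A volume 0 1) {m : ℝ} (hm : ∀ x ∈ Icc (0 : ℝ) 1, ‖u x‖ ≤ m) :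
    ∀ x ∈ Icc (0 : ℝ) 1, ‖u' x‖ ≤ (2 + (∫ t in (0 : ℝ)..1, ‖A t‖) + ‖z‖) * m := by
  intro x hx
  have h0 : (0 : ℝ) ∈ Icc (0 : ℝ) 1 := ⟨le_rfl, zero_le_one⟩
  have h1 : (1 : ℝ) ∈ Icc (0 : ℝ) 1 := ⟨zero_le_one, le_rfl⟩
  have hi := hu.intervalIntegrable hA
  have hI : uIcc (0 : ℝ) 1 = Icc 0 1 := uIcc_of_le zero_le_one
  have hm0 : 0 ≤ m := (norm_nonneg _).trans (hm 0 h0)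
  have hdiff : ∀ y ∈ Icc (0 : ℝ) 1,
      ‖u' x - u' y‖ ≤ ((∫ t in (0 : ℝ)..1, ‖A t‖) + ‖z‖) * m := by
    intro y hy
    have hsub : ∀ w ∈ Icc (0 : ℝ) 1, uIcc 0 w ⊆ uIcc (0 : ℝ) 1 := fun w hw =>
      uIcc_subset_uIcc_left (by rwa [hI])
    rw [hu.eq' x hx, hu.eq' y hy, add_sub_add_left_eq_sub,
      intervalIntegral.integral_interval_sub_left (hi.mono_set (hsub x hx))
        (hi.mono_set (hsub y hy))]
    have hg : IntervalIntegrable (fun t => (‖A t‖ + ‖z‖) * m) volume 0 1 :=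
      (hA.norm.add intervalIntegrable_const).mul_const _
    have hsub2 : uIoc y x ⊆ Ioc 0 1 := by
      intro t ht
      rw [mem_uIoc] at ht
      rcases ht with ht | ht
      · exact ⟨hy.1.trans_lt ht.1, ht.2.trans hx.2⟩
      · exact ⟨hx.1.trans_lt ht.1, ht.2.trans hy.2⟩
    rw [intervalIntegral.norm_integral_eq_norm_integral_uIoc]
    have hg' : IntegrableOn (fun t => (‖A t‖ + ‖z‖) * m) (Ioc 0 1) volume :=
      (intervalIntegrable_iff_integrableOn_Ioc_of_le zero_le_one).1 hg
    calc _ ≤ ∫ t in uIoc y x, (‖A t‖ + ‖z‖) * m := by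
          refine norm_integral_le_of_norm_le (hg'.mono_set hsub2)
            ((ae_restrict_mem measurableSet_uIoc).mono fun t ht => ?_)
          have htm := hm t (Ioc_subset_Icc_self (hsub2 ht))
          calc _ ≤ ‖A t (u t)‖ + ‖z • u t‖ := norm_sub_le _ _
            _ ≤ ‖A t‖ * ‖u t‖ + ‖z‖ * ‖u t‖ := by
              rw [norm_smul]; gcongr; exact (A t).le_opNorm _
            _ ≤ ‖A t‖ * m + ‖z‖ * m := by gcongr
            _ = _ := by ring
      _ ≤ ∫ t in Ioc 0 1, (‖A t‖ + ‖z‖) * m :=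
          setIntegral_mono_set hg' (.of_forall fun t => by positivity)
            hsub2.eventuallyLE
      _ = _ := by
          rw [← intervalIntegral.integral_of_le zero_le_one, intervalIntegral.integral_mul_const,
            intervalIntegral.integral_add hA.norm intervalIntegrable_const]
          simp
  have e : u' x = (∫ y in (0 : ℝ)..1, (u' x - u' y)) + (u 1 - u 0) := by
    rw [intervalIntegral.integral_sub intervalIntegrable_const hu.intervalIntegrable',
      hu.eq 1 h1]
    simp
  rw [e]
  have b1 : ‖∫ y in (0 : ℝ)..1, (u' x - u' y)‖ ≤ ((∫ t in (0 : ℝ)..1, ‖A t‖) + ‖z‖) * m := by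
    have := intervalIntegral.norm_integral_le_of_norm_le_const (a := (0 : ℝ)) (b := 1)
      (f := fun y => u' x - u' y) (C := ((∫ t in (0 : ℝ)..1, ‖A t‖) + ‖z‖) * m) fun y hy =>
        hdiff y (by rw [← hI]; exact uIoc_subset_uIcc hy)
    simpa using this
  have b2 : ‖u 1 - u 0‖ ≤ 2 * m :=
    (norm_sub_le _ _).trans (by linarith [hm 0 h0, hm 1 h1])
  calc _ ≤ _ := norm_add_le _ _
    _ ≤ _ := add_le_add b1 b2
    _ = _ := by ring

/-- A solution is controlled by its `L²`-norm, with constants polynomial in `z`. -/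
theorem IsVectorSolution.exists_sup_bound (hu : IsVectorSolution A z u u')
    (hA : IntervalIntegrable A volume 0 1) {Λ : ℝ}
    (hΛ : Λ = 2 + (∫ t in (0 : ℝ)..1, ‖A t‖) + ‖z‖) :
    ∃ m : ℝ, 0 ≤ m ∧ (∀ x ∈ Icc (0 : ℝ) 1, ‖u x‖ ≤ m) ∧
      (∀ x ∈ Icc (0 : ℝ) 1, ‖u' x‖ ≤ Λ * m) ∧ m ^ 2 ≤ 8 * Λ * ∫ t in (0 : ℝ)..1, ‖u t‖ ^ 2 := by
  obtain ⟨x₀, hx₀, hmax⟩ := isCompact_Icc.exists_isMaxOn (nonempty_Icc.2 zero_le_one)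
    hu.cont.norm
  have hm : ∀ x ∈ Icc (0 : ℝ) 1, ‖u x‖ ≤ ‖u x₀‖ := fun x hx => hmax hx
  set m := ‖u x₀‖ with hmdef
  have hm0 : 0 ≤ m := norm_nonneg _
  have hu' := hu.norm_deriv_le hA hm
  rw [← hΛ] at hu'
  refine ⟨m, hm0, hm, hu', ?_⟩
  have hΛ2 : 2 ≤ Λ := by
    have : 0 ≤ ∫ t in (0 : ℝ)..1, ‖A t‖ :=
      intervalIntegral.integral_nonneg zero_le_one fun _ _ => norm_nonneg _
    rw [hΛ]; linarith [norm_nonneg z]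
  have hI : uIcc (0 : ℝ) 1 = Icc 0 1 := uIcc_of_le zero_le_one
  have hsqc : ContinuousOn (fun t => ‖u t‖ ^ 2) (Icc 0 1) := hu.cont.norm.pow 2
  have lip : ∀ t ∈ Icc (0 : ℝ) 1, ‖u t - u x₀‖ ≤ Λ * m * |t - x₀| := by
    intro t ht
    have hi := hu.intervalIntegrable'
    rw [hu.eq t ht, hu.eq x₀ hx₀, add_sub_add_left_eq_sub,
      intervalIntegral.integral_interval_sub_left
        (hi.mono_set (uIcc_subset_uIcc_left (by rwa [hI])))
        (hi.mono_set (uIcc_subset_uIcc_left (by rwa [hI])))]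
    exact intervalIntegral.norm_integral_le_of_norm_le_const fun y hy =>
      hu' y (uIcc_subset_Icc_zero_one hx₀ ht (uIoc_subset_uIcc hy))
  have hd : 0 < 1 / (2 * Λ) := by positivity
  have hd4 : 1 / (2 * Λ) ≤ 1 / 4 := one_div_le_one_div_of_le (by norm_num) (by linarith)
  -- On an interval of length `1/(2Λ)` containing the maximum point the bound `‖u'‖ ≤ Λ m` keeps
  -- `‖u‖ ≥ m/2`, so `∫ ‖u‖² ≥ m²/(8Λ)`. As `Λ ≥ 2`, such an interval fits in `[0,1]` to the right
  -- of `x₀` if `x₀ ≤ 1/2`, and to the left otherwise.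
  have claim : ∀ p, 0 ≤ p → p + 1 / (2 * Λ) ≤ 1 → p ≤ x₀ → x₀ ≤ p + 1 / (2 * Λ) →
      m ^ 2 ≤ 8 * Λ * ∫ t in (0 : ℝ)..1, ‖u t‖ ^ 2 := by
    intro p hp0 hp1 hpx hxp
    have hle : p ≤ p + 1 / (2 * Λ) := by linarith
    have hsub : Icc p (p + 1 / (2 * Λ)) ⊆ Icc 0 1 := Icc_subset_Icc hp0 hp1
    have e1 : ∫ _ in p..(p + 1 / (2 * Λ)), m ^ 2 / 4 ≤ ∫ t in p..(p + 1 / (2 * Λ)), ‖u t‖ ^ 2 := by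
      refine intervalIntegral.integral_mono_on hle intervalIntegrable_const
        (ContinuousOn.intervalIntegrable (by rw [uIcc_of_le hle]; exact hsqc.mono hsub)) ?_
      intro t ht
      have h1 := lip t (hsub ht)
      have h2 : |t - x₀| ≤ 1 / (2 * Λ) := by
        rw [abs_le]; constructor <;> linarith [ht.1, ht.2]
      have h3 : Λ * m * |t - x₀| ≤ m / 2 := by
        calc _ ≤ Λ * m * (1 / (2 * Λ)) := by gcongr
          _ = m / 2 := by field_simp
      have h4 : m ≤ ‖u t‖ + ‖u t - u x₀‖ := by
        have := norm_sub_le (u t) (u t - u x₀)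
        simpa [hmdef] using this
      have h5 : m / 2 ≤ ‖u t‖ := by linarith
      nlinarith
    have e2 : ∫ t in p..(p + 1 / (2 * Λ)), ‖u t‖ ^ 2 ≤ ∫ t in (0 : ℝ)..1, ‖u t‖ ^ 2 :=
      intervalIntegral.integral_mono_interval hp0 hle hp1 (.of_forall fun t => by positivity)
        (ContinuousOn.intervalIntegrable (by rwa [hI]))
    rw [intervalIntegral.integral_const, add_sub_cancel_left, smul_eq_mul] at e1
    have e3 := e1.trans e2
    calc m ^ 2 = 8 * Λ * (1 / (2 * Λ) * (m ^ 2 / 4)) := by field_simp; ring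
      _ ≤ _ := by gcongr
  rcases le_total x₀ (1 / 2) with h | h
  · exact claim x₀ hx₀.1 (by linarith) le_rfl (by linarith)
  · exact claim (x₀ - 1 / (2 * Λ)) (by linarith) (by linarith [hx₀.2]) (by linarith) (by linarith)

theorem inner_apply_of_isStarProjection {T : E →L[ℂ] E} (hT : IsStarProjection T) (x y : E) :
    inner ℂ (T x) y = inner ℂ x (T y) := by
  have h : ContinuousLinearMap.adjoint T = T := hT.isSelfAdjoint
  rw [← ContinuousLinearMap.adjoint_inner_right, h]

theorem norm_apply_le_of_isStarProjection {T : E →L[ℂ] E} (hT : IsStarProjection T) (x : E) :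
    ‖T x‖ ≤ ‖x‖ := by
  have h2 : T (T x) = T x := by
    rw [← mul_apply_eq_comp, hT.isIdempotentElem.eq]
  have h : ‖T x‖ ^ 2 ≤ ‖x‖ * ‖T x‖ := by
    have h3 : inner ℂ (T x) (T x) = inner ℂ x (T x) := by
      rw [inner_apply_of_isStarProjection hT, h2]
    have h4 := norm_inner_le_norm (𝕜 := ℂ) x (T x)
    rw [← h3, inner_self_eq_norm_sq_to_K] at h4
    simpa using h4
  nlinarith [norm_nonneg (T x), norm_nonneg x, sq_nonneg (‖T x‖ - ‖x‖)]

/-- The basic resolvent-type estimate: off the real axis the initial data of a solution satisfying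
the condition at `0` are controlled by its boundary value at `1`. -/
theorem IsVectorSolution.abs_im_mul_le (hu : IsVectorSolution A z u u')
    (hA : IntervalIntegrable A volume 0 1)
    (hs : ∀ᵐ t ∂(volume.restrict (Icc (0 : ℝ) 1)), ∀ x, (inner ℂ x (A t x)).im = 0)
    {Tm Tp a b : E →L[ℂ] E} (hTm : IsStarProjection Tm) (hTp : IsStarProjection Tp)
    (ha : ∀ x, (inner ℂ x (a x)).im = 0) (hb : ∀ x, (inner ℂ x (b x)).im = 0)
    (hbT : ∀ x, b x - Tp (b x) = b x) (h0 : Tm (u 0) = 0) (h1 : u' 0 - Tm (u' 0) = a (u 0))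
    {Λ : ℝ} (hΛ : Λ = 2 + (∫ t in (0 : ℝ)..1, ‖A t‖) + ‖z‖) {w : E}
    (hw : w = (u' 1 + b (u 1)) - Tp (u' 1 + b (u 1)) - Tp (u 1)) :
    |z.im| * (‖u 0‖ + ‖u' 0‖) ≤ 32 * Λ ^ 3 * ‖w‖ := by
  obtain ⟨m, hm0, hm, hm', hint⟩ := hu.exists_sup_bound hA hΛ
  have hL := hu.im_inner hA hs
  have hΛ2 : 2 ≤ Λ := by
    have : 0 ≤ ∫ t in (0 : ℝ)..1, ‖A t‖ :=
      intervalIntegral.integral_nonneg zero_le_one fun _ _ => norm_nonneg _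
    rw [hΛ]; linarith [norm_nonneg z]
  have z0 : (0 : ℝ) ∈ Icc (0 : ℝ) 1 := ⟨le_rfl, zero_le_one⟩
  have z1 : (1 : ℝ) ∈ Icc (0 : ℝ) 1 := ⟨zero_le_one, le_rfl⟩
  -- Since `Tm (u 0) = 0`, only the complementary component `a (u 0)` of `u' 0` is seen, and the
  -- form of `a` is real.
  have i0 : (inner ℂ (u 0) (u' 0)).im = 0 := by
    have : inner ℂ (u 0) (Tm (u' 0)) = 0 := by
      rw [← inner_apply_of_isStarProjection hTm, h0, inner_zero_left]
    have h := ha (u 0)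
    rwa [← h1, inner_sub_right, this, sub_zero] at h
  have hTT : ∀ x, Tp (Tp x) = Tp x := fun x => by
    rw [← mul_apply_eq_comp, hTp.isIdempotentElem.eq]
  have hTw : Tp w = - Tp (u 1) := by
    rw [hw]; simp only [map_sub, map_add, hTT]; abel
  have hTbx : ∀ x, Tp (b x) = 0 := fun x => by
    have := hbT x
    rwa [sub_eq_self] at this
  have hw' : w - Tp w = u' 1 - Tp (u' 1) + b (u 1) := by
    rw [hTw, hw]; simp only [map_add, hTbx]; abel
  -- Decompose along `Tp`: the `Tp`-part of `u 1` is `-Tp w`, and the complementary part of `u' 1`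
  -- is `w - Tp w - b (u 1)`. The form of `b` is real, so the imaginary part is linear in `w`.
  have i1 : inner ℂ (u 1) (u' 1) = -inner ℂ (Tp w) (u' 1) + inner ℂ (u 1) (w - Tp w)
      - inner ℂ (u 1) (b (u 1)) := by
    rw [hw', hTw, inner_neg_left, inner_add_right, inner_sub_right,
      inner_apply_of_isStarProjection hTp]
    ring
  have i1' : |(inner ℂ (u 1) (u' 1)).im| ≤ ‖w‖ * (2 * Λ * m) := by
    have e : (inner ℂ (u 1) (u' 1)).im =
        (-inner ℂ (Tp w) (u' 1) + inner ℂ (u 1) (w - Tp w)).im := by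
      rw [i1, Complex.sub_im, hb, sub_zero]
    rw [e]
    have hq : ‖w - Tp w‖ ≤ ‖w‖ := norm_apply_le_of_isStarProjection hTp.one_sub w
    have hp : ‖Tp w‖ ≤ ‖w‖ := norm_apply_le_of_isStarProjection hTp w
    have hu1 := hm 1 z1
    have hu1' := hm' 1 z1
    calc _ ≤ ‖-inner ℂ (Tp w) (u' 1) + inner ℂ (u 1) (w - Tp w)‖ := Complex.abs_im_le_norm _
      _ ≤ ‖inner ℂ (Tp w) (u' 1)‖ + ‖inner ℂ (u 1) (w - Tp w)‖ := by
          rw [← norm_neg (inner ℂ (Tp w) (u' 1))]; exact norm_add_le _ _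
      _ ≤ ‖Tp w‖ * ‖u' 1‖ + ‖u 1‖ * ‖w - Tp w‖ :=
          add_le_add (norm_inner_le_norm _ _) (norm_inner_le_norm _ _)
      _ ≤ ‖w‖ * (Λ * m) + m * ‖w‖ := by gcongr
      _ ≤ _ := by nlinarith [mul_nonneg (norm_nonneg w) hm0]
  rw [i0, sub_zero] at hL
  have hI0 : 0 ≤ ∫ t in (0 : ℝ)..1, ‖u t‖ ^ 2 :=
    intervalIntegral.integral_nonneg zero_le_one fun _ _ => by positivity
  rw [hL, abs_neg, abs_mul, abs_of_nonneg hI0] at i1'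
  -- Lagrange's identity is quadratic in the solution on one side and linear in it on the other; one
  -- factor `m` cancels.
  have key : |z.im| * m ≤ 16 * Λ ^ 2 * ‖w‖ := by
    rcases hm0.eq_or_lt with hm00 | hmpos
    · rw [← hm00, mul_zero]; positivity
    · have : (|z.im| * m) * m ≤ (16 * Λ ^ 2 * ‖w‖) * m := by
        calc _ = |z.im| * m ^ 2 := by ring
          _ ≤ |z.im| * (8 * Λ * ∫ t in (0 : ℝ)..1, ‖u t‖ ^ 2) := by gcongr
          _ = 8 * Λ * (|z.im| * ∫ t in (0 : ℝ)..1, ‖u t‖ ^ 2) := by ring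
          _ ≤ 8 * Λ * (‖w‖ * (2 * Λ * m)) := by gcongr
          _ = _ := by ring
      exact le_of_mul_le_mul_right this hmpos
  calc _ ≤ |z.im| * (m + Λ * m) := by
        have := hm 0 z0
        have := hm' 0 z0
        gcongr
    _ ≤ |z.im| * (2 * Λ * m) := by
        have : m + Λ * m ≤ 2 * Λ * m := by nlinarith
        gcongr
    _ = 2 * Λ * (|z.im| * m) := by ring
    _ ≤ 2 * Λ * (16 * Λ ^ 2 * ‖w‖) := by gcongr
    _ = _ := by ring

end EnergyEstimates
-- Large-`k` asymptotics of solutions at `z = k²`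
section Asymptotics

open Set

theorem norm_exp_mul_I_le (w : ℂ) : ‖Complex.exp (w * Complex.I)‖ ≤ Real.exp |w.im| := by
  rw [Complex.norm_exp]
  simpa using neg_le_abs w.im

theorem norm_exp_neg_mul_I_le (w : ℂ) : ‖Complex.exp (-w * Complex.I)‖ ≤ Real.exp |w.im| := by
  simpa using norm_exp_mul_I_le (-w)

theorem norm_sin_le (w : ℂ) : ‖Complex.sin w‖ ≤ Real.exp |w.im| := by
  rw [Complex.sin, norm_div, norm_mul, Complex.norm_I, mul_one, Complex.norm_two,
    div_le_iff₀ two_pos]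
  refine (norm_sub_le _ _).trans ?_
  linarith [norm_exp_mul_I_le w, norm_exp_neg_mul_I_le w]

theorem norm_cos_le (w : ℂ) : ‖Complex.cos w‖ ≤ Real.exp |w.im| := by
  rw [Complex.cos, norm_div, Complex.norm_two, div_le_iff₀ two_pos]
  refine (norm_add_le _ _).trans ?_
  linarith [norm_exp_mul_I_le w, norm_exp_neg_mul_I_le w]

variable {E : Type*} [NormedAddCommGroup E] [InnerProductSpace ℂ E]
  {A : ℝ → E →L[ℂ] E} {z k : ℂ} {u u' : ℝ → E}

/-- The growth `e^{h(x-t)}` of the kernel and `e^{ht}` of the solution multiply to `e^{hx}`,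
independent of `t`, so only `∫ ‖A‖` remains. -/
theorem norm_integral_smul_apply_le (hA : IntervalIntegrable A volume 0 1) {h M : ℝ}
    {c : ℝ → ℂ} {x : ℝ} (hx : x ∈ Icc (0 : ℝ) 1) (hM : 0 ≤ M)
    (hc : ∀ t ∈ Icc 0 x, ‖c t‖ ≤ Real.exp (h * (x - t)))
    (hu : ∀ t ∈ Icc 0 x, ‖u t‖ ≤ M * Real.exp (h * t)) :
    ‖∫ t in (0 : ℝ)..x, c t • A t (u t)‖ ≤
      (∫ t in (0 : ℝ)..1, ‖A t‖) * M * Real.exp (h * x) := by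
  have hA' : IntervalIntegrable (fun t => ‖A t‖) volume 0 x := (hA.mono_set
    (uIcc_subset_uIcc_left (by rwa [uIcc_of_le zero_le_one]))).norm
  calc _ ≤ ∫ t in (0 : ℝ)..x, ‖A t‖ * (M * Real.exp (h * x)) := by
        refine intervalIntegral.norm_integral_le_of_norm_le hx.1 (.of_forall fun t ht => ?_)
          (hA'.mul_const _)
        have ht' : t ∈ Icc 0 x := ⟨ht.1.le, ht.2⟩
        have h1 := hc t ht'
        have h2 := hu t ht'
        rw [norm_smul]
        calc _ ≤ Real.exp (h * (x - t)) * (‖A t‖ * (M * Real.exp (h * t))) := by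
              gcongr
              exact ((A t).le_opNorm _).trans (by gcongr)
          _ = ‖A t‖ * (M * (Real.exp (h * (x - t)) * Real.exp (h * t))) := by ring
          _ = _ := by rw [← Real.exp_add]; ring_nf
    _ = (∫ t in (0 : ℝ)..x, ‖A t‖) * (M * Real.exp (h * x)) :=
        intervalIntegral.integral_mul_const _ _
    _ ≤ (∫ t in (0 : ℝ)..1, ‖A t‖) * (M * Real.exp (h * x)) := by
        gcongr
        exact intervalIntegral.integral_mono_interval le_rfl hx.1 hx.2
          (.of_forall fun t => norm_nonneg _) hA.norm
    _ = _ := by ring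

variable [CompleteSpace E]

/-- Subtract the product rules for `s u'` and `s' u`: the terms `s' u'` cancel, and `s'' = -z s`
removes the spectral parameter. The choices `sin (k (x - t))` and `cos (k (x - t))` give the
variation of constants formulas for `u` and `u'`. -/
theorem IsVectorSolution.integral_smul_eq (hu : IsVectorSolution A z u u')
    (hA : IntervalIntegrable A volume 0 1) {s s' : ℝ → ℂ} (hs : ∀ t, HasDerivAt s (s' t) t)
    (hs' : ∀ t, HasDerivAt s' (-z * s t) t) {x : ℝ} (hx : x ∈ Icc (0 : ℝ) 1) :
    ∫ t in (0 : ℝ)..x, s t • A t (u t) =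
      s x • u' x - s 0 • u' 0 - (s' x • u x - s' 0 • u 0) := by
  have hb : IsBoundedBilinearMap ℝ fun p : ℂ × E => p.1 • p.2 := isBoundedBilinearMap_smul
  have hsc : Continuous s := continuous_iff_continuousAt.2 fun t => (hs t).continuousAt
  have hsc' : Continuous s' := continuous_iff_continuousAt.2 fun t => (hs' t).continuousAt
  have hsub : uIcc 0 x ⊆ uIcc (0 : ℝ) 1 :=
    uIcc_subset_uIcc_left (by rwa [uIcc_of_le zero_le_one])
  have hsub' : Icc 0 x ⊆ Icc (0 : ℝ) 1 := Icc_subset_Icc_right hx.2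
  have hi := (hu.intervalIntegrable hA).mono_set hsub
  have hi' := hu.intervalIntegrable'.mono_set hsub
  have hzs : Continuous fun t => -z * s t := continuous_const.mul hsc
  have is : ∀ t ∈ Icc 0 x, s t = s 0 + ∫ r in (0 : ℝ)..t, s' r := fun t _ => by
    rw [intervalIntegral.integral_eq_sub_of_hasDerivAt (fun r _ => hs r)
      (hsc'.intervalIntegrable _ _)]; ring
  have is' : ∀ t ∈ Icc 0 x, s' t = s' 0 + ∫ r in (0 : ℝ)..t, -z * s r := fun t _ => by
    rw [intervalIntegral.integral_eq_sub_of_hasDerivAt (fun r _ => hs' r)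
      (hzs.intervalIntegrable _ _)]; ring
  have h1 := integral_bilinear_deriv hb hx.1 (hsc'.intervalIntegrable 0 x) hi is
    fun t ht => hu.eq' t (hsub' ht)
  have h2 := integral_bilinear_deriv hb hx.1 (hzs.intervalIntegrable 0 x) hi' is'
    fun t ht => hu.eq t (hsub' ht)
  have cu : ContinuousOn u (uIcc 0 x) := hu.cont.mono (by rwa [uIcc_of_le hx.1])
  have cu' : ContinuousOn u' (uIcc 0 x) := hu.cont'.mono (by rwa [uIcc_of_le hx.1])
  have I1 : IntervalIntegrable (fun t => s t • (A t (u t) - z • u t) + s' t • u' t) volume 0 x :=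
    (intervalIntegrable_bilinear_right hb hsc.continuousOn hi).add
      (hsc'.continuousOn.smul cu').intervalIntegrable
  have I2 : IntervalIntegrable (fun t => s' t • u' t + (-z * s t) • u t) volume 0 x :=
    ((hsc'.continuousOn.smul cu').add (hzs.continuousOn.smul cu)).intervalIntegrable
  rw [← h1, ← h2, ← intervalIntegral.integral_sub I1 I2]
  refine intervalIntegral.integral_congr fun t _ => ?_
  simp only [smul_sub, smul_smul, neg_mul, neg_smul, mul_comm z (s t)]
  abel

theorem IsVectorSolution.eq_sin_integral (hu : IsVectorSolution A (k ^ 2) u u')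
    (hA : IntervalIntegrable A volume 0 1) (hk : k ≠ 0) {x : ℝ} (hx : x ∈ Icc (0 : ℝ) 1) :
    u x = Complex.cos (k * x) • u 0 + (Complex.sin (k * x) / k) • u' 0 +
      k⁻¹ • ∫ t in (0 : ℝ)..x, Complex.sin (k * (x - t)) • A t (u t) := by
  have hlin : ∀ t : ℝ, HasDerivAt (fun t : ℝ => k * ((x : ℂ) - t)) (-k) t := fun t => by
    simpa using ((Complex.ofRealCLM.hasDerivAt (x := t)).const_sub (x : ℂ)).const_mul k
  have h := hu.integral_smul_eq hA (s := fun t => Complex.sin (k * (x - t)))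
    (s' := fun t => -(k * Complex.cos (k * (x - t))))
    (fun t => by
      have := (Complex.hasDerivAt_sin _).comp t (hlin t)
      exact this.congr_deriv (by ring))
    (fun t => by
      have := (((Complex.hasDerivAt_cos _).comp t (hlin t)).const_mul k).fun_neg
      exact this.congr_deriv (by ring)) hx
  rw [h]
  simp only [sub_self, mul_zero, Complex.sin_zero, Complex.cos_zero, Complex.ofReal_zero, sub_zero,
    zero_smul, mul_one, smul_sub, smul_smul, zero_sub, neg_smul, smul_neg]
  rw [← mul_assoc, inv_mul_cancel₀ hk]
  simp only [one_smul, one_mul, div_eq_inv_mul]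
  abel

theorem IsVectorSolution.deriv_eq_cos_integral (hu : IsVectorSolution A (k ^ 2) u u')
    (hA : IntervalIntegrable A volume 0 1) {x : ℝ} (hx : x ∈ Icc (0 : ℝ) 1) :
    u' x = -(k * Complex.sin (k * x)) • u 0 + Complex.cos (k * x) • u' 0 +
      ∫ t in (0 : ℝ)..x, Complex.cos (k * (x - t)) • A t (u t) := by
  have hlin : ∀ t : ℝ, HasDerivAt (fun t : ℝ => k * ((x : ℂ) - t)) (-k) t := fun t => by
    simpa using ((Complex.ofRealCLM.hasDerivAt (x := t)).const_sub (x : ℂ)).const_mul k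
  have h := hu.integral_smul_eq hA (s := fun t => Complex.cos (k * (x - t)))
    (s' := fun t => k * Complex.sin (k * (x - t)))
    (fun t => by
      have := (Complex.hasDerivAt_cos _).comp t (hlin t)
      exact this.congr_deriv (by ring))
    (fun t => by
      have := ((Complex.hasDerivAt_sin _).comp t (hlin t)).const_mul k
      exact this.congr_deriv (by ring)) hx
  rw [h]
  simp only [sub_self, mul_zero, Complex.sin_zero, Complex.cos_zero, Complex.ofReal_zero, sub_zero,
    zero_smul, one_smul, zero_sub, neg_smul]
  abel

theorem norm_sin_mul_le {x : ℝ} (hx : 0 ≤ x) (k : ℂ) :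
    ‖Complex.sin (k * x)‖ ≤ Real.exp (|k.im| * x) := by
  simpa [abs_mul, abs_of_nonneg hx] using norm_sin_le (k * x)

theorem norm_cos_mul_le {x : ℝ} (hx : 0 ≤ x) (k : ℂ) :
    ‖Complex.cos (k * x)‖ ≤ Real.exp (|k.im| * x) := by
  simpa [abs_mul, abs_of_nonneg hx] using norm_cos_le (k * x)

/-- Let `M` be the maximum of `e^{-|Im k| x} ‖u(x)‖`. Variation of constants gives `M ≤ D + (Q/|k|)
M` with `D` the scaled initial data, and `2Q ≤ |k|` allows half of `M` to be absorbed. -/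
theorem IsVectorSolution.norm_le_exp (hu : IsVectorSolution A (k ^ 2) u u')
    (hA : IntervalIntegrable A volume 0 1) (hk : k ≠ 0)
    (hkA : 2 * (∫ t in (0 : ℝ)..1, ‖A t‖) ≤ ‖k‖) :
    ∀ x ∈ Icc (0 : ℝ) 1, ‖u x‖ ≤ 2 * (‖u 0‖ + ‖u' 0‖ / ‖k‖) * Real.exp (|k.im| * x) := by
  set Q := ∫ t in (0 : ℝ)..1, ‖A t‖ with hQ
  set h := |k.im| with hh
  have hk0 : 0 < ‖k‖ := norm_pos_iff.2 hk
  obtain ⟨x₀, hx₀, hmax⟩ := isCompact_Icc.exists_isMaxOn (nonempty_Icc.2 zero_le_one)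
    (f := fun x => Real.exp (-(h * x)) * ‖u x‖)
    ((Continuous.continuousOn (by fun_prop)).mul hu.cont.norm)
  set M := Real.exp (-(h * x₀)) * ‖u x₀‖ with hM
  have hM0 : 0 ≤ M := by positivity
  have hbd : ∀ x ∈ Icc (0 : ℝ) 1, ‖u x‖ ≤ M * Real.exp (h * x) := fun x hx => by
    have h1 : Real.exp (-(h * x)) * ‖u x‖ ≤ M := hmax hx
    calc ‖u x‖ = Real.exp (-(h * x)) * ‖u x‖ * Real.exp (h * x) := by
          rw [mul_right_comm, ← Real.exp_add]; simp
      _ ≤ _ := by gcongr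
  set D := ‖u 0‖ + ‖u' 0‖ / ‖k‖ with hD
  have hint : ‖∫ t in (0 : ℝ)..x₀, Complex.sin (k * (x₀ - t)) • A t (u t)‖ ≤
      Q * M * Real.exp (h * x₀) := by
    refine norm_integral_smul_apply_le hA hx₀ hM0 (fun t ht => ?_)
      fun t ht => hbd t ⟨ht.1, ht.2.trans hx₀.2⟩
    have := norm_sin_mul_le (sub_nonneg.2 ht.2) k
    rwa [Complex.ofReal_sub] at this
  have hs := norm_sin_mul_le hx₀.1 k
  have hc := norm_cos_mul_le hx₀.1 k
  have hux : ‖u x₀‖ ≤ (D + M / 2) * Real.exp (h * x₀) := by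
    rw [hu.eq_sin_integral hA hk hx₀]
    calc _ ≤ ‖Complex.cos (k * x₀) • u 0‖ + ‖(Complex.sin (k * x₀) / k) • u' 0‖ +
          ‖k⁻¹ • ∫ t in (0 : ℝ)..x₀, Complex.sin (k * (x₀ - t)) • A t (u t)‖ := norm_add₃_le
      _ ≤ Real.exp (h * x₀) * ‖u 0‖ + Real.exp (h * x₀) / ‖k‖ * ‖u' 0‖ +
          ‖k‖⁻¹ * (Q * M * Real.exp (h * x₀)) := by
          rw [norm_smul, norm_smul, norm_smul, norm_div, norm_inv]
          gcongr
      _ = (D + Q / ‖k‖ * M) * Real.exp (h * x₀) := by rw [hD]; field_simp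
      _ ≤ (D + 1 / 2 * M) * Real.exp (h * x₀) := by
          have : Q / ‖k‖ ≤ 1 / 2 := by
            rw [div_le_div_iff₀ hk0 two_pos]; linarith
          gcongr
      _ = _ := by ring
  have hMD : M ≤ D + M / 2 := by
    calc M ≤ Real.exp (-(h * x₀)) * ((D + M / 2) * Real.exp (h * x₀)) := by
          rw [hM]; gcongr
      _ = D + M / 2 := by
          rw [mul_comm (D + M / 2), ← mul_assoc, ← Real.exp_add]; simp
  intro x hx
  refine (hbd x hx).trans ?_
  have : M ≤ 2 * D := by linarith
  gcongr

/-- Large-`k` asymptotics of the boundary value at `1` of the solutions satisfying the condition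
at `0`, in the scaling in which the leading term is bounded. -/
theorem IsVectorSolution.boundary_asymptotics (hu : IsVectorSolution A (k ^ 2) u u')
    (hA : IntervalIntegrable A volume 0 1)
    {Tm Tp a b : E →L[ℂ] E} (hTm : IsStarProjection Tm) (hTp : IsStarProjection Tp)
    (hbT : ∀ x, b x - Tp (b x) = b x) (hk : 1 ≤ ‖k‖)
    (hkA : 2 * (∫ t in (0 : ℝ)..1, ‖A t‖) ≤ ‖k‖) {w y : E}
    (h0 : u 0 = k⁻¹ • (w - Tm w)) (h1 : u' 0 = Tm w + a (u 0))
    (hy : y = (u' 1 + b (u 1)) - Tp (u' 1 + b (u 1)) - Tp (u 1)) {C : ℝ}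
    (hC : C = 2 * (2 * (∫ t in (0 : ℝ)..1, ‖A t‖) * (2 + ‖a‖) + ‖a‖) + 2 * ‖b‖ * (2 + ‖a‖))
    {p q : E} (hp : p = -Complex.sin k • (w - Tm w) + Complex.cos k • Tm w)
    (hq : q = Complex.cos k • (w - Tm w) + Complex.sin k • Tm w) :
    ‖(y - Tp y) + k • Tp y - (p - Tp p - Tp q)‖ ≤ C * Real.exp |k.im| * ‖w‖ / ‖k‖ := by
  set Q := ∫ t in (0 : ℝ)..1, ‖A t‖ with hQ
  have hQ0 : 0 ≤ Q := intervalIntegral.integral_nonneg zero_le_one fun _ _ => norm_nonneg _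
  have hk0 : 0 < ‖k‖ := one_pos.trans_le hk
  have hkne : k ≠ 0 := norm_pos_iff.1 hk0
  set e := Real.exp |k.im| with he
  have he0 : 0 < e := Real.exp_pos _
  have z1 : (1 : ℝ) ∈ Icc (0 : ℝ) 1 := ⟨zero_le_one, le_rfl⟩
  set δ := ‖w‖ / ‖k‖ with hδ
  have hδ0 : 0 ≤ δ := by positivity
  have nT : ‖w - Tm w‖ ≤ ‖w‖ := norm_apply_le_of_isStarProjection hTm.one_sub w
  have nT' : ‖Tm w‖ ≤ ‖w‖ := norm_apply_le_of_isStarProjection hTm w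
  have nu0 : ‖u 0‖ ≤ δ := by
    rw [h0, norm_smul, norm_inv, hδ, div_eq_inv_mul]; gcongr
  have nau : ‖a (u 0)‖ ≤ ‖a‖ * δ := (a.le_opNorm _).trans (by gcongr)
  have nD : ‖u 0‖ + ‖u' 0‖ / ‖k‖ ≤ (2 + ‖a‖) * δ := by
    have : ‖u' 0‖ ≤ ‖w‖ + ‖a‖ * δ := by
      rw [h1]; exact (norm_add_le _ _).trans (add_le_add nT' nau)
    have h2 : ‖u' 0‖ / ‖k‖ ≤ δ + ‖a‖ * δ := by
      calc _ ≤ (‖w‖ + ‖a‖ * δ) / ‖k‖ := by gcongr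
        _ = δ + ‖a‖ * δ / ‖k‖ := by rw [add_div]
        _ ≤ _ := by gcongr; exact div_le_self (by positivity) hk
    linarith
  have hM0 : 0 ≤ 2 * (‖u 0‖ + ‖u' 0‖ / ‖k‖) := by positivity
  have hbd := hu.norm_le_exp hA hkne hkA
  have hint : ∀ c : ℝ → ℂ, (∀ t ∈ Icc (0 : ℝ) 1, ‖c t‖ ≤ Real.exp (|k.im| * (1 - t))) →
      ‖∫ t in (0 : ℝ)..1, c t • A t (u t)‖ ≤ 2 * Q * (2 + ‖a‖) * δ * e := by
    intro c hc
    refine (norm_integral_smul_apply_le hA z1 hM0 hc fun t ht => hbd t ht).trans ?_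
    rw [mul_one]
    calc _ ≤ Q * (2 * ((2 + ‖a‖) * δ)) * e := by gcongr
      _ = _ := by ring
  have hS := hint (fun t => Complex.sin (k * ((1 : ℝ) - t))) fun t ht => by
    have := norm_sin_mul_le (sub_nonneg.2 ht.2) k
    rwa [Complex.ofReal_sub] at this
  have hCo := hint (fun t => Complex.cos (k * ((1 : ℝ) - t))) fun t ht => by
    have := norm_cos_mul_le (sub_nonneg.2 ht.2) k
    rwa [Complex.ofReal_sub] at this
  -- The vectors `q` and `p` are the values of `k u(1)` and `u'(1)` for `V = 0`, `a = 0`. What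
  -- remains involves only `a (u 0)` and `A u`, both smaller by a factor `1/|k|` because `u 0`
  -- carries `k⁻¹`.
  have e1 : k • u 1 - q = Complex.sin k • a (u 0) +
      ∫ t in (0 : ℝ)..1, Complex.sin (k * ((1 : ℝ) - t)) • A t (u t) := by
    conv_lhs => rw [hu.eq_sin_integral hA hkne z1]
    rw [hq, h1, smul_add, smul_add, smul_inv_smul₀ hkne, smul_smul, smul_smul]
    conv_lhs => rw [h0, smul_smul]
    rw [mul_right_comm, mul_inv_cancel₀ hkne, one_mul, mul_div_cancel₀ _ hkne]
    simp only [Complex.ofReal_one, mul_one, smul_add]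
    rw [h0]
    abel
  have e2 : u' 1 - p = Complex.cos k • a (u 0) +
      ∫ t in (0 : ℝ)..1, Complex.cos (k * ((1 : ℝ) - t)) • A t (u t) := by
    conv_lhs => rw [hu.deriv_eq_cos_integral hA z1]
    rw [hp, h1]
    conv_lhs => rw [h0, smul_smul]
    rw [neg_mul, mul_right_comm, mul_inv_cancel₀ hkne, one_mul]
    simp only [Complex.ofReal_one, mul_one, smul_add]
    rw [h0]
    abel
  have n1 : ‖k • u 1 - q‖ ≤ (2 * Q * (2 + ‖a‖) + ‖a‖) * δ * e := by
    rw [e1]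
    refine (norm_add_le _ _).trans ?_
    have : ‖Complex.sin k • a (u 0)‖ ≤ e * (‖a‖ * δ) := by
      rw [norm_smul]; gcongr; exact norm_sin_le k
    linarith
  have n2 : ‖u' 1 - p‖ ≤ (2 * Q * (2 + ‖a‖) + ‖a‖) * δ * e := by
    rw [e2]
    refine (norm_add_le _ _).trans ?_
    have : ‖Complex.cos k • a (u 0)‖ ≤ e * (‖a‖ * δ) := by
      rw [norm_smul]; gcongr; exact norm_cos_le k
    linarith
  have n3 : ‖b (u 1)‖ ≤ 2 * ‖b‖ * (2 + ‖a‖) * δ * e := by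
    have h2 := hbd 1 z1
    rw [mul_one] at h2
    calc _ ≤ ‖b‖ * ‖u 1‖ := b.le_opNorm _
      _ ≤ ‖b‖ * (2 * ((2 + ‖a‖) * δ) * e) := by gcongr; exact h2.trans (by gcongr)
      _ = _ := by ring
  have hTT : ∀ x, Tp (Tp x) = Tp x := fun x => by
    rw [← mul_apply_eq_comp, hTp.isIdempotentElem.eq]
  have hTbx : ∀ x, Tp (b x) = 0 := fun x => by
    have := hbT x
    rwa [sub_eq_self] at this
  -- The `Tp`-part of `y` is `-Tp (u 1)`; multiplication by `k` brings it to the order of the `u' 1`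
  -- part.
  have e3 : (y - Tp y) + k • Tp y - (p - Tp p - Tp q) =
      ((u' 1 - p) - Tp (u' 1 - p)) + b (u 1) - Tp (k • u 1 - q) := by
    rw [hy]
    simp only [map_sub, map_add, hTT, hTbx, map_smul, smul_sub, smul_add, smul_zero, map_zero]
    abel
  rw [e3]
  have m1 : ‖(u' 1 - p) - Tp (u' 1 - p)‖ ≤ ‖u' 1 - p‖ :=
    norm_apply_le_of_isStarProjection hTp.one_sub _
  have m2 : ‖Tp (k • u 1 - q)‖ ≤ ‖k • u 1 - q‖ := norm_apply_le_of_isStarProjection hTp _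
  calc _ ≤ ‖(u' 1 - p) - Tp (u' 1 - p)‖ + ‖b (u 1)‖ + ‖Tp (k • u 1 - q)‖ :=
        (norm_sub_le _ _).trans (by gcongr; exact norm_add_le _ _)
    _ ≤ (2 * Q * (2 + ‖a‖) + ‖a‖) * δ * e + 2 * ‖b‖ * (2 + ‖a‖) * δ * e +
        (2 * Q * (2 + ‖a‖) + ‖a‖) * δ * e :=
        add_le_add (add_le_add (m1.trans n2) n3) (m2.trans n1)
    _ = _ := by rw [hC, hδ]; ring

end Asymptotics
-- Passing between matrix solutions and their columns
section Matrices

open Set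

variable {N : ℕ}

/-- The operator on `ℂ^N` given by a matrix. -/
noncomputable def op (M : Matrix (Fin N) (Fin N) ℂ) :
    EuclideanSpace ℂ (Fin N) →L[ℂ] EuclideanSpace ℂ (Fin N) :=
  Matrix.toEuclideanCLM (n := Fin N) (𝕜 := ℂ) M

theorem op_apply (M : Matrix (Fin N) (Fin N) ℂ) (x : EuclideanSpace ℂ (Fin N)) :
    op M x = WithLp.toLp 2 (M *ᵥ x.ofLp) := rfl

theorem op_sub (M M' : Matrix (Fin N) (Fin N) ℂ) : op (M - M') = op M - op M' := map_sub _ _ _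

theorem op_add (M M' : Matrix (Fin N) (Fin N) ℂ) : op (M + M') = op M + op M' := map_add _ _ _

theorem op_mul (M M' : Matrix (Fin N) (Fin N) ℂ) : op (M * M') = op M * op M' := map_mul _ _ _

theorem op_one : op (1 : Matrix (Fin N) (Fin N) ℂ) = 1 := map_one _

theorem im_inner_op {M : Matrix (Fin N) (Fin N) ℂ} (hM : M.IsHermitian)
    (x : EuclideanSpace ℂ (Fin N)) : (inner ℂ x (op M x)).im = 0 := by
  have h : IsSelfAdjoint (op M) := by
    rw [isSelfAdjoint_iff, op, ← map_star]
    exact congrArg _ hM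
  have h1 : inner ℂ (op M x) x = inner ℂ x (op M x) := by
    rw [← ContinuousLinearMap.adjoint_inner_right]
    congr 1
    exact congrArg (fun T : EuclideanSpace ℂ (Fin N) →L[ℂ] EuclideanSpace ℂ (Fin N) => T x) h
  rw [← inner_conj_symm] at h1
  exact Complex.conj_eq_iff_im.1 h1

theorem isStarProjection_op {M : Matrix (Fin N) (Fin N) ℂ} (hM : IsStarProjection M) :
    IsStarProjection (op M) :=
  hM.map (Matrix.toEuclideanCLM (n := Fin N) (𝕜 := ℂ))

theorem intervalIntegrable_op {V : ℝ → Matrix (Fin N) (Fin N) ℂ}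
    (hV : ∀ i j, IntervalIntegrable (fun t => V t i j) volume 0 1) :
    IntervalIntegrable (fun t => op (V t)) volume 0 1 := by
  have h : (fun t => op (V t)) = fun t => ∑ i, ∑ j, V t i j • op (Matrix.single i j 1) := by
    funext t
    conv_lhs => rw [Matrix.matrix_eq_sum_single (V t)]
    simp only [op, map_sum]
    refine Finset.sum_congr rfl fun i _ => Finset.sum_congr rfl fun j _ => ?_
    rw [← map_smul, Matrix.smul_single, smul_eq_mul, mul_one]
  rw [h]
  rw [intervalIntegrable_iff]
  have h1 : ∀ i j, Integrable (fun t => V t i j • op (Matrix.single i j 1))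
      (volume.restrict (uIoc 0 1)) := fun i j => (intervalIntegrable_iff.1 (hV i j)).smul_const _
  have h2 : ∀ i, Integrable (fun t => ∑ j, V t i j • op (Matrix.single i j 1))
      (volume.restrict (uIoc 0 1)) := fun i =>
    integrable_finsetSum (f := fun j t => V t i j • op (Matrix.single i j 1)) _ fun j _ => h1 i j
  exact integrable_finsetSum
    (f := fun i t => ∑ j, V t i j • op (Matrix.single i j 1)) _ fun i _ => h2 i

/-- The coordinate functionals of `ℂ^N`. -/
noncomputable def coord (i : Fin N) : EuclideanSpace ℂ (Fin N) →L[ℂ] ℂ := EuclideanSpace.proj i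

theorem euclideanSpace_eq_add_integral_iff {f : ℝ → EuclideanSpace ℂ (Fin N)} {s t : ℝ}
    (hf : IntervalIntegrable f volume s t) (x y : EuclideanSpace ℂ (Fin N)) :
    x = y + ∫ r in s..t, f r ↔ ∀ i, x i = y i + ∫ r in s..t, f r i := by
  have h : ∀ i, (∫ r in s..t, f r) i = ∫ r in s..t, f r i := fun i =>
    ((coord i).intervalIntegral_comp_comm hf).symm
  constructor
  · intro hx i
    rw [hx, PiLp.add_apply, h]
  · intro hx
    ext i
    rw [hx, PiLp.add_apply, h]

theorem isSolution_iff {κ : Type} {V : ℝ → Matrix (Fin N) (Fin N) ℂ}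
    (hV : ∀ i j, IntervalIntegrable (fun t => V t i j) volume 0 1) {z : ℂ}
    {ψ ψ' : ℝ → Matrix (Fin N) κ ℂ} :
    IsSolution V z ψ ψ' ↔ ∀ j, IsVectorSolution (fun t => op (V t)) z
      (fun x => WithLp.toLp 2 fun i => ψ x i j) (fun x => WithLp.toLp 2 fun i => ψ' x i j) := by
  have hc : ∀ (φ : ℝ → Matrix (Fin N) κ ℂ), (∀ j, ContinuousOn
      (fun x => (WithLp.toLp 2 fun i => φ x i j : EuclideanSpace ℂ (Fin N))) (Icc 0 1)) ↔
      ∀ i j, ContinuousOn (fun x => φ x i j) (Icc 0 1) := by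
    intro φ
    constructor
    · intro h i j
      exact (coord i).continuous.comp_continuousOn
        (h j)
    · intro h j
      exact (PiLp.continuous_toLp 2 _).comp_continuousOn (continuousOn_pi.2 fun i => h i j)
  have hI : uIcc (0 : ℝ) 1 = Icc 0 1 := uIcc_of_le zero_le_one
  have hsub : ∀ x ∈ Icc (0 : ℝ) 1, uIcc 0 x ⊆ uIcc (0 : ℝ) 1 := fun x hx =>
    uIcc_subset_uIcc_left (by rwa [hI])
  have hA := intervalIntegrable_op hV
  constructor
  · intro h j
    have c := (hc ψ).2 h.cont j
    have c' := (hc ψ').2 h.cont' j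
    refine ⟨c, c', fun x hx => ?_, fun x hx => ?_⟩
    · exact (euclideanSpace_eq_add_integral_iff (ContinuousOn.intervalIntegrable
        (c'.mono (by rw [← hI]; exact hsub x hx))) _ _).2 fun i => h.eq x hx i j
    · have hi : IntervalIntegrable (fun t => op (V t) (WithLp.toLp 2 fun i => ψ t i j) -
          z • (WithLp.toLp 2 fun i => ψ t i j : EuclideanSpace ℂ (Fin N))) volume 0 x :=
        ((intervalIntegrable_apply hA c).mono_set (hsub x hx)).sub
        ((ContinuousOn.intervalIntegrable (c.mono (by rw [← hI]; exact hsub x hx))).smul z)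
      exact (euclideanSpace_eq_add_integral_iff hi _ _).2 fun i => h.eq' x hx i j
  · intro h
    refine ⟨(hc ψ).1 fun j => (h j).cont, (hc ψ').1 fun j => (h j).cont', fun x hx i j => ?_,
      fun x hx i j => ?_⟩
    · exact (euclideanSpace_eq_add_integral_iff
        ((h j).intervalIntegrable'.mono_set (hsub x hx)) _ _).1 ((h j).eq x hx) i
    · exact (euclideanSpace_eq_add_integral_iff
        (((h j).intervalIntegrable hA).mono_set (hsub x hx)) _ _).1 ((h j).eq' x hx) i

theorem IsSolution.mul_right {κ κ' : Type} [Fintype κ] {V : ℝ → Matrix (Fin N) (Fin N) ℂ}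
    (hV : ∀ i j, IntervalIntegrable (fun t => V t i j) volume 0 1) {z : ℂ}
    {ψ ψ' : ℝ → Matrix (Fin N) κ ℂ} (h : IsSolution V z ψ ψ') (C : Matrix κ κ' ℂ) :
    IsSolution V z (fun x => ψ x * C) (fun x => ψ' x * C) := by
  have hI : uIcc (0 : ℝ) 1 = Icc 0 1 := uIcc_of_le zero_le_one
  have hsub : ∀ x ∈ Icc (0 : ℝ) 1, uIcc 0 x ⊆ uIcc (0 : ℝ) 1 := fun x hx =>
    uIcc_subset_uIcc_left (by rwa [hI])
  have hsub' : ∀ x ∈ Icc (0 : ℝ) 1, uIcc 0 x ⊆ Icc (0 : ℝ) 1 := fun x hx => by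
    rw [← hI]; exact hsub x hx
  refine ⟨fun i j => ?_, fun i j => ?_, fun x hx i j => ?_, fun x hx i j => ?_⟩
  · simp only [Matrix.mul_apply]
    exact continuousOn_finsetSum _ fun l _ => (h.cont i l).mul continuousOn_const
  · simp only [Matrix.mul_apply]
    exact continuousOn_finsetSum _ fun l _ => (h.cont' i l).mul continuousOn_const
  · simp only [Matrix.mul_apply]
    rw [intervalIntegral.integral_finsetSum fun l _ =>
      (((h.cont' i l).mono (hsub' x hx)).intervalIntegrable).mul_const _, ← Finset.sum_add_distrib]
    refine Finset.sum_congr rfl fun l _ => ?_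
    rw [intervalIntegral.integral_mul_const, ← add_mul, h.eq x hx]
  · have hi : ∀ l, IntervalIntegrable (fun t => (V t * ψ t - z • ψ t) i l) volume 0 x := by
      intro l
      have h1 := (((isSolution_iff hV).1 h l).intervalIntegrable
        (intervalIntegrable_op hV)).mono_set (hsub x hx)
      rw [intervalIntegrable_iff] at h1 ⊢
      exact (coord i).integrable_comp h1
    have e : ∀ t, (V t * (ψ t * C) - z • (ψ t * C)) i j =
        ∑ l, (V t * ψ t - z • ψ t) i l * C l j := by
      intro t
      rw [← Matrix.mul_assoc, ← Matrix.smul_mul, ← Matrix.sub_mul, Matrix.mul_apply]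
    simp only [e]
    simp only [Matrix.mul_apply (M := ψ' _)]
    rw [intervalIntegral.integral_finsetSum fun l _ => (hi l).mul_const _,
      ← Finset.sum_add_distrib]
    refine Finset.sum_congr rfl fun l _ => ?_
    rw [intervalIntegral.integral_mul_const, ← add_mul, h.eq' x hx]

end Matrices
-- The fundamental solution and the boundary matrix `W`
namespace Problem

open Set

variable {N : ℕ} (p : Problem N)

theorem intervalIntegrable_V (i j : Fin N) : IntervalIntegrable (fun t => p.V t i j) volume 0 1 :=
  (intervalIntegrable_iff_integrableOn_Icc_of_le zero_le_one).2 (p.V_integrable i j)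

theorem intervalIntegrable_op_V : IntervalIntegrable (fun t => op (p.V t)) volume 0 1 :=
  intervalIntegrable_op p.intervalIntegrable_V

theorem im_inner_op_V : ∀ᵐ t ∂(volume.restrict (Icc (0 : ℝ) 1)),
    ∀ x, (inner ℂ x (op (p.V t) x)).im = 0 :=
  p.V_hermitian.mono fun _ ht x => im_inner_op ht x

theorem Tm_mul_Tm : p.Tm * p.Tm = p.Tm := p.Tm_proj.isIdempotentElem.eq

theorem Tm_mul_a : p.Tm * p.a = 0 := by
  rw [p.a_eq, ← mul_assoc, ← mul_assoc, mul_sub p.Tm, mul_one, p.Tm_mul_Tm, sub_self, zero_mul,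
    zero_mul]

theorem a_mul_Tm : p.a * p.Tm = 0 := by
  rw [p.a_eq, mul_assoc, sub_mul 1 _ p.Tm, one_mul, p.Tm_mul_Tm, sub_self, mul_zero]

theorem Tp_mul_b : p.Tp * p.b = 0 := by
  rw [p.b_eq, ← mul_assoc, ← mul_assoc, mul_sub p.Tp, mul_one, p.Tp_proj.isIdempotentElem.eq,
    sub_self, zero_mul, zero_mul]

/-- Multiplication by `Tm` separates the conditions, since `Tm a = a Tm = 0`. The normalisation
becomes an initial value problem, so existence and uniqueness apply. -/
theorem initial_values_iff (F F' : ℝ → Matrix (Fin N) (Fin N) ℂ) :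
    p.Γm F F' = 0 ∧ p.ΓmPerp F F' = 1 ↔ F 0 = 1 - p.Tm ∧ F' 0 = p.Tm + p.a := by
  have hT := p.Tm_mul_Tm
  have hTa := p.Tm_mul_a
  have haT := p.a_mul_Tm
  have hT1 : p.Tm * (1 - p.Tm) = 0 := by rw [mul_sub, mul_one, hT, sub_self]
  have hT2 : (1 - p.Tm) * p.Tm = 0 := by rw [sub_mul, one_mul, hT, sub_self]
  simp only [Γm, ΓmPerp]
  constructor
  · rintro ⟨h0, h1⟩
    have e1 : p.Tm * F 0 = 0 := by
      have := congrArg (fun X => p.Tm * X) h0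
      simp only [mul_sub, ← mul_assoc, hT1, hT, zero_mul, mul_zero] at this
      simpa [hT, hT1, mul_sub, ← mul_assoc] using this
    have e2 : p.Tm * F' 0 = p.Tm := by
      have := congrArg (fun X => p.Tm * X) h1
      simpa only [mul_add, ← mul_assoc, hT1, hT, zero_mul, zero_add, mul_one] using this
    have e3 : F 0 = 1 - p.Tm := by
      rw [e2, sub_mul, one_mul, e1, sub_zero] at h1
      exact eq_sub_of_add_eq h1
    refine ⟨e3, ?_⟩
    have e4 : p.a * F 0 = p.a := by rw [e3, mul_sub, haT, mul_one, sub_zero]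
    rw [e1, e4, sub_zero, sub_mul, one_mul, mul_sub, e2, hTa, sub_zero] at h0
    rw [sub_eq_zero, sub_eq_iff_eq_add] at h0
    rw [h0, add_comm]
  · rintro ⟨h0, h1⟩
    rw [h0, h1]
    constructor
    · simp only [mul_sub, mul_add, sub_mul, hT, hTa, haT, one_mul, mul_one, mul_zero]
      abel
    · simp only [mul_sub, mul_add, sub_mul, hT, hTa, one_mul, mul_one]
      abel

theorem exists_fundamental : ∃ F F' : ℂ → ℝ → Matrix (Fin N) (Fin N) ℂ,
    (∀ z, IsSolution p.V z (F z) (F' z) ∧ p.Γm (F z) (F' z) = 0 ∧ p.ΓmPerp (F z) (F' z) = 1) ∧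
    ∀ i j, Differentiable ℂ (fun z => F z 1 i j) ∧ Differentiable ℂ (fun z => F' z 1 i j) := by
  choose u u' hu h0 h1 hd hd' using fun j : Fin N =>
    exists_isVectorSolution p.intervalIntegrable_op_V
      (WithLp.toLp 2 fun i => (1 - p.Tm) i j) (WithLp.toLp 2 fun i => (p.Tm + p.a) i j)
  refine ⟨fun z x => Matrix.of fun i j => u j z x i, fun z x => Matrix.of fun i j => u' j z x i,
    fun z => ⟨(isSolution_iff p.intervalIntegrable_V).2 fun j => hu j z,
      (p.initial_values_iff _ _).2 ⟨?_, ?_⟩⟩, fun i j => ⟨?_, ?_⟩⟩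
  · ext i j; simp [h0]
  · ext i j; simp [h1]
  · exact (coord i).differentiable.comp (hd j)
  · exact (coord i).differentiable.comp (hd' j)

theorem fundamental_spec (z : ℂ) : IsSolution p.V z (p.fundamental z).1 (p.fundamental z).2 ∧
    p.Γm (p.fundamental z).1 (p.fundamental z).2 = 0 ∧
    p.ΓmPerp (p.fundamental z).1 (p.fundamental z).2 = 1 := by
  obtain ⟨F, F', hF, -⟩ := p.exists_fundamental
  exact Classical.epsilon_spec
    (p := fun F : (ℝ → Matrix (Fin N) (Fin N) ℂ) × (ℝ → Matrix (Fin N) (Fin N) ℂ) =>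
      IsSolution p.V z F.1 F.2 ∧ p.Γm F.1 F.2 = 0 ∧ p.ΓmPerp F.1 F.2 = 1) ⟨(F z, F' z), hF z⟩

/-- The functions in `fundamental` are chosen separately for each `z`; uniqueness identifies their
values at `1` with those of the analytic family. -/
theorem differentiable_W (i j : Fin N) : Differentiable ℂ fun z => p.W z i j := by
  obtain ⟨F, F', hF, hd⟩ := p.exists_fundamental
  have h : ∀ z, p.W z = (1 - p.Tp) * (F' z 1 + p.b * F z 1) - p.Tp * F z 1 := by
    intro z
    obtain ⟨hs, hb⟩ := p.fundamental_spec z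
    obtain ⟨hs', hb'⟩ := hF z
    rw [p.initial_values_iff] at hb hb'
    have huniq := fun l => IsVectorSolution.eq_of_initial p.intervalIntegrable_op_V
      ((isSolution_iff p.intervalIntegrable_V).1 hs l)
      ((isSolution_iff p.intervalIntegrable_V).1 hs' l) (by rw [hb.1, hb'.1])
      (by rw [hb.2, hb'.2]) 1 ⟨zero_le_one, le_rfl⟩
    have e1 : (p.fundamental z).1 1 = F z 1 := by
      ext k l
      exact congrArg (coord k) (huniq l).1
    have e2 : (p.fundamental z).2 1 = F' z 1 := by
      ext k l
      exact congrArg (coord k) (huniq l).2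
    rw [W, Γp, e1, e2]
  have h2 : (fun z => p.W z i j) = fun z => ∑ k, (1 - p.Tp) i k * (F' z 1 k j +
      ∑ l, p.b k l * F z 1 l j) - ∑ k, p.Tp i k * F z 1 k j := by
    funext z
    simp [h, Matrix.mul_apply]
  rw [h2]
  have h3 := fun i j => (hd i j).1
  have h4 := fun i j => (hd i j).2
  fun_prop

theorem exists_isVectorSolution_op_W (z : ℂ) (v : EuclideanSpace ℂ (Fin N)) :
    ∃ u u' : ℝ → EuclideanSpace ℂ (Fin N), IsVectorSolution (fun t => op (p.V t)) z u u' ∧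
      u 0 = v - op p.Tm v ∧ u' 0 = op p.Tm v + op p.a (u 0) ∧
      op (p.W z) v = (u' 1 + op p.b (u 1)) - op p.Tp (u' 1 + op p.b (u 1)) - op p.Tp (u 1) ∧
      ∀ x, u x = op (p.Fm x z) v := by
  obtain ⟨hs, hb⟩ := p.fundamental_spec z
  rw [p.initial_values_iff] at hb
  have h := (isSolution_iff p.intervalIntegrable_V).1
    (hs.mul_right p.intervalIntegrable_V (Matrix.of fun i (_ : Unit) => v i)) ()
  refine ⟨fun x => op ((p.fundamental z).1 x) v, fun x => op ((p.fundamental z).2 x) v, h,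
    ?_, ?_, ?_, fun x => rfl⟩
  · simp [hb.1, op_sub, op_one]
  · have : op p.a (op p.Tm v) = 0 := by
      rw [← mul_apply_eq_comp, ← op_mul, p.a_mul_Tm]
      simp [op]
    simp [hb.1, hb.2, op_sub, op_add, op_one, this]
  · simp [W, Γp, op_sub, op_add, op_mul, op_one]

/-- This guarantees that every real zero of `det W` occurs in the spectral data. The eigenfunction
is `F_- v`; were it identically zero on `[0,1]`, its initial data and hence `v` would vanish. -/
theorem isEigenvalue_of_op_W_eq_zero {z : ℂ} {v : EuclideanSpace ℂ (Fin N)} (hv : v ≠ 0)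
    (hW : op (p.W z) v = 0) : p.IsEigenvalue z := by
  obtain ⟨u, u', hu, h0, h1, -, hF⟩ := p.exists_isVectorSolution_op_W z v
  obtain ⟨hs, hb⟩ := p.fundamental_spec z
  set C : Matrix (Fin N) Unit ℂ := Matrix.of fun i _ => v i
  refine ⟨fun x => (p.fundamental z).1 x * C, fun x => (p.fundamental z).2 x * C,
    hs.mul_right p.intervalIntegrable_V C, ?_, ?_, ?_⟩
  · have : p.Γm (fun x => (p.fundamental z).1 x * C) (fun x => (p.fundamental z).2 x * C) =
        p.Γm (p.fundamental z).1 (p.fundamental z).2 * C := by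
      simp only [Γm, Matrix.mul_sub, Matrix.sub_mul, Matrix.mul_assoc]
    rw [this, hb.1, Matrix.zero_mul]
  · have : p.Γp (fun x => (p.fundamental z).1 x * C) (fun x => (p.fundamental z).2 x * C) =
        p.W z * C := by
      simp only [W, Γp, Matrix.mul_add, Matrix.sub_mul, Matrix.add_mul,
        Matrix.mul_assoc]
    rw [this]
    ext i j
    exact congrArg (coord i) hW
  · by_contra! hcon
    have hu0 : ∀ x ∈ Icc (0 : ℝ) 1, u x = 0 := by
      intro x hx
      have := hcon x hx
      rw [hF]
      ext i
      exact congrFun (congrFun this i) ()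
    have hu' := hu.norm_deriv_le p.intervalIntegrable_op_V (m := 0)
      (fun x hx => by rw [hu0 x hx, norm_zero]) 0 ⟨le_rfl, zero_le_one⟩
    rw [mul_zero, norm_le_zero_iff] at hu'
    have z0 := hu0 0 ⟨le_rfl, zero_le_one⟩
    rw [hu', z0, map_zero, add_zero] at h1
    rw [z0, ← h1, sub_zero] at h0
    exact hv h0.symm

theorem star_projections : IsStarProjection (op p.Tm) ∧ IsStarProjection (op p.Tp) :=
  ⟨isStarProjection_op p.Tm_proj, isStarProjection_op p.Tp_proj⟩

theorem op_b_sub (x : EuclideanSpace ℂ (Fin N)) : op p.b x - op p.Tp (op p.b x) = op p.b x := by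
  rw [← mul_apply_eq_comp, ← op_mul, p.Tp_mul_b]
  simp [op]

/-- Off the real axis `W` has an inverse of at most polynomial growth in `z` and `1 / |Im z|`. -/
theorem exists_norm_le_norm_op_W : ∃ C : ℝ, 0 < C ∧ ∀ (z : ℂ) (v : EuclideanSpace ℂ (Fin N)),
    |z.im| * ‖v‖ ≤ C * (1 + ‖z‖) ^ 3 * ‖op (p.W z) v‖ := by
  set Q := ∫ t in (0 : ℝ)..1, ‖op (p.V t)‖ with hQ
  have hQ0 : 0 ≤ Q := intervalIntegral.integral_nonneg zero_le_one fun _ _ => norm_nonneg _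
  refine ⟨32 * (2 + Q) ^ 3, by positivity, fun z v => ?_⟩
  obtain ⟨u, u', hu, h0, h1, hW, -⟩ := p.exists_isVectorSolution_op_W z v
  have hT := p.star_projections.1
  have hTT : ∀ x, op p.Tm (op p.Tm x) = op p.Tm x := fun x => by
    rw [← mul_apply_eq_comp, hT.isIdempotentElem.eq]
  have hTa : ∀ x, op p.Tm (op p.a x) = 0 := fun x => by
    rw [← mul_apply_eq_comp, ← op_mul, p.Tm_mul_a]
    simp [op]
  have h := hu.abs_im_mul_le p.intervalIntegrable_op_V p.im_inner_op_V hT p.star_projections.2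
    (im_inner_op p.a_hermitian) (im_inner_op p.b_hermitian) p.op_b_sub
    (by rw [h0, map_sub, hTT, sub_self])
    (by rw [h1, map_add, hTT, hTa]; abel) rfl hW
  -- This is the normalisation `Γ_-^⊥ F_- = I`, using that `u 0` lies in the range of `1 - Tm`.
  have hv : v = u 0 + op p.Tm (u' 0) := by
    rw [h1, map_add, hTT, hTa, h0]; abel
  have hvn : ‖v‖ ≤ ‖u 0‖ + ‖u' 0‖ := by
    conv_lhs => rw [hv]
    exact (norm_add_le _ _).trans (by gcongr; exact norm_apply_le_of_isStarProjection hT _)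
  calc _ ≤ |z.im| * (‖u 0‖ + ‖u' 0‖) := by gcongr
    _ ≤ 32 * (2 + Q + ‖z‖) ^ 3 * ‖op (p.W z) v‖ := h
    _ ≤ 32 * ((2 + Q) * (1 + ‖z‖)) ^ 3 * ‖op (p.W z) v‖ := by
        gcongr
        nlinarith [norm_nonneg z]
    _ = _ := by ring

/-- The leading term of the scaled boundary value `W`, for `z = k²`. -/
noncomputable def leadingTerm (k : ℂ) (w : EuclideanSpace ℂ (Fin N)) : EuclideanSpace ℂ (Fin N) :=
  let P := -Complex.sin k • (w - op p.Tm w) + Complex.cos k • op p.Tm w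
  P - op p.Tp P - op p.Tp (Complex.cos k • (w - op p.Tm w) + Complex.sin k • op p.Tm w)

/-- The blocks of `W(k²)` have different orders in `k`. The factor `k⁻¹` on the range of `1 - Tm` in
the argument and `k` on the range of `Tp` in the value bring them all to the order of `sin k` and
`cos k`, with a relative error `O(1/|k|)`. -/
theorem exists_norm_sub_leadingTerm_le : ∃ C K : ℝ, 0 ≤ C ∧ 1 ≤ K ∧
    ∀ (k : ℂ), K ≤ ‖k‖ → ∀ w y : EuclideanSpace ℂ (Fin N),
    y = op (p.W (k ^ 2)) (k⁻¹ • (w - op p.Tm w) + op p.Tm w) →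
    ‖(y - op p.Tp y) + k • op p.Tp y - p.leadingTerm k w‖ ≤
      C * Real.exp |k.im| * ‖w‖ / ‖k‖ := by
  set Q := ∫ t in (0 : ℝ)..1, ‖op (p.V t)‖ with hQ
  have hQ0 : 0 ≤ Q := intervalIntegral.integral_nonneg zero_le_one fun _ _ => norm_nonneg _
  refine ⟨2 * (2 * Q * (2 + ‖op p.a‖) + ‖op p.a‖) + 2 * ‖op p.b‖ * (2 + ‖op p.a‖), max 1 (2 * Q),
    by positivity, le_max_left _ _, fun k hk w y hy => ?_⟩
  set v := k⁻¹ • (w - op p.Tm w) + op p.Tm w with hv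
  obtain ⟨u, u', hu, h0, h1, hW, -⟩ := p.exists_isVectorSolution_op_W (k ^ 2) v
  have hT := p.star_projections.1
  have hTT : ∀ x, op p.Tm (op p.Tm x) = op p.Tm x := fun x => by
    rw [← mul_apply_eq_comp, hT.isIdempotentElem.eq]
  have hTv : op p.Tm v = op p.Tm w := by
    rw [hv]
    simp only [map_add, map_smul, map_sub, hTT, sub_self, smul_zero, zero_add]
  refine hu.boundary_asymptotics p.intervalIntegrable_op_V hT p.star_projections.2 p.op_b_sub
    ((le_max_left _ _).trans hk) ((le_max_right _ _).trans hk) (w := w) ?_ ?_ (hy.trans hW) rfl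
    rfl rfl
  · rw [h0, hTv, hv, add_sub_cancel_right]
  · rw [h1, hTv]

end Problem

/-! ### Entire matrices and removable singularities -/

theorem differentiable_det {n : ℕ} {M : ℂ → Matrix (Fin n) (Fin n) ℂ} (hM : IsEntire M) :
    Differentiable ℂ fun z => (M z).det := by
  simp only [Matrix.det_apply']
  have := fun i j => hM i j
  exact Differentiable.fun_sum fun σ _ => (differentiable_const _).mul
    (Differentiable.fun_finsetProd fun i _ => hM _ _)

theorem isEntire_adjugate {n : ℕ} {M : ℂ → Matrix (Fin n) (Fin n) ℂ} (hM : IsEntire M) :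
    IsEntire fun z => (M z).adjugate := by
  intro i j
  simp only [Matrix.adjugate_apply]
  refine differentiable_det fun k l => ?_
  simp only [Matrix.updateRow_apply]
  split_ifs
  · exact differentiable_const _
  · exact hM k l

theorem IsEntire.mul {l m n : ℕ} {f : ℂ → Matrix (Fin l) (Fin m) ℂ}
    {g : ℂ → Matrix (Fin m) (Fin n) ℂ} (hf : IsEntire f) (hg : IsEntire g) :
    IsEntire fun z => f z * g z := by
  intro i j
  simp only [Matrix.mul_apply]
  exact Differentiable.fun_sum fun k _ => (hf i k).mul (hg k j)

/-- A meromorphic function whose order is nonnegative everywhere extends to an entire function. -/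
theorem exists_entire_of_meromorphicOrderAt_nonneg {h : ℂ → ℂ} (hm : ∀ z, MeromorphicAt h z)
    (ho : ∀ z, 0 ≤ meromorphicOrderAt h z) :
    ∃ η : ℂ → ℂ, Differentiable ℂ η ∧ ∀ z, AnalyticAt ℂ h z → η z = h z := by
  have hm' : MeromorphicOn h Set.univ := fun z _ => hm z
  have han : ∀ z, AnalyticAt ℂ (toMeromorphicNFOn h Set.univ) z := fun z => by
    rw [← (meromorphicNFOn_toMeromorphicNFOn h _
      (Set.mem_univ z)).meromorphicOrderAt_nonneg_iff_analyticAt,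
      meromorphicOrderAt_toMeromorphicNFOn hm' (Set.mem_univ z)]
    exact ho z
  refine ⟨_, fun z => (han z).differentiableAt, fun z hz => ?_⟩
  exact ((han z).meromorphicNFAt.eventuallyEq_nhdsNE_iff_eventuallyEq_nhds hz.meromorphicNFAt).1
    (hm'.toMeromorphicNFOn_eq_self_on_nhdsNE (Set.mem_univ z)) |>.eq_of_nhds

/-- A meromorphic function that stays bounded on a vertical half-line ending at `z₀` has no pole
at `z₀`. -/
theorem meromorphicOrderAt_nonneg_of_bounded {h : ℂ → ℂ} {z₀ : ℂ} {C : ℝ}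
    (hm : ∀ t : ℝ, 0 < t → t < 1 → ‖h (z₀ + t * Complex.I)‖ ≤ C) :
    0 ≤ meromorphicOrderAt h z₀ := by
  by_contra! hneg
  have h1 := tendsto_norm_atTop_iff_cobounded.2 (tendsto_cobounded_of_meromorphicOrderAt_neg hneg)
  have h2 : Tendsto (fun t : ℝ => z₀ + t * Complex.I) (𝓝[>] 0) (𝓝[≠] z₀) := by
    refine tendsto_nhdsWithin_iff.2 ⟨?_, ?_⟩
    · have : Continuous fun t : ℝ => z₀ + t * Complex.I := by fun_prop
      have h3 := this.tendsto 0
      simp only [Complex.ofReal_zero, zero_mul, add_zero] at h3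
      exact h3.mono_left nhdsWithin_le_nhds
    · filter_upwards [self_mem_nhdsWithin] with t ht
      have : t ≠ 0 := ne_of_gt ht
      simpa using this
  have h4 := (h1.comp h2).eventually (eventually_gt_atTop C)
  have h5 : ∀ᶠ t : ℝ in 𝓝[>] 0, 0 < t ∧ t < 1 := Ioo_mem_nhdsGT one_pos
  obtain ⟨t, ht, ht'⟩ := (h4.and h5).exists
  exact absurd (hm t ht'.1 ht'.2) (not_le.2 ht)

/-! ### Poles of `W⁻¹` and part (i) -/

namespace Problem

variable {N : ℕ} (p : Problem N)

theorem isEntire_W : IsEntire p.W := p.differentiable_W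

theorem det_W_ne_zero {z : ℂ} (hz : z.im ≠ 0) : (p.W z).det ≠ 0 := by
  intro h
  obtain ⟨v, hv, hWv⟩ := Matrix.exists_mulVec_eq_zero_iff.2 h
  obtain ⟨C, -, hC⟩ := p.exists_norm_le_norm_op_W
  have h1 := hC z (WithLp.toLp 2 v)
  have h2 : op (p.W z) (WithLp.toLp 2 v) = 0 := by
    rw [op_apply, WithLp.ofLp_toLp, hWv]; rfl
  rw [h2, norm_zero, mul_zero] at h1
  have h3 : 0 < ‖(WithLp.toLp 2 v : EuclideanSpace ℂ (Fin N))‖ := by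
    rw [norm_pos_iff]
    intro h
    exact hv ((WithLp.toLp_eq_zero 2).1 h)
  have := mul_pos (abs_pos.2 hz) h3
  linarith

theorem exists_norm_inv_W_le : ∃ C : ℝ, 0 < C ∧ ∀ (z : ℂ), z.im ≠ 0 → ∀ k l,
    |z.im| * ‖(p.W z)⁻¹ k l‖ ≤ C * (1 + ‖z‖) ^ 3 := by
  obtain ⟨C, hC0, hC⟩ := p.exists_norm_le_norm_op_W
  refine ⟨C, hC0, fun z hz k l => ?_⟩
  set e : EuclideanSpace ℂ (Fin N) := EuclideanSpace.single l 1
  have h1 := hC z (op (p.W z)⁻¹ e)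
  rw [← mul_apply_eq_comp, ← op_mul, Matrix.mul_nonsing_inv _ (p.det_W_ne_zero hz).isUnit,
    op_one, one_apply_eq_self] at h1
  have h2 : ‖e‖ = 1 := by simp [e]
  have h3 : (op (p.W z)⁻¹ e) k = (p.W z)⁻¹ k l := by
    simp [op_apply, e]
  rw [h2, mul_one] at h1
  refine le_trans ?_ h1
  rw [← h3]
  gcongr
  exact PiLp.norm_apply_le _ k

theorem isUnit_det_W_mem_codiscrete : {z : ℂ | IsUnit (p.W z).det} ∈ codiscrete ℂ := by
  have h := AnalyticOnNhd.preimage_zero_mem_codiscrete (x := Complex.I)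
    (f := fun z => (p.W z).det) (fun z _ => (differentiable_det p.isEntire_W).analyticAt z)
    (p.det_W_ne_zero (by simp))
  filter_upwards [h] with z hz
  exact isUnit_iff_ne_zero.2 hz

theorem eventually_isUnit_det_W (z₀ : ℂ) : ∀ᶠ z in 𝓝[≠] z₀, IsUnit (p.W z).det := by
  have h := mem_codiscreteWithin_iff_forall_mem_nhdsNE.1 p.isUnit_det_W_mem_codiscrete z₀
    (Set.mem_univ _)
  rwa [Set.compl_univ, Set.union_empty] at h

theorem mul_inv_W_apply {m : ℕ} (ζ : ℂ → Matrix (Fin m) (Fin N) ℂ) (i : Fin m) (j : Fin N) :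
    (fun z => (ζ z * (p.W z)⁻¹) i j) =
      fun z => ((p.W z).det)⁻¹ * (ζ z * (p.W z).adjugate) i j := by
  funext z
  rw [Matrix.inv_def, Ring.inverse_eq_inv', Matrix.mul_smul, Matrix.smul_apply, smul_eq_mul]

theorem meromorphicAt_mul_inv_W {m : ℕ} {ζ : ℂ → Matrix (Fin m) (Fin N) ℂ} (hζ : IsEntire ζ)
    (i : Fin m) (j : Fin N) (z : ℂ) : MeromorphicAt (fun z => (ζ z * (p.W z)⁻¹) i j) z := by
  rw [mul_inv_W_apply]
  exact ((differentiable_det p.isEntire_W).analyticAt z).meromorphicAt.inv.mul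
    ((hζ.mul (isEntire_adjugate p.isEntire_W) i j).analyticAt z).meromorphicAt

theorem analyticAt_mul_inv_W {m : ℕ} {ζ : ℂ → Matrix (Fin m) (Fin N) ℂ} (hζ : IsEntire ζ)
    (i : Fin m) (j : Fin N) {z : ℂ} (hz : (p.W z).det ≠ 0) :
    AnalyticAt ℂ (fun z => (ζ z * (p.W z)⁻¹) i j) z := by
  rw [mul_inv_W_apply]
  exact (((differentiable_det p.isEntire_W).analyticAt z).inv hz).mul
    ((hζ.mul (isEntire_adjugate p.isEntire_W) i j).analyticAt z)

/-- At a real zero of `det W` the function `(z - μ) W(z)⁻¹` has a limit. -/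
theorem exists_tendsto_sub_mul_inv_W (μ : ℝ) : ∃ R : Matrix (Fin N) (Fin N) ℂ,
    (∀ k l, Tendsto (fun z : ℂ => (z - μ) * (p.W z)⁻¹ k l) (𝓝[≠] (μ : ℂ)) (𝓝 (R k l))) ∧
    p.W μ * R = 0 := by
  obtain ⟨C, hC0, hC⟩ := p.exists_norm_inv_W_le
  have hmer : ∀ k l, MeromorphicAt (fun z : ℂ => (z - μ) * (p.W z)⁻¹ k l) μ := by
    intro k l
    have h1 := p.meromorphicAt_mul_inv_W (ζ := fun _ => 1) (fun i j => differentiable_const _) k l μ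
    simp only [Matrix.one_mul] at h1
    exact (by fun_prop : MeromorphicAt (fun z : ℂ => z - μ) (μ : ℂ)).mul h1
  have hlim : ∀ k l, ∃ c, Tendsto (fun z : ℂ => (z - μ) * (p.W z)⁻¹ k l) (𝓝[≠] (μ : ℂ)) (𝓝 c) := by
    intro k l
    -- On the vertical segment above `μ` one has `|z - μ| = Im z`, exactly the factor in the bound
    -- for `W⁻¹`; the constant comes from `1 + ‖z‖ ≤ 2 + |μ|`.
    refine tendsto_nhds_of_meromorphicOrderAt_nonneg (hmer k l)
      (meromorphicOrderAt_nonneg_of_bounded (C := C * (2 + |μ|) ^ 3) fun t ht ht1 => ?_)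
    have him : ((μ : ℂ) + t * Complex.I).im = t := by simp
    have h := hC (μ + t * Complex.I) (by rw [him]; exact ht.ne') k l
    rw [him, abs_of_pos ht] at h
    have hn : ‖(μ : ℂ) + t * Complex.I‖ ≤ |μ| + 1 := by
      refine (norm_add_le _ _).trans ?_
      simp only [Complex.norm_real, norm_mul, Complex.norm_I, mul_one, Real.norm_eq_abs,
        abs_of_pos ht]
      linarith
    rw [add_sub_cancel_left, norm_mul, norm_mul, Complex.norm_I, mul_one, Complex.norm_real,
      Real.norm_eq_abs, abs_of_pos ht]
    exact h.trans (mul_le_mul_of_nonneg_left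
      (pow_le_pow_left₀ (by positivity) (by linarith) 3) hC0.le)
  choose R hR using hlim
  refine ⟨Matrix.of R, hR, ?_⟩
  ext i l
  have h1 : Tendsto (fun z : ℂ => ∑ k, p.W z i k * ((z - μ) * (p.W z)⁻¹ k l)) (𝓝[≠] (μ : ℂ))
      (𝓝 (∑ k, p.W μ i k * R k l)) :=
    tendsto_finsetSum _ fun k _ => (((p.differentiable_W i k).continuous.tendsto _).mono_left
      nhdsWithin_le_nhds).mul (hR k l)
  have h2 : Tendsto (fun z : ℂ => (z - μ) * (1 : Matrix (Fin N) (Fin N) ℂ) i l) (𝓝[≠] (μ : ℂ))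
      (𝓝 0) := by
    have : Continuous fun z : ℂ => (z - μ) * (1 : Matrix (Fin N) (Fin N) ℂ) i l := by fun_prop
    have h3 := this.tendsto (μ : ℂ)
    rw [sub_self, zero_mul] at h3
    exact h3.mono_left nhdsWithin_le_nhds
  -- Pass to the limit in `W(z) · (z - μ) W(z)⁻¹ = (z - μ) I`.
  have h3 := h1.congr' (f₂ := fun z : ℂ => (z - μ) * (1 : Matrix (Fin N) (Fin N) ℂ) i l) (by
    filter_upwards [p.eventually_isUnit_det_W μ] with z hz
    rw [← Matrix.mul_nonsing_inv _ hz, Matrix.mul_apply, Finset.mul_sum]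
    exact Finset.sum_congr rfl fun k _ => by ring)
  simpa [Matrix.mul_apply] using tendsto_nhds_unique h3 h2

/-- The columns of `R` lie in `Ker W(μ)`, so `P R = R`. The determinant condition makes `μ` an
eigenvalue, so the hypothesis on `ζ` is available there. -/
theorem mul_eq_zero_of_W_mul_eq_zero {m : ℕ} {ζ : ℂ → Matrix (Fin m) (Fin N) ℂ}
    (hζ : ∀ τ ∈ p.spectralData, ζ τ.μ * τ.P = 0) {μ : ℝ} (hμ : (p.W μ).det = 0)
    {R : Matrix (Fin N) (Fin N) ℂ} (hR : p.W μ * R = 0) : ζ μ * R = 0 := by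
  obtain ⟨v, hv, hWv⟩ := Matrix.exists_mulVec_eq_zero_iff.2 hμ
  have hev : p.IsEigenvalue μ := p.isEigenvalue_of_op_W_eq_zero (v := WithLp.toLp 2 v)
    (fun h => hv ((WithLp.toLp_eq_zero 2).1 h)) (by rw [op_apply, WithLp.ofLp_toLp, hWv]; rfl)
  have h := hζ ⟨μ, p.E μ, p.g μ⟩ ⟨μ, hev, rfl⟩
  set P := SpectralTriple.P ⟨μ, p.E μ, p.g μ⟩ with hP
  have hPR : P * R = R := by
    ext i l
    set r : EuclideanSpace ℂ (Fin N) := WithLp.toLp 2 fun k => R k l with hr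
    have hmem : r ∈ p.E μ := by
      rw [E, LinearMap.mem_ker]
      ext k
      exact congrFun (congrFun hR k) l
    have h1 : Matrix.toEuclideanLin P r = r := by
      rw [hP, SpectralTriple.P, LinearEquiv.apply_symm_apply]
      exact Submodule.starProjection_eq_self_iff.2 hmem
    exact congrArg (coord i) h1
  rw [← hPR, ← Matrix.mul_assoc]
  exact (congrArg (· * R) h).trans (Matrix.zero_mul R)

/-- Only real zeros of `det W` matter. There `(z - μ) ζ W⁻¹` tends to `ζ(μ) R = 0`, hence has
positive order, and removing the simple factor `z - μ` costs exactly one. -/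
theorem meromorphicOrderAt_mul_inv_W_nonneg {m : ℕ} {ζ : ℂ → Matrix (Fin m) (Fin N) ℂ}
    (hζ : IsEntire ζ) (hζP : ∀ τ ∈ p.spectralData, ζ τ.μ * τ.P = 0) (i : Fin m) (j : Fin N)
    (z₀ : ℂ) : 0 ≤ meromorphicOrderAt (fun z => (ζ z * (p.W z)⁻¹) i j) z₀ := by
  by_cases hdet : (p.W z₀).det = 0
  swap
  · exact (p.analyticAt_mul_inv_W hζ i j hdet).meromorphicOrderAt_nonneg
  have him : z₀.im = 0 := by
    by_contra him
    exact p.det_W_ne_zero him hdet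
  obtain ⟨μ, rfl⟩ : ∃ μ : ℝ, z₀ = μ := ⟨z₀.re, Complex.ext rfl him⟩
  obtain ⟨R, hR, hWR⟩ := p.exists_tendsto_sub_mul_inv_W μ
  have hζR := p.mul_eq_zero_of_W_mul_eq_zero hζP hdet hWR
  have h1 : Tendsto (fun z : ℂ => ∑ k, ζ z i k * ((z - μ) * (p.W z)⁻¹ k j)) (𝓝[≠] (μ : ℂ))
      (𝓝 (∑ k, ζ μ i k * R k j)) :=
    tendsto_finsetSum _ fun k _ => (((hζ i k).continuous.tendsto _).mono_left
      nhdsWithin_le_nhds).mul (hR k j)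
  rw [← Matrix.mul_apply, hζR, Matrix.zero_apply] at h1
  have h2 : Tendsto (fun z : ℂ => (z - μ) * (ζ z * (p.W z)⁻¹) i j) (𝓝[≠] (μ : ℂ)) (𝓝 0) := by
    refine h1.congr fun z => ?_
    rw [Matrix.mul_apply, Finset.mul_sum]
    exact Finset.sum_congr rfl fun k _ => by ring
  have hmer := p.meromorphicAt_mul_inv_W hζ i j μ
  have hlin : MeromorphicAt (fun z : ℂ => z - μ) (μ : ℂ) := by fun_prop
  have h3 := (tendsto_zero_iff_meromorphicOrderAt_pos (hlin.fun_mul hmer)).1 h2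
  rw [fun_meromorphicOrderAt_mul hlin hmer, meromorphicOrderAt_id_sub_const] at h3
  cases ho : meromorphicOrderAt (fun z => (ζ z * (p.W z)⁻¹) i j) μ with
  | top => exact le_top
  | coe n =>
    rw [ho] at h3
    norm_cast at h3 ⊢
    omega

/-- If an entire `ζ` annihilates the ranges of all spectral projectors, then `ζ W⁻¹` is entire. -/
theorem exists_entire_eq_mul_inv_W {m : ℕ} {ζ : ℂ → Matrix (Fin m) (Fin N) ℂ}
    (hζ : IsEntire ζ) (hζP : ∀ τ ∈ p.spectralData, ζ τ.μ * τ.P = 0) :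
    ∃ η : ℂ → Matrix (Fin m) (Fin N) ℂ, IsEntire η ∧
      ∀ z, IsUnit (p.W z).det → η z = ζ z * (p.W z)⁻¹ := by
  choose η hη heq using fun i j => exists_entire_of_meromorphicOrderAt_nonneg
    (p.meromorphicAt_mul_inv_W hζ i j) (p.meromorphicOrderAt_mul_inv_W_nonneg hζ hζP i j)
  refine ⟨fun z => Matrix.of fun i j => η i j z, hη, fun z hz => ?_⟩
  ext i j
  exact heq i j z (p.analyticAt_mul_inv_W hζ i j hz.ne_zero)

end Problem
-- A Liouville theorem for entire functions of order `1/2`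
section EntireFunctions

open Set

theorem exists_sq_eq_of_im_nonneg {w : ℂ} (hw : 0 ≤ w.im) :
    ∃ z : ℂ, z ^ 2 = w ∧ 0 ≤ z.re ∧ 0 ≤ z.im := by
  obtain ⟨z, hz⟩ := IsAlgClosed.exists_pow_nat_eq w two_pos
  have him : w.im = 2 * (z.re * z.im) := by
    rw [← hz, sq, Complex.mul_im]; ring
  rw [him] at hw
  have h : 0 ≤ z.re * z.im := by linarith
  rcases mul_nonneg_iff.1 h with h | h
  · exact ⟨z, hz, h⟩
  · exact ⟨-z, by rw [neg_sq, hz], by simpa using h.1, by simpa using h.2⟩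

variable {η : ℂ → ℂ}

/-- A bound with a factor `1 / |Im z|` for an entire function can be extended across the real
axis. -/
theorem exists_norm_le_of_abs_im_mul_norm_le (hη : Differentiable ℂ η) {C B : ℝ} (hC : 0 ≤ C)
    (hB : 0 ≤ B) (h : ∀ z : ℂ, z.im ≠ 0 → |z.im| * ‖η z‖ ≤ C * Real.exp (B * √‖z‖)) :
    ∀ z, ‖η z‖ ≤ C * Real.exp (B * (√‖z‖ + 2)) := by
  intro z
  rcases le_or_gt 1 |z.im| with h1 | h1
  · have hz : z.im ≠ 0 := fun h0 => by rw [h0, abs_zero] at h1; linarith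
    calc ‖η z‖ ≤ |z.im| * ‖η z‖ := le_mul_of_one_le_left (norm_nonneg _) h1
      _ ≤ _ := h z hz
      _ ≤ _ := by gcongr; linarith
  -- On the circle `|w - r| = 2` one has `|(w - r)² - 4| = 4 |Im w|`, so this factor cancels the
  -- singular weight. At `z` itself its modulus is `4 + (Im z)² ≥ 4`, and the maximum principle
  -- returns the bound with the same constant.
  · set r : ℂ := (z.re : ℂ) with hr
    have key : ∀ w ∈ frontier (Metric.ball r 2),
        ‖η w * ((w - r) ^ 2 - 4)‖ ≤ 4 * (C * Real.exp (B * (√‖z‖ + 2))) := by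
      intro w hw
      rw [frontier_ball _ two_ne_zero, mem_sphere_iff_norm] at hw
      have him : (w - r).im = w.im := by simp [hr]
      have hsq : (w - r).re ^ 2 + (w - r).im ^ 2 = 4 := by
        have := Complex.sq_norm (w - r)
        rw [hw, Complex.normSq_apply] at this
        nlinarith
      have e : (w - r) ^ 2 - 4 = 2 * Complex.I * (w.im : ℂ) * (w - r) := by
        rw [← him]
        generalize w - r = s at hsq
        apply Complex.ext
        · simp [sq]
          nlinarith
        · simp [sq]
          ring
      have hn : ‖(w - r) ^ 2 - 4‖ = 4 * |w.im| := by
        rw [e, norm_mul, norm_mul, norm_mul, hw, Complex.norm_I, Complex.norm_real]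
        simp
        ring
      rw [norm_mul, hn]
      by_cases hw0 : w.im = 0
      · rw [hw0, abs_zero, mul_zero, mul_zero]; positivity
      · have hwz : ‖w‖ ≤ ‖z‖ + 2 := by
          have h2 : ‖r‖ ≤ ‖z‖ := by
            rw [hr, Complex.norm_real]; exact Complex.abs_re_le_norm z
          calc ‖w‖ = ‖r + (w - r)‖ := by congr 1; ring
            _ ≤ ‖r‖ + ‖w - r‖ := norm_add_le _ _
            _ ≤ _ := by rw [hw]; gcongr
        have hs : √‖w‖ ≤ √‖z‖ + 2 := by
          rw [Real.sqrt_le_left (by positivity)]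
          nlinarith [Real.sq_sqrt (norm_nonneg z), Real.sqrt_nonneg ‖z‖]
        calc _ = 4 * (|w.im| * ‖η w‖) := by ring
          _ ≤ 4 * (C * Real.exp (B * √‖w‖)) := mul_le_mul_of_nonneg_left (h w hw0) (by norm_num)
          _ ≤ _ := by gcongr
    have hd : Differentiable ℂ fun w => η w * ((w - r) ^ 2 - 4) := by fun_prop
    have hzr : z - r = (z.im : ℂ) * Complex.I := by
      apply Complex.ext <;> simp [hr]
    have hmem : z ∈ closure (Metric.ball r 2) := by
      refine subset_closure ?_
      rw [Metric.mem_ball, dist_eq_norm, hzr, norm_mul, Complex.norm_I, Complex.norm_real, mul_one,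
        Real.norm_eq_abs]
      linarith
    have hmax := Complex.norm_le_of_forall_mem_frontier_norm_le Metric.isBounded_ball
      hd.diffContOnCl key hmem
    have hz4 : (4 : ℝ) ≤ ‖(z - r) ^ 2 - 4‖ := by
      have e : (z - r) ^ 2 - 4 = -((z.im ^ 2 + 4 : ℝ) : ℂ) := by
        rw [hzr, mul_pow, Complex.I_sq]; push_cast; ring
      rw [e, norm_neg, Complex.norm_real, Real.norm_of_nonneg (by positivity)]
      nlinarith
    rw [norm_mul] at hmax
    nlinarith [norm_nonneg (η z)]

/-- The map `z ↦ κ z²` opens the quadrant to a half-plane, and order `1/2` becomes order `1`, below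
the critical order `2` of Phragmén–Lindelöf. Division by `1 + z`, which has modulus at least `1`
there, makes the boundary values bounded; the factor `2` comes from `1 + x ≤ 2 |1 + ix|`. -/
theorem norm_le_of_quadrant (hη : Differentiable ℂ η) {C C' B : ℝ} (hC' : 0 ≤ C')
    (hgrowth : ∀ z, ‖η z‖ ≤ C * Real.exp (B * √‖z‖)) {κ : ℂ} (hκ : ‖κ‖ = 2)
    (h1 : ∀ x : ℝ, 0 ≤ x → ‖η (κ * x ^ 2)‖ ≤ C' * (1 + x))
    (h2 : ∀ x : ℝ, 0 ≤ x → ‖η (-κ * x ^ 2)‖ ≤ C' * (1 + x)) {z : ℂ} (hre : 0 ≤ z.re)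
    (him : 0 ≤ z.im) : ‖η (κ * z ^ 2)‖ ≤ 2 * C' * (1 + ‖z‖) := by
  have hone : ∀ w : ℂ, 0 ≤ w.re → 1 ≤ ‖1 + w‖ := fun w hw => by
    have := Complex.re_le_norm (1 + w)
    simp only [Complex.add_re, Complex.one_re] at this
    linarith
  have hne : ∀ w : ℂ, 0 ≤ w.re → 1 + w ≠ 0 := fun w hw =>
    norm_pos_iff.1 (one_pos.trans_le (hone w hw))
  have hcl : ∀ w ∈ closure (Ioi (0 : ℝ) ×ℂ Ioi 0), 0 ≤ w.re := fun w hw => by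
    rw [Complex.closure_reProdIm, closure_Ioi] at hw
    exact hw.1
  have hd1 : Differentiable ℂ fun w => η (κ * w ^ 2) := by fun_prop
  have hd2 : Differentiable ℂ fun w : ℂ => 1 + w := by fun_prop
  have hd : DiffContOnCl ℂ (fun w => (1 + w)⁻¹ • η (κ * w ^ 2)) (Ioi 0 ×ℂ Ioi 0) :=
    (hd2.diffContOnCl.inv fun w hw => hne w (hcl w hw)).smul hd1.diffContOnCl
  have hPL := PhragmenLindelof.quadrant_I (C := 2 * C') hd ⟨1, one_lt_two, B * √2, ?_⟩ ?_ ?_ hre him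
  · rw [norm_smul, norm_inv, inv_mul_le_iff₀ (one_pos.trans_le (hone z hre))] at hPL
    calc _ ≤ ‖1 + z‖ * (2 * C') := hPL
      _ ≤ (1 + ‖z‖) * (2 * C') := by
          gcongr
          simpa using norm_add_le 1 z
      _ = _ := by ring
  · refine IsBigO.of_bound C ?_
    rw [eventually_inf_principal]
    refine .of_forall fun w hw => ?_
    have hw0 : 0 ≤ w.re := (le_of_lt hw.1)
    rw [norm_smul, norm_inv, Real.norm_of_nonneg (Real.exp_pos _).le, Real.rpow_one]
    have h3 := hgrowth (κ * w ^ 2)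
    rw [norm_mul, norm_pow, hκ, Real.sqrt_mul zero_le_two, Real.sqrt_sq (norm_nonneg _),
      ← mul_assoc] at h3
    refine le_trans ?_ h3
    exact mul_le_of_le_one_left (norm_nonneg _) (inv_le_one_of_one_le₀ (hone w hw0))
  · intro x hx
    have : ‖1 + (x : ℂ)‖ = 1 + x := by
      rw [← Complex.ofReal_one, ← Complex.ofReal_add, Complex.norm_real,
        Real.norm_of_nonneg (by positivity)]
    rw [norm_smul, norm_inv, this, inv_mul_le_iff₀ (by positivity)]
    have := h1 x hx
    nlinarith
  · intro x hx
    have e : κ * ((x : ℂ) * Complex.I) ^ 2 = -κ * x ^ 2 := by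
      rw [mul_pow, Complex.I_sq]; ring
    have hn1 : 1 ≤ ‖1 + (x : ℂ) * Complex.I‖ := hone _ (by simp)
    have hn2 : x ≤ ‖1 + (x : ℂ) * Complex.I‖ := by
      have := Complex.im_le_norm (1 + (x : ℂ) * Complex.I)
      simpa using this
    rw [e, norm_smul, norm_inv, inv_mul_le_iff₀ (by linarith)]
    have := h2 x hx
    nlinarith

/-- Cauchy's estimate on the circle of radius `n²` about `z` bounds the derivative by a multiple of
`n / n²`. Square radii keep the square roots explicit. -/
theorem deriv_eq_zero_of_sqrt_growth (hη : Differentiable ℂ η) {C : ℝ} (hC : 0 ≤ C)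
    (h : ∀ z, ‖η z‖ ≤ C * (1 + √‖z‖)) (z : ℂ) : deriv η z = 0 := by
  have key : ∀ n : ℕ, 0 < n → ‖deriv η z‖ * n ≤ C * (2 + √‖z‖) := by
    intro n hn
    have hn' : (1 : ℝ) ≤ n := by exact_mod_cast hn
    have hR : (0 : ℝ) < (n : ℝ) ^ 2 := by positivity
    have h1 := Complex.norm_deriv_le_of_forall_mem_sphere_norm_le hR hη.diffContOnCl
      (c := z) (C := C * (1 + (√‖z‖ + n))) fun w hw => by
        refine (h w).trans ?_
        have hw' : ‖w‖ ≤ ‖z‖ + (n : ℝ) ^ 2 := by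
          rw [mem_sphere_iff_norm] at hw
          calc ‖w‖ = ‖z + (w - z)‖ := by congr 1; ring
            _ ≤ _ := norm_add_le _ _
            _ = _ := by rw [hw]
        have hs : √‖w‖ ≤ √‖z‖ + n := by
          rw [Real.sqrt_le_left (by positivity)]
          nlinarith [Real.sq_sqrt (norm_nonneg z), Real.sqrt_nonneg ‖z‖]
        gcongr
    rw [le_div_iff₀ hR] at h1
    have h2 : ‖deriv η z‖ * n * n ≤ C * (2 + √‖z‖) * n := by
      calc _ = ‖deriv η z‖ * (n : ℝ) ^ 2 := by ring
        _ ≤ C * (1 + (√‖z‖ + n)) := h1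
        _ ≤ C * ((2 + √‖z‖) * n) := by
            gcongr
            nlinarith [Real.sqrt_nonneg ‖z‖]
        _ = _ := by ring
    exact le_of_mul_le_mul_right h2 (by positivity)
  by_contra hne
  have hpos : 0 < ‖deriv η z‖ := norm_pos_iff.2 hne
  obtain ⟨n, hn⟩ := exists_nat_gt (C * (2 + √‖z‖) / ‖deriv η z‖)
  have hn0 : 0 < n := by
    have : (0 : ℝ) < n := lt_of_le_of_lt (by positivity) hn
    exact_mod_cast this
  have := key n hn0
  rw [div_lt_iff₀ hpos] at hn
  linarith

/-- An entire function of order `1/2` and finite type (up to a factor `1 / |Im z|`) which is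
`O(|z|^{1/2})` on the imaginary axis is constant. -/
theorem eq_const_of_growth (hη : Differentiable ℂ η) {C B C' : ℝ} (hC : 0 ≤ C) (hB : 0 ≤ B)
    (h : ∀ z : ℂ, z.im ≠ 0 → |z.im| * ‖η z‖ ≤ C * Real.exp (B * √‖z‖))
    (h1 : ∀ᶠ y : ℝ in atTop, ‖η (2 * Complex.I * y ^ 2)‖ ≤ C' * y)
    (h2 : ∀ᶠ y : ℝ in atTop, ‖η (-(2 * Complex.I) * y ^ 2)‖ ≤ C' * y) (z : ℂ) : η z = η 0 := by
  -- Compactness of the initial segment extends the bound to the whole ray.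
  have ext : ∀ κ : ℂ, (∀ᶠ y : ℝ in atTop, ‖η (κ * y ^ 2)‖ ≤ C' * y) →
      ∃ D : ℝ, 0 ≤ D ∧ ∀ x : ℝ, 0 ≤ x → ‖η (κ * x ^ 2)‖ ≤ D * (1 + x) := by
    intro κ hκ
    obtain ⟨Y, hY⟩ := eventually_atTop.1 hκ
    obtain ⟨M, hM⟩ := (isCompact_Icc (a := (0 : ℝ)) (b := Y)).exists_bound_of_continuousOn
      (f := fun y : ℝ => η (κ * y ^ 2)) (Continuous.continuousOn
        (hη.continuous.comp (by fun_prop)))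
    refine ⟨max 0 (max M C'), le_max_left _ _, fun x hx => ?_⟩
    have hD0 : 0 ≤ max 0 (max M C') := le_max_left _ _
    rcases le_total x Y with hxY | hxY
    · have hMD : M ≤ max 0 (max M C') := (le_max_left _ _).trans (le_max_right _ _)
      have := hM x ⟨hx, hxY⟩
      nlinarith
    · have hCD : C' ≤ max 0 (max M C') := (le_max_right _ _).trans (le_max_right _ _)
      have := hY x hxY
      nlinarith
  obtain ⟨D₁, hD₁, hb₁⟩ := ext _ h1
  obtain ⟨D₂, hD₂, hb₂⟩ := ext _ h2
  set D := max D₁ D₂ with hDdef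
  have hD0 : 0 ≤ D := hD₁.trans (le_max_left _ _)
  have hb₁' : ∀ x : ℝ, 0 ≤ x → ‖η (2 * Complex.I * x ^ 2)‖ ≤ D * (1 + x) := fun x hx =>
    (hb₁ x hx).trans (by gcongr; exact le_max_left _ _)
  have hb₂' : ∀ x : ℝ, 0 ≤ x → ‖η (-(2 * Complex.I) * x ^ 2)‖ ≤ D * (1 + x) := fun x hx =>
    (hb₂ x hx).trans (by gcongr; exact le_max_right _ _)
  have hg := exists_norm_le_of_abs_im_mul_norm_le hη hC hB h
  have hgrowth : ∀ w, ‖η w‖ ≤ C * Real.exp (B * 2) * Real.exp (B * √‖w‖) := fun w => by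
    refine (hg w).trans (le_of_eq ?_)
    rw [mul_assoc, ← Real.exp_add]; ring_nf
  -- The quadrant covers the half-plane `Re w ≤ 0` for `κ = 2i` and `Re w ≥ 0` for `κ = -2i`.
  have hroot : ∀ w κ : ℂ, ‖κ‖ = 2 → 0 ≤ (w / κ).im →
      ∃ s : ℂ, κ * s ^ 2 = w ∧ 0 ≤ s.re ∧ 0 ≤ s.im ∧ ‖s‖ ≤ √‖w‖ := by
    intro w κ hκ hw
    obtain ⟨s, hs, hre, him⟩ := exists_sq_eq_of_im_nonneg hw
    have hκ0 : κ ≠ 0 := norm_pos_iff.1 (by rw [hκ]; exact two_pos)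
    have hsw : κ * s ^ 2 = w := by rw [hs, mul_div_cancel₀ _ hκ0]
    refine ⟨s, hsw, hre, him, Real.le_sqrt_of_sq_le ?_⟩
    rw [← hsw, norm_mul, norm_pow, hκ]
    nlinarith [sq_nonneg ‖s‖]
  have hn1 : ‖2 * Complex.I‖ = 2 := by simp
  have hn2 : ‖-(2 * Complex.I)‖ = 2 := by simp
  have hbound : ∀ w, ‖η w‖ ≤ 2 * D * (1 + √‖w‖) := by
    intro w
    rcases le_total w.re 0 with hw | hw
    · obtain ⟨s, hs, hre, him, hn⟩ := hroot w (2 * Complex.I) hn1 (by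
        rw [div_mul_eq_div_div, Complex.div_I]
        simp
        linarith)
      rw [← hs]
      refine (norm_le_of_quadrant hη hD0 hgrowth hn1 hb₁' hb₂' hre him).trans ?_
      rw [hs]
      gcongr
    · obtain ⟨s, hs, hre, him, hn⟩ := hroot w (-(2 * Complex.I)) hn2 (by
        rw [div_neg, div_mul_eq_div_div, Complex.div_I]
        simp
        linarith)
      rw [← hs]
      refine (norm_le_of_quadrant hη hD0 hgrowth hn2 hb₂' (by simpa using hb₁') hre him).trans ?_
      rw [hs]
      gcongr
  exact is_const_of_deriv_eq_zero hη
    (deriv_eq_zero_of_sqrt_growth hη (by positivity) hbound) z 0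

end EntireFunctions
-- Lower bounds for `W(k²)` in the upper half-plane
variable {N : ℕ}

theorem norm_sub_apply_le_of_isStarProjection
    {T : EuclideanSpace ℂ (Fin N) →L[ℂ] EuclideanSpace ℂ (Fin N)} (hT : IsStarProjection T)
    (x : EuclideanSpace ℂ (Fin N)) : ‖x - T x‖ ≤ ‖x‖ :=
  norm_apply_le_of_isStarProjection hT.one_sub x

theorem norm_smul_add_smul_le
    {T : EuclideanSpace ℂ (Fin N) →L[ℂ] EuclideanSpace ℂ (Fin N)} (hT : IsStarProjection T)
    {α β : ℂ} {c : ℝ} (hα : ‖α‖ ≤ c) (hβ : ‖β‖ ≤ c) (x : EuclideanSpace ℂ (Fin N)) :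
    ‖α • (x - T x) + β • T x‖ ≤ 2 * c * ‖x‖ := by
  have hc : 0 ≤ c := (norm_nonneg _).trans hα
  refine (norm_add_le _ _).trans ?_
  rw [norm_smul, norm_smul]
  have h1 := norm_sub_apply_le_of_isStarProjection hT x
  have h2 := norm_apply_le_of_isStarProjection hT x
  calc _ ≤ c * ‖x‖ + c * ‖x‖ := by gcongr
    _ = _ := by ring

/-- The inverse of `(1 - T) + α T` is `(1 - T) + α⁻¹ T`, which has norm at most `2`. -/
theorem norm_le_two_mul_norm_sub_add_smul
    {T : EuclideanSpace ℂ (Fin N) →L[ℂ] EuclideanSpace ℂ (Fin N)} (hT : IsStarProjection T)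
    {α : ℂ} (hα : ‖α‖ = 1) (x : EuclideanSpace ℂ (Fin N)) :
    ‖x‖ ≤ 2 * ‖(x - T x) + α • T x‖ := by
  have hTT : T (T x) = T x := by rw [← mul_apply_eq_comp, hT.isIdempotentElem.eq]
  have hα0 : α ≠ 0 := norm_pos_iff.1 (by rw [hα]; exact one_pos)
  set y := (x - T x) + α • T x with hy
  have hTy : T y = α • T x := by
    simp only [hy, map_add, map_sub, map_smul, hTT, sub_self, zero_add]
  have e : x = (1 : ℂ) • (y - T y) + α⁻¹ • T y := by
    rw [hTy, inv_smul_smul₀ hα0, one_smul, hy]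
    abel
  calc ‖x‖ = ‖(1 : ℂ) • (y - T y) + α⁻¹ • T y‖ := congrArg _ e
    _ ≤ 2 * 1 * ‖y‖ := norm_smul_add_smul_le hT (by simp) (by rw [norm_inv, hα, inv_one]) y
    _ = _ := by ring

namespace Problem

variable (p : Problem N)

/-- Here `q - iP` is of size `e^{-Im k}` and `q + iP` of size `e^{Im k}`. So `P` is large, and the
leading term is `(1 - Tp) P - i Tp P`, an invertible image of `P`, up to a small error. With `Im k ≥
6` one has `e^{Im k} ≥ 7`, enough to absorb that error. -/
theorem exp_mul_norm_le_norm_leadingTerm {k : ℂ} (hk : 6 ≤ k.im)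
    (w : EuclideanSpace ℂ (Fin N)) :
    Real.exp k.im * ‖w‖ ≤ 16 * ‖p.leadingTerm k w‖ := by
  obtain ⟨hT, hS⟩ := p.star_projections
  set P := -Complex.sin k • (w - op p.Tm w) + Complex.cos k • op p.Tm w with hP
  set q := Complex.cos k • (w - op p.Tm w) + Complex.sin k • op p.Tm w with hq
  have hL : p.leadingTerm k w = P - op p.Tp P - op p.Tp q := rfl
  have he1 : Complex.exp (Complex.I * k) = Complex.cos k + Complex.I * Complex.sin k := by
    rw [mul_comm, Complex.exp_mul_I]; ring
  have he2 : Complex.exp (-(Complex.I * k)) = Complex.cos k - Complex.I * Complex.sin k := by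
    rw [← mul_neg, mul_comm, Complex.exp_mul_I, Complex.cos_neg, Complex.sin_neg]; ring
  have hI : Complex.I * Complex.I = -1 := Complex.I_mul_I
  have h1 : q - Complex.I • P = Complex.exp (Complex.I * k) • (w - op p.Tm w) +
      (-Complex.I * Complex.exp (Complex.I * k)) • op p.Tm w := by
    rw [he1, hq, hP]
    match_scalars <;> first | ring1 | linear_combination Complex.sin k * hI
  have h2 : q + Complex.I • P = Complex.exp (-(Complex.I * k)) •
      ((w - op p.Tm w) + Complex.I • op p.Tm w) := by
    rw [he2, hq, hP]
    match_scalars <;> first | ring1 | linear_combination Complex.sin k * hI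
  have hn1 : ‖Complex.exp (Complex.I * k)‖ = Real.exp (-k.im) := by
    rw [Complex.norm_exp]; simp
  have hn2 : ‖Complex.exp (-(Complex.I * k))‖ = Real.exp k.im := by
    rw [Complex.norm_exp]; simp
  have hm : ‖q - Complex.I • P‖ ≤ 2 * Real.exp (-k.im) * ‖w‖ := by
    rw [h1]
    exact norm_smul_add_smul_le hT hn1.le (by
      rw [norm_mul, norm_neg, Complex.norm_I, one_mul, hn1]) w
  have hp : Real.exp k.im * ‖w‖ ≤ 2 * ‖q + Complex.I • P‖ := by
    rw [h2, norm_smul, hn2]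
    nlinarith [norm_le_two_mul_norm_sub_add_smul hT Complex.norm_I w, Real.exp_pos k.im]
  have hPn : ‖q + Complex.I • P‖ ≤ ‖q - Complex.I • P‖ + 2 * ‖P‖ := by
    have e : q + Complex.I • P = (q - Complex.I • P) + (2 * Complex.I) • P := by
      match_scalars <;> ring
    rw [e]
    refine (norm_add_le _ _).trans ?_
    rw [norm_smul]
    simp
  have hPL : ‖P‖ ≤ 2 * (‖p.leadingTerm k w‖ + ‖q - Complex.I • P‖) := by
    refine (norm_le_two_mul_norm_sub_add_smul hS (α := -Complex.I) (by simp) P).trans ?_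
    have e : (P - op p.Tp P) + -Complex.I • op p.Tp P =
        p.leadingTerm k w + op p.Tp (q - Complex.I • P) := by
      rw [hL, map_sub, map_smul, neg_smul]
      abel
    rw [e]
    gcongr
    exact (norm_add_le _ _).trans (by
      gcongr
      exact norm_apply_le_of_isStarProjection hS _)
  have hexp : 7 ≤ Real.exp k.im := by linarith [Real.add_one_le_exp k.im]
  have hexp' : Real.exp (-k.im) ≤ 1 / 7 := by
    rw [Real.exp_neg, ← one_div]
    exact one_div_le_one_div_of_le (by norm_num) hexp
  have hw := norm_nonneg w
  have hm' : ‖q - Complex.I • P‖ ≤ 2 / 7 * ‖w‖ := hm.trans (by gcongr; linarith)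
  have h7 : 7 * ‖w‖ ≤ Real.exp k.im * ‖w‖ := by gcongr
  linarith

/-- Lower bound for `W(k²)` in the upper half-plane of `k`. -/
theorem exists_exp_mul_norm_le_norm_op_W : ∃ K : ℝ, 1 ≤ K ∧ ∀ k : ℂ, K ≤ ‖k‖ → 6 ≤ k.im →
    ∀ v, Real.exp k.im * ‖v‖ ≤ 128 * ‖k‖ * ‖op (p.W (k ^ 2)) v‖ := by
  obtain ⟨C, K, hC, hK, h⟩ := p.exists_norm_sub_leadingTerm_le
  obtain ⟨hT, hS⟩ := p.star_projections
  -- For `|k| ≥ 32 C` the error is at most half of the lower bound `e^{Im k} ‖w‖ / 16`. The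
  -- remaining `1/32`, and a factor `2` for each of the scalings of `v` and of `y`, give `128`.
  refine ⟨max K (32 * C), hK.trans (le_max_left _ _), fun k hk him v => ?_⟩
  have hkK : K ≤ ‖k‖ := (le_max_left _ _).trans hk
  have hkC : 32 * C ≤ ‖k‖ := (le_max_right _ _).trans hk
  have hk1 : 1 ≤ ‖k‖ := hK.trans hkK
  have hkpos : 0 < ‖k‖ := one_pos.trans_le hk1
  have hk0 : k ≠ 0 := norm_pos_iff.1 hkpos
  have hTT : op p.Tm (op p.Tm v) = op p.Tm v := by
    rw [← mul_apply_eq_comp, hT.isIdempotentElem.eq]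
  set w := k • (v - op p.Tm v) + op p.Tm v with hw
  have hTw : op p.Tm w = op p.Tm v := by
    simp only [hw, map_add, map_sub, map_smul, hTT, sub_self, smul_zero, zero_add]
  have hv : k⁻¹ • (w - op p.Tm w) + op p.Tm w = v := by
    rw [hTw, hw, add_sub_cancel_right, inv_smul_smul₀ hk0, sub_add_cancel]
  have hvw : ‖v‖ ≤ 2 * ‖w‖ := by
    have h1 := norm_smul_add_smul_le hT (α := k⁻¹) (β := 1) (c := 1)
      (by rw [norm_inv]; exact inv_le_one_of_one_le₀ hk1) (by simp) w
    rwa [one_smul, hv, mul_one] at h1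
  set y := op (p.W (k ^ 2)) v with hy
  have herr := h k hkK w y (by rw [hv])
  rw [abs_of_nonneg (by linarith : 0 ≤ k.im)] at herr
  have hlow := p.exp_mul_norm_le_norm_leadingTerm him w
  have hY : ‖(y - op p.Tp y) + k • op p.Tp y‖ ≤ 2 * ‖k‖ * ‖y‖ := by
    have h1 := norm_smul_add_smul_le hS (α := 1) (β := k) (c := ‖k‖) (by simpa using hk1) le_rfl y
    rwa [one_smul] at h1
  have herr' : C * Real.exp k.im * ‖w‖ / ‖k‖ ≤ Real.exp k.im * ‖w‖ / 32 := by
    rw [div_le_iff₀ hkpos]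
    have : 0 ≤ Real.exp k.im * ‖w‖ := by positivity
    nlinarith
  have htri := norm_sub_norm_le (p.leadingTerm k w) ((y - op p.Tp y) + k • op p.Tp y)
  rw [norm_sub_rev] at htri
  have : Real.exp k.im * ‖v‖ ≤ Real.exp k.im * (2 * ‖w‖) := by gcongr
  linarith

theorem exists_op_W_eq {z : ℂ} (hz : z.im ≠ 0) (x : EuclideanSpace ℂ (Fin N)) :
    ∃ v, op (p.W z) v = x := by
  refine ⟨op (p.W z)⁻¹ x, ?_⟩
  rw [← mul_apply_eq_comp, ← op_mul, Matrix.mul_nonsing_inv _ (p.det_W_ne_zero hz).isUnit, op_one,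
    one_apply_eq_self]

/-- Lower bounds pass from `W` to its adjoint: choosing `v` with `W v = e` gives `‖e‖² = ⟨f, v⟩`,
and `v` is controlled by `e`. -/
theorem norm_le_of_inner_op_eq {e f : EuclideanSpace ℂ (Fin N)} {z : ℂ} (hz : z.im ≠ 0)
    (hef : ∀ v, inner ℂ e (op (p.W z) v) = inner ℂ f v) {a b : ℝ} (ha : 0 ≤ a)
    (hb : 0 ≤ b)
    (hW : ∀ v, a * ‖v‖ ≤ b * ‖op (p.W z) v‖) : a * ‖e‖ ≤ b * ‖f‖ := by
  obtain ⟨v, hv⟩ := p.exists_op_W_eq hz e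
  have h1 := hef v
  rw [hv] at h1
  have h2 : ‖e‖ * ‖e‖ ≤ ‖f‖ * ‖v‖ := by
    calc ‖e‖ * ‖e‖ = ‖inner ℂ e e‖ := by
          rw [inner_self_eq_norm_sq_to_K]; simp [sq]
      _ ≤ _ := by rw [h1]; exact norm_inner_le_norm _ _
  have h3 := hW v
  rw [hv] at h3
  rcases (norm_nonneg e).eq_or_lt with h0 | h0
  · rw [← h0, mul_zero]; positivity
  · refine le_of_mul_le_mul_right ?_ h0
    calc a * ‖e‖ * ‖e‖ = a * (‖e‖ * ‖e‖) := by ring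
      _ ≤ a * (‖f‖ * ‖v‖) := by gcongr
      _ = ‖f‖ * (a * ‖v‖) := by ring
      _ ≤ ‖f‖ * (b * ‖e‖) := by gcongr
      _ = _ := by ring

end Problem
-- The quotient `e` is constant, and then zero
theorem one_add_sq_pow_three_le_exp {s : ℝ} (hs : 0 ≤ s) :
    (1 + s ^ 2) ^ 3 ≤ Real.exp (6 * s) := by
  calc (1 + s ^ 2) ^ 3 ≤ ((1 + s) ^ 2) ^ 3 := by gcongr; nlinarith
    _ = (1 + s) ^ 6 := by ring
    _ ≤ Real.exp s ^ 6 := by gcongr; linarith [Real.add_one_le_exp s]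
    _ = _ := by rw [← Real.exp_nat_mul]; norm_num

/-- A function which decays along the half-line vanishes if it is constant on an arithmetic
progression. -/
theorem eq_zero_of_norm_le_div {F : ℝ → ℂ} {c : ℂ} {D K θ : ℝ}
    (h : ∀ κ, K ≤ κ → ‖F κ‖ ≤ D / κ) (hc : ∀ n : ℕ, F (θ + n * (2 * Real.pi)) = c) : c = 0 := by
  have h1 : Tendsto (fun n : ℕ => θ + n * (2 * Real.pi)) atTop atTop :=
    tendsto_atTop_add_const_left _ _
      (tendsto_natCast_atTop_atTop.atTop_mul_const Real.two_pi_pos)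
  have h2 : Tendsto (fun κ : ℝ => D / κ) atTop (𝓝 0) := tendsto_const_nhds.div_atTop tendsto_id
  have h3 : ‖c‖ ≤ 0 := by
    refine ge_of_tendsto (h2.comp h1) ?_
    filter_upwards [h1.eventually_ge_atTop K] with n hn
    rw [← hc n]
    exact h _ hn
  exact norm_le_zero_iff.1 h3

namespace Problem

variable {N : ℕ} (p : Problem N)

/-- If `e(z)^* W(z) = f(z)^*` with `f` of exponential type in `√z`, then `e` is constant. -/
theorem eq_const_of_inner_op_W {e f : ℂ → EuclideanSpace ℂ (Fin N)}
    (he : ∀ j, Differentiable ℂ fun z => star (e z j))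
    (hef : ∀ z v, inner ℂ (e z) (op (p.W z) v) = inner ℂ (f z) v) {C : ℝ} (hC : 0 ≤ C)
    (hf : ∀ k : ℂ, ‖f (k ^ 2)‖ ≤ C * Real.exp |k.im|) (z : ℂ) : e z = e 0 := by
  obtain ⟨C₁, hC₁, hW₁⟩ := p.exists_norm_le_norm_op_W
  obtain ⟨K, hK, hW₂⟩ := p.exists_exp_mul_norm_le_norm_op_W
  -- The exponent `7` is `6` from the cubic factor of the a priori estimate plus `1` from `f`.
  have hb1 : ∀ z : ℂ, z.im ≠ 0 → |z.im| * ‖e z‖ ≤ C₁ * C * Real.exp (7 * √‖z‖) := by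
    intro z hz
    refine (p.norm_le_of_inner_op_eq hz (hef z) (abs_nonneg _) (by positivity) (hW₁ z)).trans ?_
    obtain ⟨k, rfl⟩ := IsAlgClosed.exists_pow_nat_eq z two_pos
    have h1 : ‖k ^ 2‖ = ‖k‖ ^ 2 := norm_pow _ _
    rw [h1, Real.sqrt_sq (norm_nonneg _)]
    calc C₁ * (1 + ‖k‖ ^ 2) ^ 3 * ‖f (k ^ 2)‖
        ≤ C₁ * Real.exp (6 * ‖k‖) * (C * Real.exp ‖k‖) := by
          gcongr
          · exact one_add_sq_pow_three_le_exp (norm_nonneg _)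
          · exact (hf k).trans (by gcongr; exact Complex.abs_im_le_norm k)
      _ = C₁ * C * (Real.exp (6 * ‖k‖) * Real.exp ‖k‖) := by ring
      _ = _ := by rw [← Real.exp_add]; ring_nf
  -- The factors `e^{Im k}` in the bounds for `W` and `f` cancel; only `|k|` is left.
  have hb2 : ∀ k : ℂ, K ≤ ‖k‖ → 6 ≤ k.im → (k ^ 2).im ≠ 0 →
      ‖e (k ^ 2)‖ ≤ 128 * C * ‖k‖ := by
    intro k hk him him2
    have h1 := p.norm_le_of_inner_op_eq him2 (hef _) (Real.exp_pos k.im).le (by positivity)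
      (hW₂ k hk him)
    have h2 := hf k
    rw [abs_of_nonneg (by linarith : 0 ≤ k.im)] at h2
    refine le_of_mul_le_mul_left ?_ (Real.exp_pos k.im)
    calc _ ≤ 128 * ‖k‖ * ‖f (k ^ 2)‖ := h1
      _ ≤ 128 * ‖k‖ * (C * Real.exp k.im) := by gcongr
      _ = _ := by ring
  have hb3 : ∀ σ : ℝ, |σ| = 1 → ∀ᶠ y : ℝ in atTop,
      ‖e (σ * (2 * Complex.I) * y ^ 2)‖ ≤ 256 * C * y := by
    intro σ hσ
    have hσ2 : (σ : ℂ) ^ 2 = 1 := by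
      have : σ ^ 2 = 1 := by rw [← sq_abs, hσ, one_pow]
      exact_mod_cast this
    filter_upwards [eventually_ge_atTop (max K 6)] with y hy
    have hyK : K ≤ y := (le_max_left _ _).trans hy
    have hy6 : 6 ≤ y := (le_max_right _ _).trans hy
    -- Then `k² = 2iσy²` for `σ = ±1`, so these two rays cover the imaginary axis of `z`.
    set k : ℂ := (σ + Complex.I) * y with hk
    have hk2 : k ^ 2 = σ * (2 * Complex.I) * y ^ 2 := by
      rw [hk]
      linear_combination (y : ℂ) ^ 2 * hσ2 + (y : ℂ) ^ 2 * Complex.I_sq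
    have him : k.im = y := by simp [hk]
    have hkn : ‖k‖ ≤ 2 * y := by
      rw [hk, norm_mul, Complex.norm_real, Real.norm_of_nonneg (by linarith)]
      gcongr
      refine (norm_add_le _ _).trans ?_
      rw [Complex.norm_real, Real.norm_eq_abs, hσ, Complex.norm_I]
      norm_num
    have hkn' : y ≤ ‖k‖ := by
      rw [← him]; exact Complex.im_le_norm k
    have hσ0 : σ ≠ 0 := fun h => by rw [h, abs_zero] at hσ; exact zero_ne_one hσ
    have h1 := hb2 k (hyK.trans hkn') (by rw [him]; exact hy6) (by
      have e1 : k ^ 2 = ((2 * σ * y ^ 2 : ℝ) : ℂ) * Complex.I := by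
        rw [hk2]; push_cast; ring
      rw [e1, Complex.im_ofReal_mul, Complex.I_im, mul_one]
      have : y ≠ 0 := by linarith
      positivity)
    rw [hk2] at h1
    nlinarith
  ext j
  have hnj : ∀ z, ‖star (e z j)‖ ≤ ‖e z‖ := fun z => by
    rw [norm_star]; exact PiLp.norm_apply_le _ j
  have h := eq_const_of_growth (he j) (C' := 256 * C) (B := 7) (by positivity) (by norm_num)
    (fun z hz => le_trans (by gcongr; exact hnj z) (hb1 z hz)) ?_ ?_ z
  · exact star_injective h
  · filter_upwards [hb3 1 (by simp)] with y hy
    refine (hnj _).trans ?_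
    simpa using hy
  · filter_upwards [hb3 (-1) (by simp)] with y hy
    refine (hnj _).trans ?_
    simpa using hy

/-- A constant vector `e` such that `W(κ²)^* e` decays along the positive half-line vanishes. -/
theorem eq_zero_of_inner_op_W {e : EuclideanSpace ℂ (Fin N)} {f : ℝ → EuclideanSpace ℂ (Fin N)}
    (hef : ∀ κ : ℝ, ∀ v, inner ℂ e (op (p.W ((κ : ℂ) ^ 2)) v) = inner ℂ (f κ) v) {D K : ℝ}
    (h1 : ∀ κ, K ≤ κ → ‖f κ - op p.Tm (f κ)‖ ≤ D / κ)
    (h2 : ∀ κ, K ≤ κ → ‖op p.Tm (f κ)‖ ≤ D / κ ^ 2) : e = 0 := by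
  obtain ⟨C, K', hC, hK', hW⟩ := p.exists_norm_sub_leadingTerm_le
  obtain ⟨hT, hS⟩ := p.star_projections
  set P : ℝ → EuclideanSpace ℂ (Fin N) → EuclideanSpace ℂ (Fin N) := fun κ w =>
    -Complex.sin κ • (w - op p.Tm w) + Complex.cos κ • op p.Tm w with hP
  set q : ℝ → EuclideanSpace ℂ (Fin N) → EuclideanSpace ℂ (Fin N) := fun κ w =>
    Complex.cos κ • (w - op p.Tm w) + Complex.sin κ • op p.Tm w with hq
  have hSS : ∀ x, op p.Tp (op p.Tp x) = op p.Tp x := fun x => by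
    rw [← mul_apply_eq_comp, hS.isIdempotentElem.eq]
  -- With `r` the remainder of the asymptotics, the expression inside the norm equals `κ ⟨e, y⟩ =
  -- ⟨(1 - Tm) f, w⟩ + κ ⟨Tm f, w⟩`. The extra `κ` is why `Tm f` must decay one order faster.
  have key : ∀ κ, max K K' ≤ κ → ∀ w, ∃ r : EuclideanSpace ℂ (Fin N), ‖r‖ ≤ C * ‖w‖ / κ ∧
      ‖κ * (inner ℂ (e - op p.Tp e) (P κ w) + inner ℂ (e - op p.Tp e) r) +
        (inner ℂ (op p.Tp e) r - inner ℂ (op p.Tp e) (q κ w))‖ ≤ 2 * D * ‖w‖ / κ := by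
    intro κ hκ w
    have hκ1 : 1 ≤ κ := hK'.trans ((le_max_right _ _).trans hκ)
    have hκ0 : 0 < κ := one_pos.trans_le hκ1
    have hκc : (κ : ℂ) ≠ 0 := by exact_mod_cast hκ0.ne'
    have hn : ‖(κ : ℂ)‖ = κ := by rw [Complex.norm_real, Real.norm_of_nonneg hκ0.le]
    set v := (κ : ℂ)⁻¹ • (w - op p.Tm w) + op p.Tm w with hv
    set y := op (p.W ((κ : ℂ) ^ 2)) v with hy
    set Y := (y - op p.Tp y) + (κ : ℂ) • op p.Tp y with hY
    have herr := hW κ (by rw [hn]; exact (le_max_right _ _).trans hκ) w y rfl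
    rw [hn, Complex.ofReal_im, abs_zero, Real.exp_zero, mul_one] at herr
    refine ⟨Y - p.leadingTerm κ w, herr, ?_⟩
    have hL : p.leadingTerm κ w = P κ w - op p.Tp (P κ w) - op p.Tp (q κ w) := rfl
    have hSin : ∀ x, inner ℂ (op p.Tp e) x = inner ℂ e (op p.Tp x) := fun x =>
      inner_apply_of_isStarProjection hS e x
    have hSout : ∀ x, inner ℂ (e - op p.Tp e) x = inner ℂ e (x - op p.Tp x) := fun x => by
      rw [inner_sub_left, inner_sub_right, hSin]
    have hSY : op p.Tp Y = (κ : ℂ) • op p.Tp y := by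
      simp only [hY, map_add, map_sub, map_smul, hSS, sub_self, zero_add]
    have hSL : op p.Tp (p.leadingTerm κ w) = -op p.Tp (q κ w) := by
      simp only [hL, map_sub, hSS, sub_self, zero_sub]
    have e1 : κ * (inner ℂ (e - op p.Tp e) (P κ w) +
        inner ℂ (e - op p.Tp e) (Y - p.leadingTerm κ w)) +
        (inner ℂ (op p.Tp e) (Y - p.leadingTerm κ w) - inner ℂ (op p.Tp e) (q κ w)) =
        κ * inner ℂ e y := by
      simp only [hSout, hSin, map_sub, hSY, hSL, inner_sub_right, inner_neg_right]
      rw [hY, hL]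
      simp only [inner_sub_right, inner_add_right, inner_smul_right]
      ring
    have hTin : ∀ x y, inner ℂ (op p.Tm x) y = inner ℂ x (op p.Tm y) :=
      inner_apply_of_isStarProjection hT
    have e2 : inner ℂ e y = (κ : ℂ)⁻¹ * inner ℂ (f κ - op p.Tm (f κ)) w +
        inner ℂ (op p.Tm (f κ)) w := by
      rw [hy, hef, hv, inner_add_right, inner_smul_right, inner_sub_left, inner_sub_right, hTin]
    have e3 : κ * inner ℂ e y = inner ℂ (f κ - op p.Tm (f κ)) w +
        κ * inner ℂ (op p.Tm (f κ)) w := by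
      rw [e2, mul_add, mul_inv_cancel_left₀ hκc]
    rw [e1, e3]
    refine (norm_add_le _ _).trans ?_
    rw [norm_mul, hn]
    calc _ ≤ ‖f κ - op p.Tm (f κ)‖ * ‖w‖ + κ * (‖op p.Tm (f κ)‖ * ‖w‖) := by
          gcongr <;> exact norm_inner_le_norm _ _
      _ ≤ D / κ * ‖w‖ + κ * (D / κ ^ 2 * ‖w‖) := by
          gcongr
          · exact h1 κ ((le_max_left _ _).trans hκ)
          · exact h2 κ ((le_max_left _ _).trans hκ)
      _ = _ := by field_simp; ring
  have hpos : ∀ κ, max K K' ≤ κ → 1 ≤ κ := fun κ hκ => hK'.trans ((le_max_right _ _).trans hκ)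
  have hP0 : ∀ (n : ℕ) w, P (0 + n * (2 * Real.pi)) w = op p.Tm w := fun n w => by
    simp only [hP, ← Complex.ofReal_cos, ← Complex.ofReal_sin, Real.sin_add_nat_mul_two_pi,
      Real.cos_add_nat_mul_two_pi, Real.sin_zero, Real.cos_zero]
    simp
  have hP1 : ∀ (n : ℕ) w, P (Real.pi / 2 + n * (2 * Real.pi)) w = -(w - op p.Tm w) := fun n w => by
    simp only [hP, ← Complex.ofReal_cos, ← Complex.ofReal_sin, Real.sin_add_nat_mul_two_pi,
      Real.cos_add_nat_mul_two_pi, Real.sin_pi_div_two, Real.cos_pi_div_two]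
    simp
  have hq0 : ∀ (n : ℕ) w, q (0 + n * (2 * Real.pi)) w = w - op p.Tm w := fun n w => by
    simp only [hq, ← Complex.ofReal_cos, ← Complex.ofReal_sin, Real.sin_add_nat_mul_two_pi,
      Real.cos_add_nat_mul_two_pi, Real.sin_zero, Real.cos_zero]
    simp
  have hq1 : ∀ (n : ℕ) w, q (Real.pi / 2 + n * (2 * Real.pi)) w = op p.Tm w := fun n w => by
    simp only [hq, ← Complex.ofReal_cos, ← Complex.ofReal_sin, Real.sin_add_nat_mul_two_pi,
      Real.cos_add_nat_mul_two_pi, Real.sin_pi_div_two, Real.cos_pi_div_two]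
    simp
  have hqn : ∀ κ w, ‖q κ w‖ ≤ 2 * ‖w‖ := fun κ w => by
    refine (norm_smul_add_smul_le hT (c := 1) ?_ ?_ w).trans_eq (by ring)
    · rw [← Complex.ofReal_cos, Complex.norm_real]; exact Real.abs_cos_le_one κ
    · rw [← Complex.ofReal_sin, Complex.norm_real]; exact Real.abs_sin_le_one κ
  -- Only the first term carries the factor `κ`, and everything else is bounded, so `⟨d, P(κ) d⟩ =
  -- O(1/κ)`. At `2πn` and `π/2 + 2πn` this inner product is constant, equal to `⟨d, Tm d⟩` and
  -- `-⟨d, d - Tm d⟩`; both vanish, hence `d = 0`.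
  have hperp : e - op p.Tp e = 0 := by
    set d := e - op p.Tp e with hd
    have hb : ∀ κ, max K K' ≤ κ → ‖inner ℂ d (P κ d)‖ ≤
        (2 * |D| * ‖d‖ + ‖d‖ * (C * ‖d‖) + ‖op p.Tp e‖ * (C * ‖d‖ + 2 * ‖d‖)) / κ := by
      intro κ hκ
      have hκ1 := hpos κ hκ
      have hκ0 : 0 < κ := one_pos.trans_le hκ1
      obtain ⟨r, hr, hr'⟩ := key κ hκ d
      have hn : ‖(κ : ℂ)‖ = κ := by rw [Complex.norm_real, Real.norm_of_nonneg hκ0.le]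
      rw [le_div_iff₀ hκ0]
      have hrd : κ * ‖r‖ ≤ C * ‖d‖ := by rwa [le_div_iff₀ hκ0, mul_comm] at hr
      have hrd' : ‖r‖ ≤ C * ‖d‖ := (le_mul_of_one_le_left (norm_nonneg _) hκ1).trans hrd
      have e1 : (κ : ℂ) * inner ℂ d (P κ d) =
          (κ * (inner ℂ d (P κ d) + inner ℂ d r) +
            (inner ℂ (op p.Tp e) r - inner ℂ (op p.Tp e) (q κ d))) -
          κ * inner ℂ d r - (inner ℂ (op p.Tp e) r - inner ℂ (op p.Tp e) (q κ d)) := by ring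
      have e2 : ‖inner ℂ d (P κ d)‖ * κ = ‖(κ : ℂ) * inner ℂ d (P κ d)‖ := by
        rw [norm_mul, hn, mul_comm]
      have hD : 2 * D * ‖d‖ / κ ≤ 2 * |D| * ‖d‖ := by
        refine div_le_of_le_mul₀ hκ0.le (by positivity) ?_
        calc 2 * D * ‖d‖ ≤ 2 * |D| * ‖d‖ := by gcongr; exact le_abs_self D
          _ ≤ _ := le_mul_of_one_le_right (by positivity) hκ1
      rw [e2, e1]
      refine (norm_sub_le _ _).trans (add_le_add ((norm_sub_le _ _).trans
        (add_le_add (hr'.trans hD) ?_)) ((norm_sub_le _ _).trans ?_))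
      · rw [norm_mul, hn]
        calc κ * ‖inner ℂ d r‖ ≤ κ * (‖d‖ * ‖r‖) := by gcongr; exact norm_inner_le_norm _ _
          _ = ‖d‖ * (κ * ‖r‖) := by ring
          _ ≤ _ := by gcongr
      · rw [mul_add]
        refine add_le_add ((norm_inner_le_norm _ _).trans (by gcongr))
          ((norm_inner_le_norm _ _).trans (by gcongr; exact hqn κ d))
    have h3 := eq_zero_of_norm_le_div hb fun n => by rw [hP0]
    have h4 := eq_zero_of_norm_le_div hb fun n => by rw [hP1]
    rw [inner_neg_right, neg_eq_zero, inner_sub_right, h3, sub_zero] at h4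
    exact inner_self_eq_zero.1 h4
  have hSe : op p.Tp e = e := (sub_eq_zero.1 hperp).symm
  -- Once the term with the factor `κ` is gone, the full `O(1/κ)` bound reaches `q`, and the same
  -- sampling finishes.
  have hb : ∀ κ, max K K' ≤ κ → ‖inner ℂ e (q κ e)‖ ≤ (2 * D * ‖e‖ + ‖e‖ * (C * ‖e‖)) / κ := by
    intro κ hκ
    have hκ0 : 0 < κ := one_pos.trans_le (hpos κ hκ)
    obtain ⟨r, hr, hr'⟩ := key κ hκ e
    rw [hperp, hSe] at hr'
    simp only [inner_zero_left, add_zero, mul_zero, zero_add] at hr'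
    rw [norm_sub_rev] at hr'
    calc ‖inner ℂ e (q κ e)‖ = ‖(inner ℂ e (q κ e) - inner ℂ e r) + inner ℂ e r‖ := by
          rw [sub_add_cancel]
      _ ≤ 2 * D * ‖e‖ / κ + ‖e‖ * (C * ‖e‖ / κ) := by
          refine (norm_add_le _ _).trans (add_le_add hr' ((norm_inner_le_norm _ _).trans ?_))
          gcongr
      _ = _ := by ring
  have h3 := eq_zero_of_norm_le_div hb fun n => by rw [hq0]
  have h4 := eq_zero_of_norm_le_div hb fun n => by rw [hq1]
  rw [inner_sub_right, h4, sub_zero] at h3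
  exact inner_self_eq_zero.1 h3

end Problem

/-! ### Algebraic nondegeneracy, part (ii) -/

variable {N : ℕ}

theorem SpectralTriple.conjTranspose_P (τ : SpectralTriple N) : τ.Pᴴ = τ.P := by
  have h : op τ.P = τ.E.starProjection := by
    refine ContinuousLinearMap.ext fun x => ?_
    have h1 := LinearMap.congr_fun (Matrix.toEuclideanLin.apply_symm_apply
      (τ.E.starProjection : EuclideanSpace ℂ (Fin N) →ₗ[ℂ] EuclideanSpace ℂ (Fin N))) x
    rwa [← SpectralTriple.P] at h1
  have h1 : star (op τ.P) = op τ.P := by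
    rw [h]
    exact isStarProjection_starProjection.isSelfAdjoint
  refine (Matrix.toEuclideanCLM (n := Fin N) (𝕜 := ℂ)).toEquiv.injective ?_
  exact (map_star (Matrix.toEuclideanCLM (n := Fin N) (𝕜 := ℂ)) τ.P).trans h1

theorem differentiable_star_star {f : ℂ → ℂ} (hf : Differentiable ℂ f) :
    Differentiable ℂ fun z => star (f (star z)) := fun z => by
  have h := (hf (star z)).star_star
  rwa [star_star] at h

/-- The principal root of `k²` is `±k`, and `|Im k|` ignores the sign. On bounded sets continuity
suffices, since the exponential is at least `1`. -/
theorem exists_norm_le_exp_of_isBigO {E : Type*} [NormedAddCommGroup E] {ξ : ℂ → E}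
    (hξ : Continuous ξ)
    (hO : ξ =O[Bornology.cobounded ℂ] fun z => Real.exp |(z ^ (1 / 2 : ℂ)).im|) :
    ∃ C : ℝ, 0 ≤ C ∧ ∀ k : ℂ, ‖ξ (k ^ 2)‖ ≤ C * Real.exp |k.im| := by
  obtain ⟨c, hc⟩ := hO.bound
  obtain ⟨r, -, hr⟩ := hasBasis_cobounded_norm.eventually_iff.1 hc
  obtain ⟨M, hM⟩ := (isCompact_closedBall (0 : ℂ) r).exists_bound_of_continuousOn hξ.continuousOn
  refine ⟨max 0 (max c M), le_max_left _ _, fun k => ?_⟩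
  have h0 : 0 ≤ max 0 (max c M) := le_max_left _ _
  rcases le_total r ‖k ^ 2‖ with h | h
  · have h1 := hr h
    rw [Real.norm_of_nonneg (Real.exp_pos _).le] at h1
    have h2 : ((k ^ 2) ^ (1 / 2 : ℂ)) ^ 2 = k ^ 2 := by
      rw [one_div]; exact Complex.cpow_ofNat_inv_pow _ 2
    have h3 : |((k ^ 2) ^ (1 / 2 : ℂ)).im| = |k.im| := by
      rcases sq_eq_sq_iff_eq_or_eq_neg.1 h2 with h | h
      · rw [h]
      · rw [h, Complex.neg_im, abs_neg]
    rw [h3] at h1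
    refine h1.trans ?_
    gcongr
    exact (le_max_left _ _).trans (le_max_right _ _)
  · refine (hM _ (by simpa using h)).trans ?_
    calc M ≤ max 0 (max c M) := (le_max_right _ _).trans (le_max_right _ _)
      _ ≤ _ := le_mul_of_one_le_right h0 (Real.one_le_exp (abs_nonneg _))

theorem exists_norm_sq_le_of_isBigO {E : Type*} [NormedAddCommGroup E] {f : ℝ → E} {n : ℕ}
    {s : ℝ} (hs : 2 * s = -n) (h : f =O[atTop] fun x : ℝ => x ^ s) :
    ∃ D : ℝ, ∀ᶠ κ : ℝ in atTop, ‖f (κ ^ 2)‖ ≤ D / κ ^ n := by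
  obtain ⟨D, hD⟩ := h.bound
  refine ⟨D, ?_⟩
  filter_upwards [(tendsto_pow_atTop two_ne_zero).eventually hD, eventually_gt_atTop 0] with κ hκ h0
  refine hκ.trans_eq ?_
  rw [Real.norm_of_nonneg (by positivity), ← Real.rpow_natCast_mul h0.le, Nat.cast_ofNat, hs,
    Real.rpow_neg h0.le, Real.rpow_natCast, div_eq_mul_inv]

namespace Problem

variable (p : Problem N)

/-- If `P_α ξ(λ_α) = 0` for all `α`, then `ξ(z̄)^* = e(z)^* W(z)` with an entire `e^*`. -/
theorem exists_inner_op_W_eq {ξ : ℂ → Fin N → ℂ} (hξ : Differentiable ℂ ξ)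
    (hP : ∀ τ ∈ p.spectralData, τ.P *ᵥ ξ τ.μ = 0) :
    ∃ e : ℂ → EuclideanSpace ℂ (Fin N), (∀ j, Differentiable ℂ fun z => star (e z j)) ∧
      ∀ z v, inner ℂ (e z) (op (p.W z) v) = inner ℂ (WithLp.toLp 2 (ξ (star z))) v := by
  -- The double conjugation keeps `ζ` entire. As the eigenvalues are real and the projectors
  -- self-adjoint, `P ξ = 0` becomes `ζ P = 0` there.
  set ζ : ℂ → Matrix (Fin 1) (Fin N) ℂ := fun z => Matrix.of fun _ j => star (ξ (star z) j) with hζ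
  have hζe : IsEntire ζ := fun _ j => differentiable_star_star (differentiable_pi.1 hξ j)
  have hζP : ∀ τ ∈ p.spectralData, ζ τ.μ * τ.P = 0 := by
    intro τ hτ
    ext i j
    have h1 := congrArg star (congrFun (hP τ hτ) j)
    rw [Pi.zero_apply, star_zero, Matrix.mulVec, dotProduct, star_sum] at h1
    rw [Matrix.zero_apply, ← h1, Matrix.mul_apply]
    refine Finset.sum_congr rfl fun l _ => ?_
    have h2 : star (τ.P j l) = τ.P l j := congrFun (congrFun τ.conjTranspose_P l) j
    rw [star_mul, h2]
    simp [hζ]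
  obtain ⟨η, hη, hηW⟩ := p.exists_entire_eq_mul_inv_W hζe hζP
  -- The identity holds off a discrete set and extends by continuity, including to the zeros of `det
  -- W`.
  have hmul : ∀ z, η z * p.W z = ζ z := by
    intro z
    ext i j
    have hc1 : Continuous fun z => (η z * p.W z) i j := (hη.mul p.isEntire_W i j).continuous
    have hc2 : Continuous fun z => ζ z i j := (hζe i j).continuous
    refine tendsto_nhds_unique (l := 𝓝[≠] z)
      ((hc1.tendsto z).mono_left nhdsWithin_le_nhds) ?_
    refine ((hc2.tendsto z).mono_left nhdsWithin_le_nhds).congr' ?_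
    filter_upwards [p.eventually_isUnit_det_W z] with w hw
    rw [hηW w hw, Matrix.mul_assoc, Matrix.nonsing_inv_mul _ hw, Matrix.mul_one]
  refine ⟨fun z => WithLp.toLp 2 fun j => star (η z 0 j), fun j => ?_, fun z v => ?_⟩
  · simpa using hη 0 j
  · have h1 : ∀ x y : EuclideanSpace ℂ (Fin N), inner ℂ x y = star x.ofLp ⬝ᵥ y.ofLp := fun x y => by
      rw [EuclideanSpace.inner_eq_star_dotProduct, dotProduct_comm]
    have h2 : (ζ z).row 0 = (η z).row 0 ᵥ* p.W z := by
      rw [← hmul z]; rfl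
    have h3 : star (fun j => star (η z 0 j)) = (η z).row 0 := by
      funext j; exact star_star _
    rw [h1, h1, op_apply]
    change star (fun j => star (η z 0 j)) ⬝ᵥ (p.W z *ᵥ v.ofLp) = (ζ z).row 0 ⬝ᵥ v.ofLp
    rw [h2, h3, Matrix.dotProduct_mulVec]

theorem algebraicallyNondegenerate : AlgebraicallyNondegenerate p.Tm p.spectralData := by
  intro ξ hξ hP hO h1 h2
  obtain ⟨e, he, hef⟩ := p.exists_inner_op_W_eq hξ hP
  -- The `O`-conditions are stated in the sup norm; this identity map carries them to the Euclidean
  -- norm.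
  set Λ : (Fin N → ℂ) →L[ℂ] EuclideanSpace ℂ (Fin N) :=
    ((PiLp.continuousLinearEquiv 2 ℂ fun _ : Fin N => ℂ).symm :
      (Fin N → ℂ) →L[ℂ] EuclideanSpace ℂ (Fin N)) with hΛ
  have hΛop : ∀ (M : Matrix (Fin N) (Fin N) ℂ) x, op M (Λ x) = Λ (M *ᵥ x) := fun M x => rfl
  obtain ⟨C, hC, hCξ⟩ := exists_norm_le_exp_of_isBigO (Λ.continuous.comp hξ.continuous)
    ((Λ.isBigO_comp ξ _).trans hO)
  have hconst : ∀ z, e z = e 0 := p.eq_const_of_inner_op_W he hef hC fun k => by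
    have h := hCξ (star k)
    rw [← star_pow, Complex.star_def, Complex.conj_im, abs_neg] at h
    exact h
  obtain ⟨D₁, hD₁⟩ := exists_norm_sq_le_of_isBigO (n := 1) (by norm_num)
    ((Λ.isBigO_comp _ _).trans h1)
  obtain ⟨D₂, hD₂⟩ := exists_norm_sq_le_of_isBigO (n := 2) (by norm_num)
    ((Λ.isBigO_comp _ _).trans h2)
  obtain ⟨K, hK⟩ := eventually_atTop.1 ((hD₁.and hD₂).and (eventually_gt_atTop 0))
  have he0 : e 0 = 0 := by
    refine p.eq_zero_of_inner_op_W (f := fun κ => Λ (ξ ((κ ^ 2 : ℝ) : ℂ))) (D := max D₁ D₂)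
      (K := K) (fun κ v => ?_) (fun κ hκ => ?_) fun κ hκ => ?_
    · rw [← hconst, hef]
      simp [hΛ]
    · obtain ⟨⟨h, -⟩, hκ0⟩ := hK κ hκ
      have e1 : Λ (ξ ((κ ^ 2 : ℝ) : ℂ)) - op p.Tm (Λ (ξ ((κ ^ 2 : ℝ) : ℂ))) =
          Λ ((1 - p.Tm) *ᵥ ξ ((κ ^ 2 : ℝ) : ℂ)) := by
        rw [hΛop, ← map_sub, Matrix.sub_mulVec, Matrix.one_mulVec]
      rw [e1]
      refine h.trans ?_
      rw [pow_one]
      gcongr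
      exact le_max_left _ _
    · obtain ⟨⟨-, h⟩, hκ0⟩ := hK κ hκ
      rw [hΛop]
      refine h.trans ?_
      gcongr
      exact le_max_right _ _
  intro z
  have h3 : ∀ v, inner ℂ (WithLp.toLp 2 (ξ z) : EuclideanSpace ℂ (Fin N)) v = 0 := fun v => by
    have h := hef (star z) v
    rw [star_star, hconst, he0, inner_zero_left] at h
    exact h.symm
  exact (WithLp.toLp_eq_zero 2).1 (inner_self_eq_zero.1 (h3 _))

end Problem
end SturmLiouville

/-- (i) `ζ W⁻¹` is entire: `W` is invertible off a closed discrete set, and the function `ζ W⁻¹`,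
defined where `W` is invertible, extends to an entire function. (ii) The spectral data are
algebraically nondegenerate. -/
theorem mainTheorem3 {N : ℕ} (p : SturmLiouville.Problem N) :
    (∀ (m : ℕ) (ζ : ℂ → Matrix (Fin m) (Fin N) ℂ), SturmLiouville.IsEntire ζ →
      (∀ τ ∈ p.spectralData, ζ τ.μ * τ.P = 0) →
      {z : ℂ | IsUnit (p.W z).det} ∈ codiscrete ℂ ∧
      ∃ η : ℂ → Matrix (Fin m) (Fin N) ℂ, SturmLiouville.IsEntire η ∧
        ∀ z, IsUnit (p.W z).det → η z = ζ z * (p.W z)⁻¹) ∧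
    SturmLiouville.AlgebraicallyNondegenerate p.Tm p.spectralData :=
  ⟨fun _ _ hζ hP => ⟨p.isUnit_det_W_mem_codiscrete, p.exists_entire_eq_mul_inv_W hζ hP⟩,
    p.algebraicallyNondegenerate⟩
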